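/- Let $\mathbf k$ be a field and let $H=\bigoplus_{p\ge 0}H^p$ be a connected ($H^0\cong\mathbf k$) biassociative differential graded Hopf algebra over $\mathbf k$, with unit, counit and antipode, product $\mu$, coproduct $\Delta$ and differential $d$ of degree $+1$. All signs follow the Koszul rule with respect to the internal degree; in particular $(f\otimes g)(x\otimes y)=(-1)^{|g||x|}f(x)\otimes g(y)$, permutations of tensor factors are signed, and $\Delta\mu=(\mu\otimes\mu)(2,3)(\Delta\otimes\Delta)$. For $p\ge 0$ and $m,n\ge 1$ let $C^{p,m,n}$ be the space of normalized cochains: $\mathbf k$-linear maps $f:H^{\otimes m}\to H^{\otimes n}$ of degree $p$ that vanish on $a_1\otimes\cdots\otimes a_m$ whenever some $a_i\in H^0$, and whose values lie in $(\bigoplus_{q>0}H^q)^{\otimes n}$. Put $$d_C f=(-1)^p f\circ d_{[m]}-d_{[n]}\circ f,\qquad d_{[r]}=\sum_{i=0}^{r-1}1^{\otimes i}\otimes d\otimes 1^{\otimes (r-1-i)},$$ $$\partial_C f=\lambda^n\circ(1\otimes f)-f\circ\sum_{i=0}^{m-1}(-1)^i\,1^{\otimes i}\otimes\mu\otimes1^{\otimes(m-1-i)}+(-1)^{m+1}\rho^n\circ(f\otimes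 1),$$ $$\delta_C f=(1\otimes f)\circ\lambda_m-\sum_{i=0}^{n-1}(-1)^i\,(1^{\otimes i}\otimes\Delta\otimes1^{\otimes(n-1-i)})\circ f+(-1)^{n+1}(f\otimes 1)\circ\rho_m,$$ where $\lambda^n:H\otimes H^{\otimes n}\to H^{\otimes n}$ and $\rho^n:H^{\otimes n}\otimes H\to H^{\otimes n}$ are the left and right actions of $H$ through the iterated coproduct, given by $\lambda^1=\rho^1=\mu$, $\lambda^{n}=(\mu\otimes\lambda^{n-1})(2,3)(\Delta\otimes1^{\otimes n})$, $\rho^{n}=(\rho^{n-1}\otimes\mu)(n,n+1)(1^{\otimes n}\otimes\Delta)$, and $\lambda_m:H^{\otimes m}\to H\otimes H^{\otimes m}$ and $\rho_m:H^{\otimes m}\to H^{\otimes m}\otimes H$ are the left and right coactions through the iterated product, given by $\lambda_1=\rho_1=\Delta$, $\lambda_{m}=(\mu\otimes1^{\otimes m})(2,3)(\Delta\otimes\lambda_{m-1})$, $\rho_{m}=(1^{\otimes m}\otimes\mu)(m,m+1)(\rho_{m-1}\otimes\Delta)$. Let $\widetilde C^r(H;H;3)=\bigoplus_{p\ge0;\;m,n\ge1;\;p+m+n=r+1}C^{p,m,n}$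 with total differential $D_C=(-1)^{m(n+1)}d_C+(-1)^{n(p+1)}\partial_C+(-1)^{p(m+1)}\delta_C$ on $C^{p,m,n}$, and let $\widetilde H^*_{d.g.h.a.}(H;H;3)$ be its cohomology, the restricted Hochschild–Cartier cohomology of $H$ truncated at degree $0$. A deformation of $(H,d,\mu,\Delta)$ is a differential graded $\mathbf k[[t]]$-Hopf algebra structure on $H[[t]]$ (tensor products over $\mathbf k[[t]]$ being $t$-adically completed, so that $H[[t]]^{\hat\otimes m}=H^{\otimes m}[[t]]$) whose differential, product and coproduct are of the form $d_t=d+td_1+t^2d_2+\cdots$, $\mu_t=\mu+t\mu_1+t^2\mu_2+\cdots$, $\Delta_t=\Delta+t\Delta_1+t^2\Delta_2+\cdots$ with $\mathbf k$-linear coefficients homogeneous of degree $1,0,0$ respectively. Theorem. Suppose $\widetilde H^3_{d.g.h.a.}(H;H;3)=0$. Then for every $2$-cocycle $d_1+\mu_1+\Delta_1\in C^{1,1,1}\oplus C^{0,2,1}\oplus C^{0,1,2}=\widetilde C^2(H;H;3)$, the linear approximation $(d+td_1,\ \mu+t\mu_1,\ \Delta+t\Delta_1)$ extends to a deformation of $H$,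 that is, there is a deformation $(H[[t]],d_t,\mu_t,\Delta_t)$ whose coefficients of $t$ are $d_1$, $\mu_1$, $\Delta_1$. -/

import Mathlib

open scoped TensorProduct

noncomputable section

namespace DGH

universe u v

/-! ### Tensor powers `H^{⊗(i+1)}` -/

section TensorPowers

variable (k : Type u) [Field k] (H : Type v) [AddCommGroup H] [Module k H]

/-- The tensor powers of `H` with at least one factor, as bundled modules:
`TP i` is `H^{⊗(i+1)}`, with `TP 0 = H` and `TP (i+1) = H ⊗ TP i`. -/
def TP : ℕ → ModuleCat.{v} k
  | 0 => ModuleCat.of k H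
  | i + 1 => ModuleCat.of k (H ⊗[k] (TP i : Type v))

/-- `T k H i` is the tensor power `H^{⊗(i+1)}` over `k`; `T k H 0` is `H`. -/
abbrev T (i : ℕ) : Type v := TP k H i

/-- `H^{⊗1} = H`. -/
def single : H ≃ₗ[k] T k H 0 := LinearEquiv.refl k H

/-- `H ⊗ H^{⊗(i+1)} = H^{⊗(i+2)}`. -/
def cons (i : ℕ) : H ⊗[k] T k H i ≃ₗ[k] T k H (i + 1) :=
  LinearEquiv.refl k (H ⊗[k] T k H i)

/-- `H ⊗ H = H^{⊗2}`. -/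
def pair : H ⊗[k] H ≃ₗ[k] T k H 1 :=
  TensorProduct.congr (LinearEquiv.refl k H) (single k H) ≪≫ₗ cons k H 0

/-- The associativity isomorphism `H^{⊗(i+1)} ⊗ H = H^{⊗(i+2)}`. -/
def snoc : (i : ℕ) → T k H i ⊗[k] H ≃ₗ[k] T k H (i + 1)
  | 0 => TensorProduct.congr (single k H).symm (single k H) ≪≫ₗ cons k H 0
  | i + 1 =>
      TensorProduct.congr (cons k H i).symm (LinearEquiv.refl k H) ≪≫ₗ
        TensorProduct.assoc k H (T k H i) H ≪≫ₗ
        TensorProduct.congr (LinearEquiv.refl k H) (snoc i) ≪≫ₗ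
        cons k H (i + 1)

end TensorPowers

/-! ### Gradings and Koszul signs -/

section Graded

variable {k : Type u} [Field k] {H : Type v} [AddCommGroup H] [Module k H]
  (𝒜 : ℕ → Submodule k H)

/-- The subspace of `H^{⊗(i+1)}` of elements of internal degree `q`. -/
def tensorGr : (i : ℕ) → ℕ → Submodule k (T k H i)
  | 0, q => (𝒜 q).map (single k H).toLinearMap
  | i + 1, q => ⨆ ab ∈ Finset.HasAntidiagonal.antidiagonal q,
      (Submodule.map₂ (TensorProduct.mk k H (T k H i)) (𝒜 ab.1) (tensorGr i ab.2)).map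
        (cons k H i).toLinearMap

/-- The span of the tensors `a₁ ⊗ ⋯ ⊗ aᵢ₊₁` such that some factor has degree `0`. -/
def tensorDegenerate : (i : ℕ) → Submodule k (T k H i)
  | 0 => (𝒜 0).map (single k H).toLinearMap
  | i + 1 =>
      (Submodule.map₂ (TensorProduct.mk k H (T k H i)) (𝒜 0) ⊤ ⊔
        Submodule.map₂ (TensorProduct.mk k H (T k H i)) ⊤ (tensorDegenerate i)).map
          (cons k H i).toLinearMap

/-- The span of the tensors `a₁ ⊗ ⋯ ⊗ aᵢ₊₁` all of whose factors are homogeneous of positive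
degree. -/
def tensorPositive : (i : ℕ) → Submodule k (T k H i)
  | 0 => (⨆ q : ℕ, 𝒜 (q + 1)).map (single k H).toLinearMap
  | i + 1 =>
      (Submodule.map₂ (TensorProduct.mk k H (T k H i)) (⨆ q : ℕ, 𝒜 (q + 1))
        (tensorPositive i)).map (cons k H i).toLinearMap

variable [DirectSum.Decomposition 𝒜]

/-- The projection of `H` onto the sum of its components of odd degree. -/
def oddPart : H →ₗ[k] H :=
  DirectSum.toModule k ℕ H (fun i => if Odd i then (𝒜 i).subtype else 0) ∘ₗ
    (DirectSum.decomposeLinearEquiv 𝒜).toLinearMap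

/-- The sign involution `x ↦ (-1)^{|x|} x`. For a map `g` of degree `p`, the Koszul rule
`(f ⊗ g)(x ⊗ y) = (-1)^{p|x|} f x ⊗ g y` says that the graded tensor product of `f` and `g`
is `TensorProduct.map (f ∘ τ^p) g`. -/
def τ : H →ₗ[k] H := LinearMap.id - (2 : k) • oddPart 𝒜

/-- The signed transposition `x ⊗ y ↦ (-1)^{|x||y|} y ⊗ x`. -/
def swap : H ⊗[k] H →ₗ[k] H ⊗[k] H :=
  (TensorProduct.comm k H H).toLinearMap ∘ₗ
    (LinearMap.id - (2 : k) • TensorProduct.map (oddPart 𝒜) (oddPart 𝒜))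

/-- The signed exchange of the two inner factors,
`(a ⊗ x) ⊗ (y ⊗ b) ↦ (-1)^{|x||y|} (a ⊗ y) ⊗ (x ⊗ b)`. -/
def midSwap (A B : Type v) [AddCommGroup A] [Module k A] [AddCommGroup B] [Module k B] :
    (A ⊗[k] H) ⊗[k] (H ⊗[k] B) →ₗ[k] (A ⊗[k] H) ⊗[k] (H ⊗[k] B) :=
  (TensorProduct.tensorTensorTensorComm k A H H B).toLinearMap ∘ₗ
    (LinearMap.id - (2 : k) • TensorProduct.map
      (TensorProduct.map LinearMap.id (oddPart 𝒜))
      (TensorProduct.map (oddPart 𝒜) LinearMap.id))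

end Graded

/-! ### Connected differential graded Hopf algebras over a field -/

/-- A connected biassociative differential graded Hopf algebra over the field `k`, on the graded
vector space `H = ⨁_{p ≥ 0} 𝒜 p`; the differential has degree `+1`. -/
structure DGHopfAlgebra {k : Type u} [Field k] {H : Type v} [AddCommGroup H] [Module k H]
    (𝒜 : ℕ → Submodule k H) [DirectSum.Decomposition 𝒜] where
  d : H →ₗ[k] H
  mul : H ⊗[k] H →ₗ[k] H
  unit : k →ₗ[k] H
  comul : H →ₗ[k] H ⊗[k] H
  counit : H →ₗ[k] k
  antipode : H →ₗ[k] H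
  connected : Nonempty (𝒜 0 ≃ₗ[k] k)
  -- degrees
  d_deg : ∀ p, ∀ x ∈ 𝒜 p, d x ∈ 𝒜 (p + 1)
  mul_deg : ∀ p, ∀ x ∈ tensorGr 𝒜 1 p, mul ((pair k H).symm x) ∈ 𝒜 p
  unit_deg : ∀ c, unit c ∈ 𝒜 0
  comul_deg : ∀ p, ∀ x ∈ 𝒜 p, pair k H (comul x) ∈ tensorGr 𝒜 1 p
  counit_deg : ∀ p, p ≠ 0 → ∀ x ∈ 𝒜 p, counit x = 0
  antipode_deg : ∀ p, ∀ x ∈ 𝒜 p, antipode x ∈ 𝒜 p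
  -- differential graded algebra
  d_comp_d : d ∘ₗ d = 0
  mul_assoc : mul ∘ₗ TensorProduct.map mul LinearMap.id =
    mul ∘ₗ TensorProduct.map LinearMap.id mul ∘ₗ (TensorProduct.assoc k H H H).toLinearMap
  unit_mul : mul ∘ₗ TensorProduct.map unit LinearMap.id ∘ₗ
    (TensorProduct.lid k H).symm.toLinearMap = LinearMap.id
  mul_unit : mul ∘ₗ TensorProduct.map LinearMap.id unit ∘ₗ
    (TensorProduct.rid k H).symm.toLinearMap = LinearMap.id
  d_mul : d ∘ₗ mul =
    mul ∘ₗ (TensorProduct.map d LinearMap.id + TensorProduct.map (τ 𝒜) d)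
  -- differential graded coalgebra
  comul_coassoc : (TensorProduct.assoc k H H H).toLinearMap ∘ₗ
      TensorProduct.map comul LinearMap.id ∘ₗ comul =
    TensorProduct.map LinearMap.id comul ∘ₗ comul
  counit_comul : (TensorProduct.lid k H).toLinearMap ∘ₗ
    TensorProduct.map counit LinearMap.id ∘ₗ comul = LinearMap.id
  comul_counit : (TensorProduct.rid k H).toLinearMap ∘ₗ
    TensorProduct.map LinearMap.id counit ∘ₗ comul = LinearMap.id
  comul_d : comul ∘ₗ d =
    (TensorProduct.map d LinearMap.id + TensorProduct.map (τ 𝒜) d) ∘ₗ comul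
  -- compatibility
  comul_mul : comul ∘ₗ mul =
    TensorProduct.map mul mul ∘ₗ midSwap 𝒜 H H ∘ₗ TensorProduct.map comul comul
  comul_unit : comul ∘ₗ unit =
    TensorProduct.map unit unit ∘ₗ (TensorProduct.lid k k).symm.toLinearMap
  counit_mul : counit ∘ₗ mul =
    (TensorProduct.lid k k).toLinearMap ∘ₗ TensorProduct.map counit counit
  counit_unit : counit ∘ₗ unit = LinearMap.id
  -- antipode, an anti-homomorphism of graded algebras
  antipode_left : mul ∘ₗ TensorProduct.map antipode LinearMap.id ∘ₗ comul = unit ∘ₗ counit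
  antipode_right : mul ∘ₗ TensorProduct.map LinearMap.id antipode ∘ₗ comul = unit ∘ₗ counit
  antipode_mul : antipode ∘ₗ mul = mul ∘ₗ swap 𝒜 ∘ₗ TensorProduct.map antipode antipode

/-! ### The Hochschild–Cartier complex -/

namespace DGHopfAlgebra

variable {k : Type u} [Field k] {H : Type v} [AddCommGroup H] [Module k H]
  {𝒜 : ℕ → Submodule k H} [DirectSum.Decomposition 𝒜] (X : DGHopfAlgebra 𝒜)

/-- The internal differential `∑ 1 ⊗ ⋯ ⊗ d ⊗ ⋯ ⊗ 1` on `H^{⊗(i+1)}`. -/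
def dInt : (i : ℕ) → T k H i →ₗ[k] T k H i
  | 0 => (single k H).toLinearMap ∘ₗ X.d ∘ₗ (single k H).symm.toLinearMap
  | i + 1 => (cons k H i).toLinearMap ∘ₗ
      (TensorProduct.map X.d LinearMap.id + TensorProduct.map (τ 𝒜) (dInt i)) ∘ₗ
      (cons k H i).symm.toLinearMap

/-- The bar differential `∑ (-1)^s 1^{⊗s} ⊗ μ ⊗ 1^{⊗(i-s)} : H^{⊗(i+2)} → H^{⊗(i+1)}`, in its
inductive form `μ ⊗ 1 - 1 ⊗ bar`. -/
def bar : (i : ℕ) → T k H (i + 1) →ₗ[k] T k H i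
  | 0 => (single k H).toLinearMap ∘ₗ X.mul ∘ₗ (pair k H).symm.toLinearMap
  | i + 1 => (cons k H i).toLinearMap ∘ₗ
      (TensorProduct.map X.mul LinearMap.id ∘ₗ
          (TensorProduct.assoc k H H (T k H i)).symm.toLinearMap ∘ₗ
          TensorProduct.map LinearMap.id (cons k H i).symm.toLinearMap -
        TensorProduct.map LinearMap.id (bar i)) ∘ₗ
      (cons k H (i + 1)).symm.toLinearMap

/-- The cobar differential `∑ (-1)^s 1^{⊗s} ⊗ Δ ⊗ 1^{⊗(j-s)} : H^{⊗(j+1)} → H^{⊗(j+2)}`, in its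
inductive form `Δ ⊗ 1 - 1 ⊗ cobar`. -/
def cobar : (j : ℕ) → T k H j →ₗ[k] T k H (j + 1)
  | 0 => (pair k H).toLinearMap ∘ₗ X.comul ∘ₗ (single k H).symm.toLinearMap
  | j + 1 => (cons k H (j + 1)).toLinearMap ∘ₗ
      (TensorProduct.map LinearMap.id (cons k H j).toLinearMap ∘ₗ
          (TensorProduct.assoc k H H (T k H j)).toLinearMap ∘ₗ
          TensorProduct.map X.comul LinearMap.id -
        TensorProduct.map LinearMap.id (cobar j)) ∘ₗ
      (cons k H j).symm.toLinearMap

/-- The left action of `H` on the interior tensor power `H^{⊗(j+1)}`. -/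
def lact : (j : ℕ) → H ⊗[k] T k H j →ₗ[k] T k H j
  | 0 => (single k H).toLinearMap ∘ₗ X.mul ∘ₗ
      TensorProduct.map LinearMap.id (single k H).symm.toLinearMap
  | j + 1 => (cons k H j).toLinearMap ∘ₗ TensorProduct.map X.mul (lact j) ∘ₗ
      midSwap 𝒜 H (T k H j) ∘ₗ
      TensorProduct.map X.comul (cons k H j).symm.toLinearMap

/-- The right action of `H` on the interior tensor power `H^{⊗(j+1)}`. -/
def ract : (j : ℕ) → T k H j ⊗[k] H →ₗ[k] T k H j
  | 0 => (single k H).toLinearMap ∘ₗ X.mul ∘ₗ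
      TensorProduct.map (single k H).symm.toLinearMap LinearMap.id
  | j + 1 => (snoc k H j).toLinearMap ∘ₗ TensorProduct.map (ract j) X.mul ∘ₗ
      midSwap 𝒜 (T k H j) H ∘ₗ
      TensorProduct.map (snoc k H j).symm.toLinearMap X.comul

/-- The left coaction of `H` on the interior tensor power `H^{⊗(i+1)}`. -/
def lcoact : (i : ℕ) → T k H i →ₗ[k] H ⊗[k] T k H i
  | 0 => TensorProduct.map LinearMap.id (single k H).toLinearMap ∘ₗ X.comul ∘ₗ
      (single k H).symm.toLinearMap
  | i + 1 => TensorProduct.map X.mul (cons k H i).toLinearMap ∘ₗ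
      midSwap 𝒜 H (T k H i) ∘ₗ
      TensorProduct.map X.comul (lcoact i) ∘ₗ (cons k H i).symm.toLinearMap

/-- The right coaction of `H` on the interior tensor power `H^{⊗(i+1)}`. -/
def rcoact : (i : ℕ) → T k H i →ₗ[k] T k H i ⊗[k] H
  | 0 => TensorProduct.map (single k H).toLinearMap LinearMap.id ∘ₗ X.comul ∘ₗ
      (single k H).symm.toLinearMap
  | i + 1 => TensorProduct.map (snoc k H i).toLinearMap X.mul ∘ₗ
      midSwap 𝒜 (T k H i) H ∘ₗ
      TensorProduct.map (rcoact i) X.comul ∘ₗ (snoc k H i).symm.toLinearMap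

variable (𝒜) in
/-- The normalized Hochschild–Cartier cochains of tridegree `(p, i+1, j+1)`: the linear maps
`H^{⊗(i+1)} → H^{⊗(j+1)}` of degree `p` that vanish on tensors with a factor of degree `0`, and
whose values have no component with a factor of degree `0`. -/
def cochains (p i j : ℕ) : Submodule k (T k H i →ₗ[k] T k H j) where
  carrier := {f | (∀ q, ∀ x ∈ tensorGr 𝒜 i q, f x ∈ tensorGr 𝒜 j (q + p)) ∧
    (∀ x ∈ tensorDegenerate 𝒜 i, f x = 0) ∧ ∀ x, f x ∈ tensorPositive 𝒜 j}
  add_mem' := fun {f g} hf hg =>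
    ⟨fun q x hx => add_mem (hf.1 q x hx) (hg.1 q x hx),
      fun x hx => by simp [hf.2.1 x hx, hg.2.1 x hx],
      fun x => add_mem (hf.2.2 x) (hg.2.2 x)⟩
  zero_mem' := ⟨fun _ _ _ => zero_mem _, fun _ _ => rfl, fun _ => zero_mem _⟩
  smul_mem' := fun c f hf =>
    ⟨fun q x hx => Submodule.smul_mem _ c (hf.1 q x hx),
      fun x hx => by simp [hf.2.1 x hx],
      fun x => Submodule.smul_mem _ c (hf.2.2 x)⟩

/-- `d_C f = (-1)^p f ∘ d - d ∘ f` on maps `H^{⊗(i+1)} → H^{⊗(j+1)}` of degree `p`. -/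
def dC (p i j : ℕ) : (T k H i →ₗ[k] T k H j) →ₗ[k] (T k H i →ₗ[k] T k H j) where
  toFun f := (-1 : k) ^ p • (f ∘ₗ X.dInt i) - X.dInt j ∘ₗ f
  map_add' f g := by
    simp only [LinearMap.add_comp, LinearMap.comp_add, smul_add]; abel
  map_smul' c f := by
    simp only [LinearMap.smul_comp, LinearMap.comp_smul, smul_sub, RingHom.id_apply,
      smul_comm c]

/-- `∂_C f = λ (1 ⊗ f) - f ∘ bar + (-1)^{m+1} ρ (f ⊗ 1)`, with `m = i + 1` inputs, on maps
`H^{⊗(i+1)} → H^{⊗(j+1)}` of degree `p`. -/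
def barC (p i j : ℕ) : (T k H i →ₗ[k] T k H j) →ₗ[k] (T k H (i + 1) →ₗ[k] T k H j) where
  toFun f := X.lact j ∘ₗ TensorProduct.map (τ 𝒜 ^ p) f ∘ₗ (cons k H i).symm.toLinearMap -
    f ∘ₗ X.bar i +
    (-1 : k) ^ (i + 2) •
      (X.ract j ∘ₗ TensorProduct.map f LinearMap.id ∘ₗ (snoc k H i).symm.toLinearMap)
  map_add' f g := by
    simp only [TensorProduct.map_add_left, TensorProduct.map_add_right, LinearMap.add_comp,
      LinearMap.comp_add, smul_add]; abel
  map_smul' c f := by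
    simp only [TensorProduct.map_smul_left, TensorProduct.map_smul_right, LinearMap.smul_comp,
      LinearMap.comp_smul, smul_sub, smul_add, RingHom.id_apply, smul_comm c]

/-- `δ_C f = (1 ⊗ f) λ - cobar ∘ f + (-1)^{n+1} (f ⊗ 1) ρ`, with `n = j + 1` outputs, on maps
`H^{⊗(i+1)} → H^{⊗(j+1)}` of degree `p`. -/
def cobarC (p i j : ℕ) : (T k H i →ₗ[k] T k H j) →ₗ[k] (T k H i →ₗ[k] T k H (j + 1)) where
  toFun f := (cons k H j).toLinearMap ∘ₗ TensorProduct.map (τ 𝒜 ^ p) f ∘ₗ X.lcoact i -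
    X.cobar j ∘ₗ f +
    (-1 : k) ^ (j + 2) •
      ((snoc k H j).toLinearMap ∘ₗ TensorProduct.map f LinearMap.id ∘ₗ X.rcoact i)
  map_add' f g := by
    simp only [TensorProduct.map_add_left, TensorProduct.map_add_right, LinearMap.add_comp,
      LinearMap.comp_add, smul_add]; abel
  map_smul' c f := by
    simp only [TensorProduct.map_smul_left, TensorProduct.map_smul_right, LinearMap.smul_comp,
      LinearMap.comp_smul, smul_sub, smul_add, RingHom.id_apply, smul_comm c]

variable (k H) in
/-- Families of linear maps `H^{⊗(i+1)} → H^{⊗(j+1)}` indexed by `p, i, j ≥ 0`. -/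
abbrev Family : Type v := ∀ _p i j : ℕ, T k H i →ₗ[k] T k H j

/-- The component of `D_C c` coming from `d_C`, with the sign `(-1)^{m(n+1)}`,
`(m, n) = (i+1, j+1)`. -/
def dTerm (c : Family k H) : Family k H
  | 0, _, _ => 0
  | p + 1, i, j => (-1 : k) ^ ((i + 1) * (j + 2)) • X.dC p i j (c p i j)

/-- The component of `D_C c` coming from `∂_C`, with the sign `(-1)^{n(p+1)}`. -/
def barTerm (c : Family k H) : Family k H
  | _, 0, _ => 0
  | p, i + 1, j => (-1 : k) ^ ((j + 1) * (p + 1)) • X.barC p i j (c p i j)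

/-- The component of `D_C c` coming from `δ_C`, with the sign `(-1)^{p(m+1)}`. -/
def cobarTerm (c : Family k H) : Family k H
  | _, _, 0 => 0
  | p, i, j + 1 => (-1 : k) ^ (p * (i + 2)) • X.cobarC p i j (c p i j)

/-- The total differential
`D_C = (-1)^{m(n+1)} d_C + (-1)^{n(p+1)} ∂_C + (-1)^{p(m+1)} δ_C`. -/
def D : Family k H →ₗ[k] Family k H where
  toFun c := fun p i j => X.dTerm c p i j + X.barTerm c p i j + X.cobarTerm c p i j
  map_add' c c' := by
    funext p i j
    rcases p with _ | p <;> rcases i with _ | i <;> rcases j with _ | j <;>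
      simp only [dTerm, barTerm, cobarTerm, Pi.add_apply, map_add, smul_add] <;> abel
  map_smul' a c := by
    funext p i j
    rcases p with _ | p <;> rcases i with _ | i <;> rcases j with _ | j <;>
      simp only [dTerm, barTerm, cobarTerm, Pi.smul_apply, map_smul, smul_add, smul_zero,
        RingHom.id_apply, smul_comm a]

variable (𝒜) in
/-- The restricted total `r`-cochains truncated at degree `0`: the direct sum of the normalized
cochains of tridegree `(p, m, n)` with `p ≥ 0`, `m, n ≥ 1` and `p + m + n = r + 1`. As
`(m, n) = (i+1, j+1)`, the last condition is `p + i + j + 1 = r`. -/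
def totalCochains (r : ℕ) : Submodule k (Family k H) where
  carrier := {c | ∀ p i j, c p i j ∈ cochains 𝒜 p i j ∧ (p + i + j + 1 ≠ r → c p i j = 0)}
  add_mem' := fun {c c'} hc hc' p i j =>
    ⟨add_mem (hc p i j).1 (hc' p i j).1, fun h => by
      simp [(hc p i j).2 h, (hc' p i j).2 h]⟩
  zero_mem' := fun _ _ _ => ⟨zero_mem _, fun _ => rfl⟩
  smul_mem' := fun a c hc p i j =>
    ⟨Submodule.smul_mem _ a (hc p i j).1, fun h => by simp [(hc p i j).2 h]⟩

/-- The restricted total `r`-cocycles. -/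
def cocycles (r : ℕ) : Submodule k (Family k H) :=
  totalCochains 𝒜 r ⊓ LinearMap.ker X.D

/-- The restricted total `r`-coboundaries (there are no restricted total cochains in total
degree `0`, so the truncated subtraction is harmless). -/
def coboundaries (r : ℕ) : Submodule k (Family k H) :=
  (totalCochains 𝒜 (r - 1)).map X.D

/-- The restricted Hochschild–Cartier cohomology of `X` truncated at degree `0`. -/
abbrev Cohomology (r : ℕ) : Type v :=
  X.cocycles r ⧸ (X.coboundaries r).submoduleOf (X.cocycles r)

variable (k H) in
/-- The sum `d₁ + μ₁ + Δ₁`, with summands in tridegrees `(1,1,1)`, `(0,2,1)`, `(0,1,2)`. -/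
def infinitesimal (d₁ : H →ₗ[k] H) (μ₁ : H ⊗[k] H →ₗ[k] H) (Δ₁ : H →ₗ[k] H ⊗[k] H) :
    Family k H
  | 1, 0, 0 => (single k H).toLinearMap ∘ₗ d₁ ∘ₗ (single k H).symm.toLinearMap
  | 0, 1, 0 => (single k H).toLinearMap ∘ₗ μ₁ ∘ₗ (pair k H).symm.toLinearMap
  | 0, 0, 1 => (pair k H).toLinearMap ∘ₗ Δ₁ ∘ₗ (single k H).symm.toLinearMap
  | _, _, _ => 0

end DGHopfAlgebra

/-! ### Formal power series of linear maps

`FormalMap k V W` is `Hom_k(V, W)[[t]]`, a series `∑ tⁿ fₙ` being the sequence of its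
coefficients. It is the space of `k[[t]]`-linear maps `V[[t]] → W[[t]]`, by
`(∑ tᵃ fₐ)(∑ tᵇ v_b) = ∑ tᵃ⁺ᵇ fₐ(v_b)`. The `m`-th (`t`-adically completed) tensor power of
`H[[t]]` over `k[[t]]` is `(H^{⊗m})[[t]]`. -/

section Formal

variable (k : Type u) [Field k]

/-- Formal power series in `t` whose coefficients are linear maps `V → W`. -/
abbrev FormalMap (V W : Type*) [AddCommGroup V] [Module k V] [AddCommGroup W] [Module k W] :=
  ℕ → (V →ₗ[k] W)

variable {k} {U V W V' W' : Type*} [AddCommGroup U] [Module k U] [AddCommGroup V] [Module k V]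
  [AddCommGroup W] [Module k W] [AddCommGroup V'] [Module k V'] [AddCommGroup W'] [Module k W']

namespace FormalMap

/-- The constant series `f`, i.e. the `k[[t]]`-linear extension of `f`. -/
def const (f : V →ₗ[k] W) : FormalMap k V W := fun n => if n = 0 then f else 0

/-- Composition of `k[[t]]`-linear maps. -/
def comp (g : FormalMap k V W) (f : FormalMap k U V) : FormalMap k U W :=
  fun n => ∑ ab ∈ Finset.HasAntidiagonal.antidiagonal n, g ab.1 ∘ₗ f ab.2

/-- The (unsigned) tensor product of `k[[t]]`-linear maps. -/
def tmap (f : FormalMap k V W) (g : FormalMap k V' W') :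
    FormalMap k (V ⊗[k] V') (W ⊗[k] W') :=
  fun n => ∑ ab ∈ Finset.HasAntidiagonal.antidiagonal n, TensorProduct.map (f ab.1) (g ab.2)

/-- The identity of `V[[t]]`. -/
def one : FormalMap k V V := const LinearMap.id

end FormalMap

end Formal

infixr:80 " ⊚ " => FormalMap.comp
infixl:90 " ⊠ " => FormalMap.tmap

open FormalMap in
/-- A structure of differential graded `k[[t]]`-Hopf algebra on `H[[t]]`, where
`H = ⨁_{p ≥ 0} 𝒜 p`. The axioms are those of `DGHopfAlgebra`, for `k[[t]]`-linear maps. -/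
structure FormalDGHopfAlgebra {k : Type u} [Field k] {H : Type v} [AddCommGroup H] [Module k H]
    (𝒜 : ℕ → Submodule k H) [DirectSum.Decomposition 𝒜] where
  d : FormalMap k H H
  mul : FormalMap k (H ⊗[k] H) H
  unit : FormalMap k k H
  comul : FormalMap k H (H ⊗[k] H)
  counit : FormalMap k H k
  antipode : FormalMap k H H
  -- degrees
  d_deg : ∀ n p, ∀ x ∈ 𝒜 p, d n x ∈ 𝒜 (p + 1)
  mul_deg : ∀ n p, ∀ x ∈ tensorGr 𝒜 1 p, mul n ((pair k H).symm x) ∈ 𝒜 p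
  unit_deg : ∀ n c, unit n c ∈ 𝒜 0
  comul_deg : ∀ n p, ∀ x ∈ 𝒜 p, pair k H (comul n x) ∈ tensorGr 𝒜 1 p
  counit_deg : ∀ n p, p ≠ 0 → ∀ x ∈ 𝒜 p, counit n x = 0
  antipode_deg : ∀ n p, ∀ x ∈ 𝒜 p, antipode n x ∈ 𝒜 p
  -- differential graded algebra
  d_comp_d : d ⊚ d = 0
  mul_assoc : mul ⊚ (mul ⊠ one) =
    mul ⊚ (one ⊠ mul) ⊚ const (TensorProduct.assoc k H H H).toLinearMap
  unit_mul : mul ⊚ (unit ⊠ one) ⊚ const (TensorProduct.lid k H).symm.toLinearMap = one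
  mul_unit : mul ⊚ (one ⊠ unit) ⊚ const (TensorProduct.rid k H).symm.toLinearMap = one
  d_mul : d ⊚ mul = mul ⊚ (d ⊠ one + const (τ 𝒜) ⊠ d)
  -- differential graded coalgebra
  comul_coassoc : const (TensorProduct.assoc k H H H).toLinearMap ⊚ (comul ⊠ one) ⊚ comul =
    (one ⊠ comul) ⊚ comul
  counit_comul : const (TensorProduct.lid k H).toLinearMap ⊚ (counit ⊠ one) ⊚ comul = one
  comul_counit : const (TensorProduct.rid k H).toLinearMap ⊚ (one ⊠ counit) ⊚ comul = one
  comul_d : comul ⊚ d = (d ⊠ one + const (τ 𝒜) ⊠ d) ⊚ comul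
  -- compatibility
  comul_mul : comul ⊚ mul = (mul ⊠ mul) ⊚ const (midSwap 𝒜 H H) ⊚ (comul ⊠ comul)
  comul_unit : comul ⊚ unit =
    (unit ⊠ unit) ⊚ const (TensorProduct.lid k k).symm.toLinearMap
  counit_mul : counit ⊚ mul =
    const (TensorProduct.lid k k).toLinearMap ⊚ (counit ⊠ counit)
  counit_unit : counit ⊚ unit = one
  -- antipode, an anti-homomorphism of graded algebras
  antipode_left : mul ⊚ (antipode ⊠ one) ⊚ comul = unit ⊚ counit
  antipode_right : mul ⊚ (one ⊠ antipode) ⊚ comul = unit ⊚ counit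
  antipode_mul : antipode ⊚ mul = mul ⊚ const (swap 𝒜) ⊚ (antipode ⊠ antipode)

/-- `Y` is a deformation of `X`: `d_t = d + t d₁ + ⋯`, `μ_t = μ + t μ₁ + ⋯`,
`Δ_t = Δ + t Δ₁ + ⋯`. -/
structure IsDeformation {k : Type u} [Field k] {H : Type v} [AddCommGroup H] [Module k H]
    {𝒜 : ℕ → Submodule k H} [DirectSum.Decomposition 𝒜]
    (X : DGHopfAlgebra 𝒜) (Y : FormalDGHopfAlgebra 𝒜) : Prop where
  d_zero : Y.d 0 = X.d
  mul_zero : Y.mul 0 = X.mul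
  comul_zero : Y.comul 0 = X.comul

end DGH

end

noncomputable section

namespace DGH

universe u v

/-! ### Calculus of formal power series of linear maps -/

section FormalCalculus

open Finset.HasAntidiagonal (antidiagonal)

/-! The deformation is built one power of `t` at a time. Take series `d_t`, `μ_t`, `Δ_t` over `H`
that satisfy the axioms of a differential graded bialgebra below order `n ≥ 1`. Each of the six
axioms (`d² = 0`, Leibniz, co-Leibniz, associativity, compatibility, coassociativity) has a defect,
and the coefficients of `tⁿ` in the six defects form one total `3`-cochain, the obstruction. If the
coefficients of order `n` are changed by a `2`-cochain `b`, the obstruction changes by `-D b`. So if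
the obstruction is a cocycle, the vanishing of the third cohomology yields a `b` that removes it. At
order `1` the given cocycle itself serves as `b`, because the undeformed structure has no defect.

The obstruction is a cocycle because of identities that hold for arbitrary series, with no axiom
assumed: `d` commutes with `d²`, the bracketings of a fourfold product cancel in pairs, `Δ` of an
associator can be computed in two ways, and so on (`sqDefect_d`, `leibDefect_d`, `coleibDefect_d`,
`assocDefect_d`, `coassocDefect_d`, `comul_leibDefect`, `assocDefect_pentagon`, `comul_assocDefect`,
`coassocDefect_mul`, `coassocDefect_pentagon`). Each is linear in the defects. When the defects
start at order `n`, their coefficients of order `n` meet only the constant terms of the operations,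
which are those of `H`; the ten identities then become the ten components of `D (obstruction) = 0`
(`D_obstruction`).

The complex consists of normalized cochains, so the obstruction has to be normalized too
(`obstruction_mem`). All corrections are normalized, hence the original unit and counit remain a
unit and a counit at every stage; therefore the defects vanish as soon as an argument is the unit,
and are killed by the counit in every output. Connectedness turns this into normalization: degree
`0` is the line of the unit, and the kernel of the counit is the positive part.

The stages agree to higher and higher order and have a limit (`exists_limit`, `exists_bialgebra`).
The antipode needs no further obstruction theory: the identity is convolution invertible modulo `t`,
hence invertible (`conv_left_inverse`, `exists_antipode`), and the inverse reverses products by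
uniqueness of inverses in the convolution algebra of maps `H ⊗ H → H` (`antipode_comp_mul`). -/

theorem sum_antidiagonal_interchange {M : Type*} [AddCommMonoid M] (F : ℕ → ℕ → ℕ → ℕ → M) (n : ℕ) :
    ∑ p ∈ antidiagonal n, ∑ a ∈ antidiagonal p.1, ∑ b ∈ antidiagonal p.2, F a.1 a.2 b.1 b.2 =
    ∑ p ∈ antidiagonal n, ∑ a ∈ antidiagonal p.1, ∑ b ∈ antidiagonal p.2, F a.1 b.1 a.2 b.2 := by
  simp only [Finset.sum_sigma']
  refine Finset.sum_nbij'
    (fun z => ⟨(z.2.1.1 + z.2.2.1, z.2.1.2 + z.2.2.2), (z.2.1.1, z.2.2.1), (z.2.1.2, z.2.2.2)⟩)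
    (fun z => ⟨(z.2.1.1 + z.2.2.1, z.2.1.2 + z.2.2.2), (z.2.1.1, z.2.2.1), (z.2.1.2, z.2.2.2)⟩)
    ?_ ?_ ?_ ?_ ?_
  all_goals
    rintro ⟨⟨p, q⟩, ⟨a, b⟩, ⟨c, e⟩⟩ h
    simp only [Finset.mem_sigma, Finset.HasAntidiagonal.mem_antidiagonal] at h ⊢
    try obtain ⟨h1, h2, h3⟩ := h
    try subst h2 h3
    try simp
    try omega

theorem sum_antidiagonal_assoc {M : Type*} [AddCommMonoid M] (F : ℕ → ℕ → ℕ → M) (n : ℕ) :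
    ∑ p ∈ antidiagonal n, ∑ a ∈ antidiagonal p.1, F a.1 a.2 p.2 =
    ∑ p ∈ antidiagonal n, ∑ a ∈ antidiagonal p.2, F p.1 a.1 a.2 := by
  simp only [Finset.sum_sigma']
  refine Finset.sum_nbij'
    (fun z => ⟨(z.2.1, z.2.2 + z.1.2), (z.2.2, z.1.2)⟩)
    (fun z => ⟨(z.1.1 + z.2.1, z.2.2), (z.1.1, z.2.1)⟩) ?_ ?_ ?_ ?_ ?_
  all_goals
    rintro ⟨⟨p, q⟩, ⟨a, b⟩⟩ h
    simp only [Finset.mem_sigma, Finset.HasAntidiagonal.mem_antidiagonal] at h ⊢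
    try obtain ⟨h1, h2⟩ := h
    try subst h2
    try simp
    try omega

variable {k : Type u} [Field k]
variable {U V W V' W' : Type*} [AddCommGroup U] [Module k U] [AddCommGroup V] [Module k V]
  [AddCommGroup W] [Module k W] [AddCommGroup V'] [Module k V'] [AddCommGroup W'] [Module k W']

namespace FormalMap

/-- The `k[[t]]`-linear map `V[[t]] → W[[t]]` given by a series of linear maps. -/
def app (f : FormalMap k V W) : (ℕ → V) →ₗ[k] (ℕ → W) where
  toFun x := fun n => ∑ ab ∈ antidiagonal n, f ab.1 (x ab.2)
  map_add' x y := by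
    funext n; simp [Finset.sum_add_distrib]
  map_smul' c x := by
    funext n; simp [Finset.smul_sum]

variable (k) in
/-- The completed tensor product of two series of vectors. -/
def st (x : ℕ → V) (y : ℕ → W) : ℕ → V ⊗[k] W :=
  fun n => ∑ ab ∈ antidiagonal n, x ab.1 ⊗ₜ[k] y ab.2

/-- The constant series. -/
def ser (v : V) : ℕ → V := Pi.single 0 v

theorem app_apply (f : FormalMap k V W) (x : ℕ → V) (n : ℕ) :
    app f x n = ∑ ab ∈ antidiagonal n, f ab.1 (x ab.2) := rfl

theorem st_apply (x : ℕ → V) (y : ℕ → W) (n : ℕ) :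
    st k x y n = ∑ ab ∈ antidiagonal n, x ab.1 ⊗ₜ[k] y ab.2 := rfl

theorem sum_antidiagonal_eq_right {M : Type*} [AddCommMonoid M] (F : ℕ → ℕ → M) (n : ℕ)
    (h : ∀ b, b < n → F (n - b) b = 0) : ∑ ab ∈ antidiagonal n, F ab.1 ab.2 = F 0 n := by
  rw [Finset.sum_eq_single (0, n)]
  · rintro ⟨a, b⟩ hab hne
    rw [Finset.HasAntidiagonal.mem_antidiagonal] at hab
    have hb : b < n := by
      rcases Nat.eq_zero_or_pos a with h0 | h0
      · subst h0; simp at hab; subst hab; simp at hne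
      · simp at hab; omega
    have : a = n - b := by simp at hab; omega
    subst this
    exact h b hb
  · simp

theorem sum_antidiagonal_eq_left {M : Type*} [AddCommMonoid M] (F : ℕ → ℕ → M) (n : ℕ)
    (h : ∀ a, a < n → F a (n - a) = 0) : ∑ ab ∈ antidiagonal n, F ab.1 ab.2 = F n 0 := by
  rw [← Finset.Nat.sum_antidiagonal_swap]
  exact sum_antidiagonal_eq_right (fun a b => F b a) n h

@[simp] theorem app_ser (f : FormalMap k V W) (v : V) (n : ℕ) : app f (ser v) n = f n v := by
  rw [app_apply, sum_antidiagonal_eq_left (fun a b => f a (ser v b))]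
  · simp [ser]
  · intro a ha
    simp [ser, Nat.sub_ne_zero_of_lt ha]

theorem st_ser (v : V) (w : W) : st k (ser v) (ser w) = ser (v ⊗ₜ[k] w) := by
  funext n
  rw [st_apply, sum_antidiagonal_eq_left (fun a b => (ser v a) ⊗ₜ[k] (ser w b))]
  · by_cases h : n = 0 <;> simp [ser, h]
  · intro a ha
    simp [ser, Nat.sub_ne_zero_of_lt ha]

/-- The constant series `ser v` recover all coefficients. Identities between composites of series
can thus be proved by computing with elements, where `app` turns `⊚` into composition and `⊠` into
`st`. -/
theorem ext_app {f g : FormalMap k V W} (h : ∀ x, app f x = app g x) : f = g := by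
  funext n
  ext v
  rw [← app_ser f, h, app_ser]

@[simp] theorem app_comp (g : FormalMap k V W) (f : FormalMap k U V) (x : ℕ → U) :
    app (g ⊚ f) x = app g (app f x) := by
  funext n
  simp only [app_apply, comp, LinearMap.sum_apply, map_sum, LinearMap.comp_apply]
  exact sum_antidiagonal_assoc (fun a b c => g a (f b (x c))) n

@[simp] theorem app_tmap (f : FormalMap k V W) (g : FormalMap k V' W') (x : ℕ → V) (y : ℕ → V') :
    app (f ⊠ g) (st k x y) = st k (app f x) (app g y) := by
  funext n
  simp only [app_apply, st_apply, tmap, LinearMap.sum_apply, map_sum, TensorProduct.sum_tmul,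
    TensorProduct.tmul_sum, TensorProduct.map_tmul]
  -- Both sides range over the splittings of `n` into four parts and differ only by the exchange of
  -- the two middle parts.
  refine Eq.trans (Finset.sum_congr rfl fun p _ => Finset.sum_comm) (Eq.trans
    (sum_antidiagonal_interchange (fun a b c e => f a (x c) ⊗ₜ[k] g b (y e)) n)
    (Finset.sum_congr rfl fun p _ => Finset.sum_comm))

theorem app_const_apply (f : V →ₗ[k] W) (x : ℕ → V) (n : ℕ) : app (const f) x n = f (x n) := by
  rw [app_apply, sum_antidiagonal_eq_right (fun a b => const f a (x b))]
  · simp [const]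
  · intro a ha
    simp [const, Nat.sub_ne_zero_of_lt ha]

@[simp] theorem app_one (x : ℕ → V) : app (one : FormalMap k V V) x = x := by
  funext n; simp [one, app_const_apply]

@[simp] theorem app_add (f g : FormalMap k V W) (x : ℕ → V) :
    app (f + g) x = app f x + app g x := by
  funext n; simp [app_apply, Finset.sum_add_distrib]

@[simp] theorem app_sub (f g : FormalMap k V W) (x : ℕ → V) :
    app (f - g) x = app f x - app g x := by
  funext n; simp [app_apply, Finset.sum_sub_distrib]

@[simp] theorem app_zero (x : ℕ → V) : app (0 : FormalMap k V W) x = 0 := by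
  funext n; simp [app_apply]

@[simp] theorem st_add_left (x x' : ℕ → V) (y : ℕ → W) :
    st k (x + x') y = st k x y + st k x' y := by
  funext n; simp [st_apply, TensorProduct.add_tmul, Finset.sum_add_distrib]

@[simp] theorem st_add_right (x : ℕ → V) (y y' : ℕ → W) :
    st k x (y + y') = st k x y + st k x y' := by
  funext n; simp [st_apply, TensorProduct.tmul_add, Finset.sum_add_distrib]

@[simp] theorem st_sub_left (x x' : ℕ → V) (y : ℕ → W) :
    st k (x - x') y = st k x y - st k x' y := by
  funext n; simp [st_apply, TensorProduct.sub_tmul, Finset.sum_sub_distrib]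

@[simp] theorem st_sub_right (x : ℕ → V) (y y' : ℕ → W) :
    st k x (y - y') = st k x y - st k x y' := by
  funext n; simp [st_apply, TensorProduct.tmul_sub, Finset.sum_sub_distrib]

@[simp] theorem st_smul_left (c : k) (x : ℕ → V) (y : ℕ → W) :
    st k (c • x) y = c • st k x y := by
  funext n; simp [st_apply, TensorProduct.smul_tmul', Finset.smul_sum]

@[simp] theorem st_smul_right (c : k) (x : ℕ → V) (y : ℕ → W) :
    st k x (c • y) = c • st k x y := by
  funext n; simp [st_apply, Finset.smul_sum]

@[simp] theorem st_zero_left (y : ℕ → W) : st k (0 : ℕ → V) y = 0 := by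
  funext n; simp [st_apply]

@[simp] theorem st_zero_right (x : ℕ → V) : st k x (0 : ℕ → W) = 0 := by
  funext n; simp [st_apply]

@[simp] theorem app_assoc (x : ℕ → U) (y : ℕ → V) (z : ℕ → W) :
    app (const (TensorProduct.assoc k U V W).toLinearMap) (st k (st k x y) z) =
      st k x (st k y z) := by
  funext n
  simp only [app_const_apply, st_apply, TensorProduct.sum_tmul, TensorProduct.tmul_sum, map_sum,
    LinearEquiv.coe_coe, TensorProduct.assoc_tmul]
  exact sum_antidiagonal_assoc (fun a b c => x a ⊗ₜ[k] (y b ⊗ₜ[k] z c)) n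

@[simp] theorem app_assoc_symm (x : ℕ → U) (y : ℕ → V) (z : ℕ → W) :
    app (const (TensorProduct.assoc k U V W).symm.toLinearMap) (st k x (st k y z)) =
      st k (st k x y) z := by
  rw [← app_assoc]
  funext n
  rw [app_const_apply, app_const_apply]
  exact (TensorProduct.assoc k U V W).symm_apply_apply _

/-- Two constant maps that agree on a tensor product of a series of vectors pointwise. -/
theorem app_const_st (f : V ⊗[k] W →ₗ[k] U) (x : ℕ → V) (y : ℕ → W) (n : ℕ) :
    app (const f) (st k x y) n = ∑ ab ∈ antidiagonal n, f (x ab.1 ⊗ₜ[k] y ab.2) := by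
  simp [app_const_apply, st_apply]

variable (W) in
/-- Tensoring with a series of vectors on the left. -/
def insL (x : ℕ → V) : FormalMap k W (V ⊗[k] W) := fun n => TensorProduct.mk k V W (x n)

variable (V) in
/-- Tensoring with a series of vectors on the right. -/
def insR (y : ℕ → W) : FormalMap k V (V ⊗[k] W) := fun n => (TensorProduct.mk k V W).flip (y n)

@[simp] theorem app_insL (x : ℕ → V) (y : ℕ → W) : app (insL W x) y = st k x y := rfl

@[simp] theorem app_insR (x : ℕ → V) (y : ℕ → W) : app (insR V y) x = st k x y := by
  funext n
  rw [app_apply, st_apply, ← Finset.Nat.sum_antidiagonal_swap]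
  rfl

@[simp] theorem app_smul (c : k) (f : FormalMap k V W) (x : ℕ → V) :
    app (c • f) x = c • app f x := by
  funext n; simp [app_apply, Finset.smul_sum]

/-! #### Coefficients -/

@[simp] theorem const_zero (f : V →ₗ[k] W) : const f 0 = f := rfl

@[simp] theorem one_zero : (one : FormalMap k V V) 0 = LinearMap.id := rfl

theorem const_succ (f : V →ₗ[k] W) {n : ℕ} (h : n ≠ 0) : const f n = 0 := by simp [const, h]

@[simp] theorem comp_zero (g : FormalMap k V W) (f : FormalMap k U V) :
    (g ⊚ f) 0 = g 0 ∘ₗ f 0 := by simp [comp]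

@[simp] theorem tmap_zero (f : FormalMap k V W) (g : FormalMap k V' W') :
    (f ⊠ g) 0 = TensorProduct.map (f 0) (g 0) := by simp [tmap]

/-- The series `f` has the form `t^n a + O(t^{n+1})`. -/
def Lead (n : ℕ) (f : FormalMap k V W) (a : V →ₗ[k] W) : Prop := (∀ i < n, f i = 0) ∧ f n = a

namespace Lead

variable {n : ℕ}

theorem add {f g : FormalMap k V W} {a b : V →ₗ[k] W} (hf : Lead n f a) (hg : Lead n g b) :
    Lead n (f + g) (a + b) :=
  ⟨fun i hi => by simp [hf.1 i hi, hg.1 i hi], by simp [hf.2, hg.2]⟩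

theorem sub {f g : FormalMap k V W} {a b : V →ₗ[k] W} (hf : Lead n f a) (hg : Lead n g b) :
    Lead n (f - g) (a - b) :=
  ⟨fun i hi => by simp [hf.1 i hi, hg.1 i hi], by simp [hf.2, hg.2]⟩

/-- At leading order only the constant term of the other factor contributes. This is what converts
identities between defects into identities for the operations of `H` itself. -/
theorem comp_left {f : FormalMap k V W} {a : V →ₗ[k] W} (hf : Lead n f a) (g : FormalMap k U V) :
    Lead n (f ⊚ g) (a ∘ₗ g 0) := by
  refine ⟨fun i hi => ?_, ?_⟩
  · refine Finset.sum_eq_zero fun p hp => ?_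
    rw [Finset.HasAntidiagonal.mem_antidiagonal] at hp
    rw [hf.1 p.1 (by omega), LinearMap.zero_comp]
  · rw [← hf.2]
    exact sum_antidiagonal_eq_left (fun a b => f a ∘ₗ g b) n
      fun i hi => by rw [hf.1 i hi, LinearMap.zero_comp]

theorem comp_right {f : FormalMap k U V} {a : U →ₗ[k] V} (g : FormalMap k V W) (hf : Lead n f a) :
    Lead n (g ⊚ f) (g 0 ∘ₗ a) := by
  refine ⟨fun i hi => ?_, ?_⟩
  · refine Finset.sum_eq_zero fun p hp => ?_
    rw [Finset.HasAntidiagonal.mem_antidiagonal] at hp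
    rw [hf.1 p.2 (by omega), LinearMap.comp_zero]
  · rw [← hf.2]
    exact sum_antidiagonal_eq_right (fun a b => g a ∘ₗ f b) n
      fun i hi => by rw [hf.1 i hi, LinearMap.comp_zero]

theorem tmap_left {f : FormalMap k V W} {a : V →ₗ[k] W} (hf : Lead n f a)
    (g : FormalMap k V' W') : Lead n (f ⊠ g) (TensorProduct.map a (g 0)) := by
  refine ⟨fun i hi => ?_, ?_⟩
  · refine Finset.sum_eq_zero fun p hp => ?_
    rw [Finset.HasAntidiagonal.mem_antidiagonal] at hp
    rw [hf.1 p.1 (by omega), TensorProduct.map_zero_left]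
  · rw [← hf.2]
    exact sum_antidiagonal_eq_left (fun a b => TensorProduct.map (f a) (g b)) n
      fun i hi => by rw [hf.1 i hi, TensorProduct.map_zero_left]

theorem tmap_right {f : FormalMap k V W} {a : V →ₗ[k] W} (g : FormalMap k V' W')
    (hf : Lead n f a) : Lead n (g ⊠ f) (TensorProduct.map (g 0) a) := by
  refine ⟨fun i hi => ?_, ?_⟩
  · refine Finset.sum_eq_zero fun p hp => ?_
    rw [Finset.HasAntidiagonal.mem_antidiagonal] at hp
    rw [hf.1 p.2 (by omega), TensorProduct.map_zero_right]
  · rw [← hf.2]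
    exact sum_antidiagonal_eq_right (fun a b => TensorProduct.map (g a) (f b)) n
      fun i hi => by rw [hf.1 i hi, TensorProduct.map_zero_right]

theorem eq {f g : FormalMap k V W} {a b : V →ₗ[k] W} (h : f = g) (hf : Lead n f a)
    (hg : Lead n g b) : a = b := by rw [← hf.2, h, hg.2]

end Lead

/-- The series `f` and `g` agree up to order `n`. -/
def EqTo (n : ℕ) (f g : FormalMap k V W) : Prop := ∀ i ≤ n, f i = g i

namespace EqTo

variable {n : ℕ}

theorem refl (f : FormalMap k V W) : EqTo n f f := fun _ _ => rfl

theorem add {f f' g g' : FormalMap k V W} (hf : EqTo n f f') (hg : EqTo n g g') :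
    EqTo n (f + g) (f' + g') := fun i hi => by simp [hf i hi, hg i hi]

theorem sub {f f' g g' : FormalMap k V W} (hf : EqTo n f f') (hg : EqTo n g g') :
    EqTo n (f - g) (f' - g') := fun i hi => by simp [hf i hi, hg i hi]

theorem comp {g g' : FormalMap k V W} {f f' : FormalMap k U V} (hg : EqTo n g g')
    (hf : EqTo n f f') : EqTo n (g ⊚ f) (g' ⊚ f') := fun i hi => by
  refine Finset.sum_congr rfl fun p hp => ?_
  rw [Finset.HasAntidiagonal.mem_antidiagonal] at hp
  rw [hg p.1 (by omega), hf p.2 (by omega)]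

theorem tmap {g g' : FormalMap k V W} {f f' : FormalMap k V' W'} (hg : EqTo n g g')
    (hf : EqTo n f f') : EqTo n (g ⊠ f) (g' ⊠ f') := fun i hi => by
  refine Finset.sum_congr rfl fun p hp => ?_
  rw [Finset.HasAntidiagonal.mem_antidiagonal] at hp
  rw [hg p.1 (by omega), hf p.2 (by omega)]

end EqTo

/-- `Diff n f g a`: up to order `n`, the series `g` is `f + t^n a`. -/
def Diff (n : ℕ) (f g : FormalMap k V W) (a : V →ₗ[k] W) : Prop :=
  (∀ i < n, g i = f i) ∧ g n = f n + a

namespace Diff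

variable {n : ℕ}

theorem refl (f : FormalMap k V W) : Diff n f f 0 := ⟨fun _ _ => rfl, by simp⟩

theorem add {f f' g g' : FormalMap k V W} {a b : V →ₗ[k] W} (hf : Diff n f f' a)
    (hg : Diff n g g' b) : Diff n (f + g) (f' + g') (a + b) :=
  ⟨fun i hi => by simp [hf.1 i hi, hg.1 i hi], by simp only [Pi.add_apply, hf.2, hg.2]; abel⟩

theorem sub {f f' g g' : FormalMap k V W} {a b : V →ₗ[k] W} (hf : Diff n f f' a)
    (hg : Diff n g g' b) : Diff n (f - g) (f' - g') (a - b) :=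
  ⟨fun i hi => by simp [hf.1 i hi, hg.1 i hi], by simp only [Pi.sub_apply, hf.2, hg.2]; abel⟩

/-- For `n ≠ 0` the splittings `(0, n)` and `(n, 0)` are distinct, and they are the only ones that
involve a coefficient of order `n`. -/
theorem sum_split {M : Type*} [AddCommMonoid M] (F : ℕ → ℕ → M) (hn : n ≠ 0) :
    ∑ p ∈ antidiagonal n, F p.1 p.2 = F 0 n + F n 0 +
      ∑ p ∈ (antidiagonal n).filter (fun p => p.1 < n ∧ p.2 < n), F p.1 p.2 := by
  rw [← Finset.sum_filter_add_sum_filter_not (antidiagonal n) (fun p => p.1 < n ∧ p.2 < n),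
    add_comm]
  congr 1
  have : (antidiagonal n).filter (fun p => ¬(p.1 < n ∧ p.2 < n)) = {(0, n), (n, 0)} := by
    ext ⟨a, b⟩
    simp only [Finset.mem_filter, Finset.HasAntidiagonal.mem_antidiagonal, Finset.mem_insert,
      Finset.mem_singleton, Prod.mk.injEq]
    omega
  rw [this, Finset.sum_pair (by simp [Ne.symm hn])]

/-- A product rule: the term quadratic in the two changes has order `2n`, which exceeds `n` because
`n ≠ 0`. -/
theorem comp {g g' : FormalMap k V W} {f f' : FormalMap k U V} {a : U →ₗ[k] V} {b : V →ₗ[k] W}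
    (hn : n ≠ 0) (hg : Diff n g g' b) (hf : Diff n f f' a) :
    Diff n (g ⊚ f) (g' ⊚ f') (b ∘ₗ f 0 + g 0 ∘ₗ a) := by
  refine ⟨fun i hi => ?_, ?_⟩
  · refine Finset.sum_congr rfl fun p hp => ?_
    rw [Finset.HasAntidiagonal.mem_antidiagonal] at hp
    rw [hg.1 p.1 (by omega), hf.1 p.2 (by omega)]
  · simp only [FormalMap.comp]
    rw [sum_split (fun a b => g' a ∘ₗ f' b) hn, sum_split (fun a b => g a ∘ₗ f b) hn,
      Finset.sum_congr rfl (g := fun p : ℕ × ℕ => g p.1 ∘ₗ f p.2), hg.2, hf.2,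
      hg.1 0 (Nat.pos_of_ne_zero hn), hf.1 0 (Nat.pos_of_ne_zero hn), LinearMap.add_comp,
      LinearMap.comp_add]
    · abel
    · intro p hp
      rw [Finset.mem_filter] at hp
      rw [hg.1 _ hp.2.1, hf.1 _ hp.2.2]

theorem tmap {g g' : FormalMap k V W} {f f' : FormalMap k V' W'} {a : V' →ₗ[k] W'}
    {b : V →ₗ[k] W} (hn : n ≠ 0) (hg : Diff n g g' b) (hf : Diff n f f' a) :
    Diff n (g ⊠ f) (g' ⊠ f') (TensorProduct.map b (f 0) + TensorProduct.map (g 0) a) := by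
  refine ⟨fun i hi => ?_, ?_⟩
  · refine Finset.sum_congr rfl fun p hp => ?_
    rw [Finset.HasAntidiagonal.mem_antidiagonal] at hp
    rw [hg.1 p.1 (by omega), hf.1 p.2 (by omega)]
  · simp only [FormalMap.tmap]
    rw [sum_split (fun a b => TensorProduct.map (g' a) (f' b)) hn,
      sum_split (fun a b => TensorProduct.map (g a) (f b)) hn,
      Finset.sum_congr rfl (g := fun p : ℕ × ℕ => TensorProduct.map (g p.1) (f p.2)), hg.2, hf.2,
      hg.1 0 (Nat.pos_of_ne_zero hn), hf.1 0 (Nat.pos_of_ne_zero hn), TensorProduct.map_add_left,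
      TensorProduct.map_add_right]
    · abel
    · intro p hp
      rw [Finset.mem_filter] at hp
      rw [hg.1 _ hp.2.1, hf.1 _ hp.2.2]

end Diff

/-! #### Generating families of series -/

variable (k) in
/-- A class of series of vectors whose constant members span. -/
def Gen (P : (ℕ → V) → Prop) : Prop := Submodule.span k {v : V | P (ser v)} = ⊤

theorem Gen.ext {P : (ℕ → V) → Prop} (hP : Gen k P) {f g : FormalMap k V W}
    (h : ∀ x, P x → app f x = app g x) : f = g := by
  funext n
  refine LinearMap.ext_on hP fun v hv => ?_
  rw [← app_ser f, h _ hv, app_ser]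

/-- Iterating this reduces an identity on a multiple tensor product to pure tensors of series from
prescribed classes, in practice homogeneous ones, on which Koszul signs are explicit scalars. -/
theorem Gen.tmul {P : (ℕ → V) → Prop} {P' : (ℕ → W) → Prop} (hP : Gen k P) (hP' : Gen k P') :
    Gen k (fun u : ℕ → V ⊗[k] W => ∃ x y, P x ∧ P' y ∧ u = st k x y) := by
  unfold Gen at *
  rw [eq_top_iff, ← TensorProduct.map₂_mk_top_top_eq_top, ← hP, ← hP', Submodule.map₂_span_span]
  refine Submodule.span_mono ?_
  rintro _ ⟨v, hv, w, hw, rfl⟩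
  exact ⟨ser v, ser w, hv, hw, by rw [st_ser]; rfl⟩

end FormalMap

end FormalCalculus

/-! ### Gradings, homogeneous series and Koszul signs -/

section Gradings

open Finset.HasAntidiagonal (antidiagonal mem_antidiagonal)

variable {k : Type u} [Field k]
variable {U V W V' W' : Type*} [AddCommGroup U] [Module k U] [AddCommGroup V] [Module k V]
  [AddCommGroup W] [Module k W] [AddCommGroup V'] [Module k V'] [AddCommGroup W'] [Module k W']

/-- The total grading of a tensor product. -/
def gt (𝒢 : ℕ → Submodule k V) (ℋ : ℕ → Submodule k W) (q : ℕ) : Submodule k (V ⊗[k] W) :=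
  ⨆ ab ∈ antidiagonal q, Submodule.map₂ (TensorProduct.mk k V W) (𝒢 ab.1) (ℋ ab.2)

/-- The linear map `f` has degree `p`. -/
def IsDeg (𝒢 : ℕ → Submodule k V) (ℋ : ℕ → Submodule k W) (p : ℕ) (f : V →ₗ[k] W) : Prop :=
  ∀ q, ∀ x ∈ 𝒢 q, f x ∈ ℋ (q + p)

/-- The series of vectors `x` is homogeneous of degree `p`. -/
def Homog (𝒢 : ℕ → Submodule k V) (p : ℕ) (x : ℕ → V) : Prop := ∀ n, x n ∈ 𝒢 p

/-- The series of linear maps `f` is homogeneous of degree `p`. -/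
def FDeg (𝒢 : ℕ → Submodule k V) (ℋ : ℕ → Submodule k W) (p : ℕ) (f : FormalMap k V W) : Prop :=
  ∀ n, IsDeg 𝒢 ℋ p (f n)

variable {𝒰 : ℕ → Submodule k U} {𝒢 : ℕ → Submodule k V} {ℋ : ℕ → Submodule k W}
  {𝒢' : ℕ → Submodule k V'} {ℋ' : ℕ → Submodule k W'} {p q : ℕ}

theorem tmul_mem_gt {x : V} {y : W} (hx : x ∈ 𝒢 p) (hy : y ∈ ℋ q) :
    x ⊗ₜ[k] y ∈ gt 𝒢 ℋ (p + q) :=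
  Submodule.mem_iSup_of_mem (p, q) (Submodule.mem_iSup_of_mem (mem_antidiagonal.2 rfl)
    (Submodule.apply_mem_map₂ _ hx hy))

theorem gt_le {q : ℕ} {S : Submodule k (V ⊗[k] W)}
    (h : ∀ a b, a + b = q → ∀ x ∈ 𝒢 a, ∀ y ∈ ℋ b, x ⊗ₜ[k] y ∈ S) : gt 𝒢 ℋ q ≤ S :=
  iSup₂_le fun ab hab => Submodule.map₂_le.2 fun x hx y hy =>
    h ab.1 ab.2 (mem_antidiagonal.1 hab) x hx y hy

theorem map_mem_of_gt {q : ℕ} (f : V ⊗[k] W →ₗ[k] U) {S : Submodule k U}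
    (h : ∀ a b, a + b = q → ∀ x ∈ 𝒢 a, ∀ y ∈ ℋ b, f (x ⊗ₜ[k] y) ∈ S) :
    ∀ u ∈ gt 𝒢 ℋ q, f u ∈ S :=
  gt_le (S := S.comap f) h

namespace IsDeg

theorem of_tmul {f : V ⊗[k] W →ₗ[k] U}
    (h : ∀ a b, ∀ x ∈ 𝒢 a, ∀ y ∈ ℋ b, f (x ⊗ₜ[k] y) ∈ 𝒰 (a + b + p)) :
    IsDeg (gt 𝒢 ℋ) 𝒰 p f := by
  intro q
  refine gt_le (S := (𝒰 (q + p)).comap f) fun a b hab x hx y hy => ?_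
  subst hab
  exact h a b x hx y hy

theorem id : IsDeg 𝒢 𝒢 0 (LinearMap.id : V →ₗ[k] V) := fun _ _ hx => hx

theorem comp {g : V →ₗ[k] W} {f : U →ₗ[k] V} (hg : IsDeg 𝒢 ℋ q g) (hf : IsDeg 𝒰 𝒢 p f) :
    IsDeg 𝒰 ℋ (p + q) (g ∘ₗ f) := fun r x hx => by
  rw [← add_assoc]; exact hg _ _ (hf r x hx)

theorem zero : IsDeg 𝒢 ℋ p 0 := fun _ _ _ => zero_mem _

theorem add {f g : V →ₗ[k] W} (hf : IsDeg 𝒢 ℋ p f) (hg : IsDeg 𝒢 ℋ p g) :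
    IsDeg 𝒢 ℋ p (f + g) := fun r x hx => add_mem (hf r x hx) (hg r x hx)

theorem sub {f g : V →ₗ[k] W} (hf : IsDeg 𝒢 ℋ p f) (hg : IsDeg 𝒢 ℋ p g) :
    IsDeg 𝒢 ℋ p (f - g) := fun r x hx => sub_mem (hf r x hx) (hg r x hx)

theorem neg {f : V →ₗ[k] W} (hf : IsDeg 𝒢 ℋ p f) :
    IsDeg 𝒢 ℋ p (-f) := fun r x hx => neg_mem (hf r x hx)

theorem sum {ι : Type*} {s : Finset ι} {f : ι → V →ₗ[k] W} (hf : ∀ i ∈ s, IsDeg 𝒢 ℋ p (f i)) :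
    IsDeg 𝒢 ℋ p (∑ i ∈ s, f i) := fun r x hx => by
  rw [LinearMap.sum_apply]; exact sum_mem fun i hi => hf i hi r x hx

theorem map {f : V →ₗ[k] W} {g : V' →ₗ[k] W'} (hf : IsDeg 𝒢 ℋ p f) (hg : IsDeg 𝒢' ℋ' q g) :
    IsDeg (gt 𝒢 𝒢') (gt ℋ ℋ') (p + q) (TensorProduct.map f g) :=
  of_tmul fun a b x hx y hy => by
    rw [TensorProduct.map_tmul, show a + b + (p + q) = (a + p) + (b + q) by omega]
    exact tmul_mem_gt (hf _ _ hx) (hg _ _ hy)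

theorem assoc : IsDeg (gt (gt 𝒰 𝒢) ℋ) (gt 𝒰 (gt 𝒢 ℋ)) 0
    (TensorProduct.assoc k U V W).toLinearMap :=
  of_tmul fun a b x hx z hz => by
    revert x
    refine map_mem_of_gt ((TensorProduct.assoc k U V W).toLinearMap ∘ₗ
      (TensorProduct.mk k _ _).flip z) fun a' b' hab x hx y hy => ?_
    subst hab
    rw [add_zero, add_assoc]
    exact tmul_mem_gt hx (tmul_mem_gt hy hz)

theorem assoc_symm : IsDeg (gt 𝒰 (gt 𝒢 ℋ)) (gt (gt 𝒰 𝒢) ℋ) 0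
    (TensorProduct.assoc k U V W).symm.toLinearMap :=
  of_tmul fun a b x hx z hz => by
    revert z
    refine map_mem_of_gt ((TensorProduct.assoc k U V W).symm.toLinearMap ∘ₗ
      TensorProduct.mk k _ _ x) fun a' b' hab y hy z hz => ?_
    subst hab
    rw [add_zero, ← add_assoc]
    exact tmul_mem_gt (tmul_mem_gt hx hy) hz

end IsDeg

namespace FDeg

theorem const {f : V →ₗ[k] W} (hf : IsDeg 𝒢 ℋ p f) : FDeg 𝒢 ℋ p (FormalMap.const f) := fun n => by
  by_cases h : n = 0
  · subst h; exact hf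
  · rw [FormalMap.const_succ f h]; exact IsDeg.zero

theorem one : FDeg 𝒢 𝒢 0 (FormalMap.one : FormalMap k V V) := const IsDeg.id

theorem comp {g : FormalMap k V W} {f : FormalMap k U V} (hg : FDeg 𝒢 ℋ q g)
    (hf : FDeg 𝒰 𝒢 p f) : FDeg 𝒰 ℋ (p + q) (g ⊚ f) :=
  fun _ => IsDeg.sum fun _ _ => (hg _).comp (hf _)

theorem tmap {f : FormalMap k V W} {g : FormalMap k V' W'} (hf : FDeg 𝒢 ℋ p f)
    (hg : FDeg 𝒢' ℋ' q g) : FDeg (gt 𝒢 𝒢') (gt ℋ ℋ') (p + q) (f ⊠ g) :=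
  fun _ => IsDeg.sum fun _ _ => (hf _).map (hg _)

theorem add {f g : FormalMap k V W} (hf : FDeg 𝒢 ℋ p f) (hg : FDeg 𝒢 ℋ p g) :
    FDeg 𝒢 ℋ p (f + g) := fun n => (hf n).add (hg n)

theorem sub {f g : FormalMap k V W} (hf : FDeg 𝒢 ℋ p f) (hg : FDeg 𝒢 ℋ p g) :
    FDeg 𝒢 ℋ p (f - g) := fun n => (hf n).sub (hg n)

end FDeg

theorem Homog.app {f : FormalMap k V W} {x : ℕ → V} (hf : FDeg 𝒢 ℋ p f) (hx : Homog 𝒢 q x) :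
    Homog ℋ (q + p) (f.app x) :=
  fun n => by rw [FormalMap.app_apply]; exact sum_mem fun _ _ => hf _ _ _ (hx _)

theorem Homog.st {x : ℕ → V} {y : ℕ → W} (hx : Homog 𝒢 p x) (hy : Homog ℋ q y) :
    Homog (gt 𝒢 ℋ) (p + q) (FormalMap.st k x y) :=
  fun _ => sum_mem fun _ _ => tmul_mem_gt (hx _) (hy _)

theorem Homog.ser {v : V} (hv : v ∈ 𝒢 p) : Homog 𝒢 p (FormalMap.ser v) := fun n => by
  by_cases h : n = 0
  · subst h; simpa [FormalMap.ser] using hv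
  · simp [FormalMap.ser, h]

/-- Each coefficient of a homogeneous series is a finite sum of homogeneous pure tensors, although
the series itself need not be of the form `st k x y`. The main use is with coproducts `Δ x`, past
which elements must be moved with the correct sign. -/
theorem Homog.ext_gt {f g : FormalMap k (V ⊗[k] W) U} {s : ℕ}
    (h : ∀ a b, a + b = s → ∀ x y, Homog 𝒢 a x → Homog ℋ b y →
      f.app (FormalMap.st k x y) = g.app (FormalMap.st k x y))
    {u : ℕ → V ⊗[k] W} (hu : Homog (gt 𝒢 ℋ) s u) : f.app u = g.app u := by
  funext n
  rw [FormalMap.app_apply, FormalMap.app_apply]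
  refine Finset.sum_congr rfl fun ab _ => ?_
  have := map_mem_of_gt (f ab.1 - g ab.1) (S := ⊥) (fun a b hab x hx y hy => ?_) _ (hu ab.2)
  · simpa [sub_eq_zero] using this
  · have := congrFun (h a b hab _ _ (Homog.ser hx) (Homog.ser hy)) ab.1
    rw [FormalMap.st_ser, FormalMap.app_ser, FormalMap.app_ser] at this
    simp [this]

end Gradings

/-! ### Koszul signs on homogeneous series, and extensionality on homogeneous tensors. -/

section Koszul

open Finset.HasAntidiagonal (antidiagonal mem_antidiagonal)
open FormalMap

variable {k : Type u} [Field k] {H : Type v} [AddCommGroup H] [Module k H]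
  {𝒜 : ℕ → Submodule k H} [DirectSum.Decomposition 𝒜] {p q : ℕ}

theorem sub_one_sub_smul {M : Type*} [AddCommGroup M] [Module k M] (s : k) (x : M) :
    x - (1 - s) • x = s • x := by
  rw [sub_smul, one_smul, sub_sub_cancel]

theorem oddPart_of_mem {x : H} (hx : x ∈ 𝒜 p) : oddPart 𝒜 x = if Odd p then x else 0 := by
  simp only [oddPart, LinearMap.comp_apply, LinearEquiv.coe_coe,
    DirectSum.decomposeLinearEquiv_apply]
  rw [DirectSum.decompose_of_mem 𝒜 hx]
  erw [DirectSum.toModule_lof]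
  split_ifs <;> simp

/-- The scalar `1 - (-1)^p` is `0` or `2` according to the parity of `p`. Written in this way the
formula also holds in characteristic `2`, where both sides vanish. -/
theorem two_smul_oddPart {x : H} (hx : x ∈ 𝒜 p) :
    (2 : k) • oddPart 𝒜 x = (1 - (-1 : k) ^ p) • x := by
  rw [oddPart_of_mem hx]
  rcases Nat.even_or_odd p with h | h
  · simp [h, h.neg_one_pow]
  · rw [if_pos h, h.neg_one_pow]; norm_num

theorem τ_of_mem {x : H} (hx : x ∈ 𝒜 p) : τ 𝒜 x = (-1 : k) ^ p • x := by
  simp [τ, two_smul_oddPart hx, sub_smul]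

theorem two_smul_oddPart_tmul {x y : H} (hx : x ∈ 𝒜 p) (hy : y ∈ 𝒜 q) :
    (2 : k) • (oddPart 𝒜 x ⊗ₜ[k] oddPart 𝒜 y) = (1 - (-1 : k) ^ (p * q)) • (x ⊗ₜ[k] y) := by
  rw [oddPart_of_mem hx, oddPart_of_mem hy]
  rcases Nat.even_or_odd p with h | h
  · simp [Nat.not_odd_iff_even.2 h, (h.mul_right q).neg_one_pow]
  · rcases Nat.even_or_odd q with h' | h'
    · simp [Nat.not_odd_iff_even.2 h', (h'.mul_left p).neg_one_pow]
    · rw [if_pos h, if_pos h', (h.mul h').neg_one_pow]; norm_num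

theorem swap_of_mem {x y : H} (hx : x ∈ 𝒜 p) (hy : y ∈ 𝒜 q) :
    swap 𝒜 (x ⊗ₜ[k] y) = (-1 : k) ^ (p * q) • (y ⊗ₜ[k] x) := by
  simp [swap, two_smul_oddPart_tmul hx hy, sub_smul]

variable {A B : Type v} [AddCommGroup A] [Module k A] [AddCommGroup B] [Module k B]

theorem midSwap_of_mem (a : A) {x y : H} (b : B) (hx : x ∈ 𝒜 p) (hy : y ∈ 𝒜 q) :
    midSwap 𝒜 A B ((a ⊗ₜ[k] x) ⊗ₜ[k] (y ⊗ₜ[k] b)) =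
      (-1 : k) ^ (p * q) • ((a ⊗ₜ[k] y) ⊗ₜ[k] (x ⊗ₜ[k] b)) := by
  have key : (2 : k) • ((a ⊗ₜ[k] oddPart 𝒜 x) ⊗ₜ[k] (oddPart 𝒜 y ⊗ₜ[k] b)) =
      (1 - (-1 : k) ^ (p * q)) • ((a ⊗ₜ[k] x) ⊗ₜ[k] (y ⊗ₜ[k] b)) := by
    rw [oddPart_of_mem hx, oddPart_of_mem hy]
    rcases Nat.even_or_odd p with h | h
    · simp [Nat.not_odd_iff_even.2 h, (h.mul_right q).neg_one_pow]
    · rcases Nat.even_or_odd q with h' | h'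
      · simp [Nat.not_odd_iff_even.2 h', (h'.mul_left p).neg_one_pow]
      · rw [if_pos h, if_pos h', (h.mul h').neg_one_pow]; norm_num
  have key' : (LinearMap.id - (2 : k) • TensorProduct.map
      (TensorProduct.map LinearMap.id (oddPart 𝒜))
      (TensorProduct.map (oddPart 𝒜) LinearMap.id) :
        (A ⊗[k] H) ⊗[k] (H ⊗[k] B) →ₗ[k] (A ⊗[k] H) ⊗[k] (H ⊗[k] B)) ((a ⊗ₜ[k] x) ⊗ₜ[k] (y ⊗ₜ[k] b)) =
      (-1 : k) ^ (p * q) • ((a ⊗ₜ[k] x) ⊗ₜ[k] (y ⊗ₜ[k] b)) := by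
    rw [LinearMap.sub_apply, LinearMap.smul_apply, TensorProduct.map_tmul, TensorProduct.map_tmul,
      TensorProduct.map_tmul, LinearMap.id_apply, LinearMap.id_apply, LinearMap.id_apply, key]
    exact sub_one_sub_smul ((-1 : k) ^ (p * q)) ((a ⊗ₜ[k] x) ⊗ₜ[k] (y ⊗ₜ[k] b))
  rw [midSwap, LinearMap.comp_apply, key', map_smul]
  simp

theorem app_τ {x : ℕ → H} (hx : Homog 𝒜 p x) : app (const (τ 𝒜)) x = (-1 : k) ^ p • x := by
  funext n
  rw [app_const_apply, τ_of_mem (hx n), Pi.smul_apply]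

theorem app_swap {x y : ℕ → H} (hx : Homog 𝒜 p x) (hy : Homog 𝒜 q y) :
    app (const (swap 𝒜)) (st k x y) = (-1 : k) ^ (p * q) • st k y x := by
  funext n
  rw [app_const_st, Pi.smul_apply, st_apply, ← Finset.Nat.sum_antidiagonal_swap, Finset.smul_sum]
  exact Finset.sum_congr rfl fun ab _ => swap_of_mem (hx _) (hy _)

theorem app_midSwap (a : ℕ → A) {x y : ℕ → H} (b : ℕ → B) (hx : Homog 𝒜 p x) (hy : Homog 𝒜 q y) :
    app (const (midSwap 𝒜 A B)) (st k (st k a x) (st k y b)) =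
      (-1 : k) ^ (p * q) • st k (st k a y) (st k x b) := by
  funext n
  simp only [app_const_apply, st_apply, TensorProduct.sum_tmul, TensorProduct.tmul_sum, map_sum,
    Pi.smul_apply, Finset.smul_sum]
  refine Eq.trans (Finset.sum_congr rfl fun r _ => Finset.sum_comm) (Eq.trans
    (sum_antidiagonal_interchange
      (fun i j l m => midSwap 𝒜 A B ((a i ⊗ₜ[k] x j) ⊗ₜ[k] (y l ⊗ₜ[k] b m))) n) ?_)
  refine Eq.trans ?_ (Finset.sum_congr rfl fun r _ => Finset.sum_comm)
  refine Finset.sum_congr rfl fun r _ => Finset.sum_congr rfl fun s _ =>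
    Finset.sum_congr rfl fun t _ => midSwap_of_mem _ _ (hx _) (hy _)

theorem IsDeg.τ : IsDeg 𝒜 𝒜 0 (τ 𝒜) := fun q x hx => by
  rw [τ_of_mem hx]; exact Submodule.smul_mem _ _ hx

theorem IsDeg.midSwap {𝒢 : ℕ → Submodule k A} {ℋ : ℕ → Submodule k B} :
    IsDeg (gt (gt 𝒢 𝒜) (gt 𝒜 ℋ)) (gt (gt 𝒢 𝒜) (gt 𝒜 ℋ)) 0 (midSwap 𝒜 A B) :=
  IsDeg.of_tmul fun r s u hu w hw => by
    revert u
    refine map_mem_of_gt (DGH.midSwap 𝒜 A B ∘ₗ (TensorProduct.mk k _ _).flip w)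
      fun i j hij a ha x hx => ?_
    revert w
    refine map_mem_of_gt (DGH.midSwap 𝒜 A B ∘ₗ
      TensorProduct.mk k _ _ (a ⊗ₜ[k] x)) fun l m hlm y hy b hb => ?_
    rw [LinearMap.comp_apply, TensorProduct.mk_apply,
      midSwap_of_mem _ _ hx hy, show r + s + 0 = (i + l) + (j + m) by omega]
    exact Submodule.smul_mem _ _ (tmul_mem_gt (tmul_mem_gt ha hy) (tmul_mem_gt hx hb))

variable (𝒜) in
theorem gen_homog : Gen k (fun x : ℕ → H => ∃ p, Homog 𝒜 p x) := by
  unfold Gen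
  rw [eq_top_iff, ← (DirectSum.Decomposition.isInternal 𝒜).submodule_iSup_eq_top]
  exact iSup_le fun p x hx => Submodule.subset_span ⟨p, Homog.ser hx⟩

variable {W : Type*} [AddCommGroup W] [Module k W]

variable (𝒜) in
theorem hext₁ {f g : FormalMap k H W} (h : ∀ p x, Homog 𝒜 p x → app f x = app g x) : f = g :=
  (gen_homog 𝒜).ext fun x ⟨p, hx⟩ => h p x hx

variable (𝒜) in
theorem hext₂ {f g : FormalMap k (H ⊗[k] H) W}
    (h : ∀ p q x y, Homog 𝒜 p x → Homog 𝒜 q y → app f (st k x y) = app g (st k x y)) : f = g :=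
  ((gen_homog 𝒜).tmul (gen_homog 𝒜)).ext fun _ ⟨x, y, ⟨p, hx⟩, ⟨q, hy⟩, e⟩ =>
    e ▸ h p q x y hx hy

variable (𝒜) in
theorem hext₃ {f g : FormalMap k (H ⊗[k] (H ⊗[k] H)) W}
    (h : ∀ p q r x y z, Homog 𝒜 p x → Homog 𝒜 q y → Homog 𝒜 r z →
      app f (st k x (st k y z)) = app g (st k x (st k y z))) : f = g :=
  ((gen_homog 𝒜).tmul ((gen_homog 𝒜).tmul (gen_homog 𝒜))).ext
    fun _ ⟨x, _, ⟨p, hx⟩, ⟨y, z, ⟨q, hy⟩, ⟨r, hz⟩, e⟩, e'⟩ => by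
      subst e e'; exact h p q r x y z hx hy hz

theorem gen_true {V : Type*} [AddCommGroup V] [Module k V] : Gen k (fun _ : ℕ → V => True) := by
  simp [Gen]

theorem ext₄ {f g : FormalMap k (H ⊗[k] (H ⊗[k] (H ⊗[k] H))) W}
    (h : ∀ x y z w, app f (st k x (st k y (st k z w))) = app g (st k x (st k y (st k z w)))) :
    f = g :=
  (gen_true.tmul (gen_true.tmul (gen_true.tmul gen_true))).ext
    fun _ ⟨x, _, _, ⟨y, _, _, ⟨z, w, _, _, e⟩, e'⟩, e''⟩ => by
      subst e e' e''; exact h x y z w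

variable (𝒜) in
theorem hext₂₂ {f g : FormalMap k ((H ⊗[k] H) ⊗[k] (H ⊗[k] H)) W}
    (h : ∀ p q r s a b c e, Homog 𝒜 p a → Homog 𝒜 q b → Homog 𝒜 r c → Homog 𝒜 s e →
      app f (st k (st k a b) (st k c e)) = app g (st k (st k a b) (st k c e))) : f = g :=
  (((gen_homog 𝒜).tmul (gen_homog 𝒜)).tmul ((gen_homog 𝒜).tmul (gen_homog 𝒜))).ext
    fun _ ⟨_, _, ⟨a, b, ⟨p, ha⟩, ⟨q, hb⟩, e₁⟩, ⟨c, e, ⟨r, hc⟩, ⟨s, he⟩, e₂⟩, e₃⟩ => by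
      subst e₁ e₂ e₃; exact h p q r s a b c e ha hb hc he

variable (𝒜) in
theorem hext₂₂₂ {f g : FormalMap k ((H ⊗[k] H) ⊗[k] ((H ⊗[k] H) ⊗[k] (H ⊗[k] H))) W}
    (h : ∀ p q r s l m a b c e i j, Homog 𝒜 p a → Homog 𝒜 q b → Homog 𝒜 r c → Homog 𝒜 s e →
      Homog 𝒜 l i → Homog 𝒜 m j →
      app f (st k (st k a b) (st k (st k c e) (st k i j))) =
        app g (st k (st k a b) (st k (st k c e) (st k i j)))) : f = g :=
  (((gen_homog 𝒜).tmul (gen_homog 𝒜)).tmul (((gen_homog 𝒜).tmul (gen_homog 𝒜)).tmul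
    ((gen_homog 𝒜).tmul (gen_homog 𝒜)))).ext
    fun _ ⟨_, _, ⟨a, b, ⟨p, ha⟩, ⟨q, hb⟩, e₁⟩, ⟨_, _, ⟨c, e, ⟨r, hc⟩, ⟨s, he⟩, e₂⟩,
        ⟨i, j, ⟨l, hi⟩, ⟨m, hj⟩, e₃⟩, e₄⟩, e₅⟩ => by
      subst e₁ e₂ e₃ e₄ e₅; exact h p q r s l m a b c e i j ha hb hc he hi hj

end Koszul

/-! ### Formal differentials, products and coproducts, and their defects -/

open FormalMap in
/-- Series `d_t`, `μ_t`, `Δ_t` of degrees `1, 0, 0`, with no relation imposed. -/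
structure PreHopf {k : Type u} [Field k] {H : Type v} [AddCommGroup H] [Module k H]
    (𝒜 : ℕ → Submodule k H) [DirectSum.Decomposition 𝒜] where
  d : FormalMap k H H
  mul : FormalMap k (H ⊗[k] H) H
  comul : FormalMap k H (H ⊗[k] H)
  d_deg : FDeg 𝒜 𝒜 1 d
  mul_deg : FDeg (gt 𝒜 𝒜) 𝒜 0 mul
  comul_deg : FDeg 𝒜 (gt 𝒜 𝒜) 0 comul

namespace PreHopf

open FormalMap

variable {k : Type u} [Field k] {H : Type v} [AddCommGroup H] [Module k H]
  {𝒜 : ℕ → Submodule k H} [DirectSum.Decomposition 𝒜] (G : PreHopf 𝒜)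

/-- The differential of `H ⊗ H`. -/
def d2 : FormalMap k (H ⊗[k] H) (H ⊗[k] H) := G.d ⊠ one + const (τ 𝒜) ⊠ G.d

/-- The differential of `H ⊗ H ⊗ H`. -/
def d3 : FormalMap k (H ⊗[k] (H ⊗[k] H)) (H ⊗[k] (H ⊗[k] H)) := G.d ⊠ one + const (τ 𝒜) ⊠ G.d2

/-- The product of `H ⊗ H`. -/
def star : FormalMap k ((H ⊗[k] H) ⊗[k] (H ⊗[k] H)) (H ⊗[k] H) :=
  (G.mul ⊠ G.mul) ⊚ const (midSwap 𝒜 H H)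

/-- The defect of `d² = 0`. -/
def sqDefect : FormalMap k H H := G.d ⊚ G.d

/-- The defect of the Leibniz rule. -/
def leibDefect : FormalMap k (H ⊗[k] H) H := G.d ⊚ G.mul - G.mul ⊚ G.d2

/-- The defect of the co-Leibniz rule. -/
def coleibDefect : FormalMap k H (H ⊗[k] H) := G.comul ⊚ G.d - G.d2 ⊚ G.comul

/-- The defect of associativity. -/
def assocDefect : FormalMap k (H ⊗[k] (H ⊗[k] H)) H :=
  G.mul ⊚ (G.mul ⊠ one) ⊚ const (TensorProduct.assoc k H H H).symm.toLinearMap -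
    G.mul ⊚ (one ⊠ G.mul)

/-- The defect of the multiplicativity of the coproduct. -/
def compatDefect : FormalMap k (H ⊗[k] H) (H ⊗[k] H) :=
  G.comul ⊚ G.mul - G.star ⊚ (G.comul ⊠ G.comul)

/-- The defect of coassociativity. -/
def coassocDefect : FormalMap k H (H ⊗[k] (H ⊗[k] H)) :=
  const (TensorProduct.assoc k H H H).toLinearMap ⊚ (G.comul ⊠ one) ⊚ G.comul -
    (one ⊠ G.comul) ⊚ G.comul

/-- The left action of `H` on `H ⊗ H`. -/
def lact2 : FormalMap k (H ⊗[k] (H ⊗[k] H)) (H ⊗[k] H) :=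
  (G.mul ⊠ G.mul) ⊚ const (midSwap 𝒜 H H) ⊚ (G.comul ⊠ one)

/-- The left action of `H` on `H ⊗ H ⊗ H`. -/
def lact3 : FormalMap k (H ⊗[k] (H ⊗[k] (H ⊗[k] H))) (H ⊗[k] (H ⊗[k] H)) :=
  (G.mul ⊠ G.lact2) ⊚ const (midSwap 𝒜 H (H ⊗[k] H)) ⊚ (G.comul ⊠ one)

/-- The right action of `H` on `H ⊗ H`. -/
def ract2 : FormalMap k ((H ⊗[k] H) ⊗[k] H) (H ⊗[k] H) :=
  (G.mul ⊠ G.mul) ⊚ const (midSwap 𝒜 H H) ⊚ (one ⊠ G.comul)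

/-- The right action of `H` on `H ⊗ H ⊗ H`. -/
def ract3 : FormalMap k ((H ⊗[k] (H ⊗[k] H)) ⊗[k] H) (H ⊗[k] (H ⊗[k] H)) :=
  const (TensorProduct.assoc k H H H).toLinearMap ⊚ (G.ract2 ⊠ G.mul) ⊚
    const (midSwap 𝒜 (H ⊗[k] H) H) ⊚
    (const (TensorProduct.assoc k H H H).symm.toLinearMap ⊠ G.comul)

/-- The left coaction of `H` on `H ⊗ H`. -/
def lcoact2 : FormalMap k (H ⊗[k] H) (H ⊗[k] (H ⊗[k] H)) :=
  (G.mul ⊠ one) ⊚ const (midSwap 𝒜 H H) ⊚ (G.comul ⊠ G.comul)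

/-- The left coaction of `H` on `H ⊗ H ⊗ H`. -/
def lcoact3 : FormalMap k (H ⊗[k] (H ⊗[k] H)) (H ⊗[k] (H ⊗[k] (H ⊗[k] H))) :=
  (G.mul ⊠ one) ⊚ const (midSwap 𝒜 H (H ⊗[k] H)) ⊚ (G.comul ⊠ G.lcoact2)

/-- The right coaction of `H` on `H ⊗ H`. -/
def rcoact2 : FormalMap k (H ⊗[k] H) ((H ⊗[k] H) ⊗[k] H) :=
  (one ⊠ G.mul) ⊚ const (midSwap 𝒜 H H) ⊚ (G.comul ⊠ G.comul)

/-- The right coaction of `H` on `H ⊗ H ⊗ H`. -/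
def rcoact3 : FormalMap k (H ⊗[k] (H ⊗[k] H)) ((H ⊗[k] (H ⊗[k] H)) ⊗[k] H) :=
  (const (TensorProduct.assoc k H H H).toLinearMap ⊠ G.mul) ⊚
    const (midSwap 𝒜 (H ⊗[k] H) H) ⊚ (G.rcoact2 ⊠ G.comul) ⊚
    const (TensorProduct.assoc k H H H).symm.toLinearMap

variable {p q : ℕ} {x y : ℕ → H}

theorem homog_d (hx : Homog 𝒜 p x) : Homog 𝒜 (p + 1) (app G.d x) := hx.app G.d_deg

theorem homog_mul (hx : Homog 𝒜 p x) (hy : Homog 𝒜 q y) :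
    Homog 𝒜 (p + q) (app G.mul (st k x y)) :=
  show Homog 𝒜 (p + q + 0) _ from Homog.app G.mul_deg (hx.st hy)

theorem app_d2 (hx : Homog 𝒜 p x) (y : ℕ → H) :
    app G.d2 (st k x y) = st k (app G.d x) y + (-1 : k) ^ p • st k x (app G.d y) := by
  simp [d2, app_τ hx]

theorem app_d3 (hx : Homog 𝒜 p x) (u : ℕ → H ⊗[k] H) :
    app G.d3 (st k x u) = st k (app G.d x) u + (-1 : k) ^ p • st k x (app G.d2 u) := by
  simp [d3, app_τ hx]

theorem app_star {r s : ℕ} (a : ℕ → H) {b c : ℕ → H} (e : ℕ → H) (hb : Homog 𝒜 r b)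
    (hc : Homog 𝒜 s c) : app G.star (st k (st k a b) (st k c e)) =
      (-1 : k) ^ (r * s) • st k (app G.mul (st k a c)) (app G.mul (st k b e)) := by
  simp [star, app_midSwap a e hb hc]

/-- Both sides are `d³`. -/
theorem sqDefect_d : G.sqDefect ⊚ G.d = G.d ⊚ G.sqDefect :=
  ext_app fun x => by simp [sqDefect]

/-- The two cross terms `d x ⊗ d y` cancel, since `d` raises the degree of `x` by one and so
reverses the sign. -/
theorem d2_d2 : G.d2 ⊚ G.d2 = G.sqDefect ⊠ one + one ⊠ G.sqDefect :=
  hext₂ 𝒜 fun p q x y hx hy => by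
    simp only [app_add, app_comp, app_tmap, app_one, G.app_d2 hx, map_add, map_smul, sqDefect,
      G.app_d2 (G.homog_d hx), pow_succ]
    rcases neg_one_pow_eq_or k p with h | h <;> simp only [h] <;> module

theorem app_d2_d2 (u : ℕ → H ⊗[k] H) : app G.d2 (app G.d2 u) =
    app (G.sqDefect ⊠ one) u + app (one ⊠ G.sqDefect) u := by
  rw [← app_comp, d2_d2, app_add]

/-- The terms `d μ d` on the left cancel, and what remains contains `d²` on `H` or on `H ⊗ H`. -/
theorem leibDefect_d : G.d ⊚ G.leibDefect + G.leibDefect ⊚ G.d2 =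
    G.sqDefect ⊚ G.mul - G.mul ⊚ (G.sqDefect ⊠ one + one ⊠ G.sqDefect) :=
  ext_app fun u => by
    simp only [app_add, app_comp, leibDefect, app_sub, map_add, map_sub, app_d2_d2]
    simp only [sqDefect, app_comp]
    abel

theorem coleibDefect_d : G.coleibDefect ⊚ G.d + G.d2 ⊚ G.coleibDefect =
    G.comul ⊚ G.sqDefect - (G.sqDefect ⊠ one + one ⊠ G.sqDefect) ⊚ G.comul :=
  ext_app fun u => by
    simp only [app_add, app_comp, coleibDefect, app_sub, map_sub, app_d2_d2]
    simp only [sqDefect, app_comp]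
    abel

/-- The signed sum of the two products of adjacent factors `H ⊗ H ⊗ H → H ⊗ H`. -/
def bar2 : FormalMap k (H ⊗[k] (H ⊗[k] H)) (H ⊗[k] H) :=
  (G.mul ⊠ one) ⊚ const (TensorProduct.assoc k H H H).symm.toLinearMap - one ⊠ G.mul

/-- The signed sum of the three products of adjacent factors. -/
def bar3 : FormalMap k (H ⊗[k] (H ⊗[k] (H ⊗[k] H))) (H ⊗[k] (H ⊗[k] H)) :=
  (G.mul ⊠ one) ⊚ const (TensorProduct.assoc k H H (H ⊗[k] H)).symm.toLinearMap - one ⊠ G.bar2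

/-- The signed sum of the two coproducts `H ⊗ H → H ⊗ H ⊗ H`. -/
def cobar2 : FormalMap k (H ⊗[k] H) (H ⊗[k] (H ⊗[k] H)) :=
  const (TensorProduct.assoc k H H H).toLinearMap ⊚ (G.comul ⊠ one) - one ⊠ G.comul

/-- The signed sum of the three coproducts `H ⊗ H ⊗ H → H ⊗ H ⊗ H ⊗ H`. -/
def cobar3 : FormalMap k (H ⊗[k] (H ⊗[k] H)) (H ⊗[k] (H ⊗[k] (H ⊗[k] H))) :=
  const (TensorProduct.assoc k H H (H ⊗[k] H)).toLinearMap ⊚ (G.comul ⊠ one) - one ⊠ G.cobar2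

/-- Moving `d` through one multiplication costs a Leibniz defect. In each of the two bracketings
this happens twice, which gives the four terms on the right. -/
theorem assocDefect_d : G.d ⊚ G.assocDefect - G.assocDefect ⊚ G.d3 =
    G.leibDefect ⊚ G.bar2 +
      G.mul ⊚ (G.leibDefect ⊠ one) ⊚ const (TensorProduct.assoc k H H H).symm.toLinearMap -
      G.mul ⊚ (const (τ 𝒜) ⊠ G.leibDefect) :=
  hext₃ 𝒜 fun p q r x y z hx hy hz => by
    simp only [app_add, app_sub, app_comp, app_tmap, app_one, assocDefect, leibDefect, bar2,
      map_sub, map_add, map_smul, G.app_d2 hx, G.app_d2 (G.homog_mul hx hy), G.app_d3 hx,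
      app_assoc_symm, G.app_d2 hy, app_τ hx, st_add_left, st_add_right, st_sub_left, st_sub_right,
      st_smul_left, st_smul_right, pow_add]
    module

theorem τ_τ_of_mem {p : ℕ} : ∀ u ∈ gt 𝒜 𝒜 p,
    TensorProduct.map (τ 𝒜) (τ 𝒜) u = (-1 : k) ^ p • u := by
  intro u hu
  have := map_mem_of_gt (𝒢 := 𝒜) (ℋ := 𝒜) (q := p)
    (TensorProduct.map (τ 𝒜) (τ 𝒜) - (-1 : k) ^ p • LinearMap.id) (S := ⊥) ?_ u hu
  · simpa [sub_eq_zero] using this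
  · rintro a b rfl x hx y hy
    simp [τ_of_mem hx, τ_of_mem hy, pow_add, TensorProduct.smul_tmul', smul_smul, mul_comm]

theorem app_τ_τ {p : ℕ} {u : ℕ → H ⊗[k] H} (hu : Homog (gt 𝒜 𝒜) p u) :
    app (const (τ 𝒜) ⊠ const (τ 𝒜)) u = (-1 : k) ^ p • u := by
  have : const (τ 𝒜) ⊠ const (τ 𝒜) = const (TensorProduct.map (τ 𝒜) (τ 𝒜)) := by
    refine hext₂ 𝒜 fun p q x y hx hy => ?_
    funext n
    rw [app_tmap, app_const_st, st_apply]
    simp [app_const_apply]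
  rw [this]
  funext n
  rw [app_const_apply, τ_τ_of_mem _ (hu n), Pi.smul_apply]

theorem homog_comul (hx : Homog 𝒜 p x) : Homog (gt 𝒜 𝒜) p (app G.comul x) :=
  Homog.app G.comul_deg hx

/-- `d3` is bracketed to the right. In the other bracketing `d` passes two factors at once to reach
the third, whence the factor `τ ⊗ τ`. -/
theorem d3_assoc (u : ℕ → H ⊗[k] H) (y : ℕ → H) :
    app G.d3 (app (const (TensorProduct.assoc k H H H).toLinearMap) (st k u y)) =
    app (const (TensorProduct.assoc k H H H).toLinearMap)
      (st k (app G.d2 u) y + st k (app (const (τ 𝒜) ⊠ const (τ 𝒜)) u) (app G.d y)) := by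
  have : G.d3 ⊚ const (TensorProduct.assoc k H H H).toLinearMap =
      const (TensorProduct.assoc k H H H).toLinearMap ⊚
        (G.d2 ⊠ one + (const (τ 𝒜) ⊠ const (τ 𝒜)) ⊠ G.d) := by
    refine (((gen_homog 𝒜).tmul (gen_homog 𝒜)).tmul gen_true).ext ?_
    rintro _ ⟨_, z, ⟨x, y, ⟨p, hx⟩, ⟨q, hy⟩, rfl⟩, -, rfl⟩
    simp only [app_add, app_comp, app_tmap, app_assoc, G.app_d3 hx, G.app_d2 hx, G.app_d2 hy,
      app_τ hx, app_τ hy, st_add_left, st_add_right, st_smul_left, st_smul_right, map_add,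
      map_smul, app_one]
    module
  have h := congrArg (fun f => app f (st k u y)) this
  simpa only [app_comp, app_add, app_tmap, app_one] using h

theorem coassocDefect_d : G.coassocDefect ⊚ G.d - G.d3 ⊚ G.coassocDefect =
    G.cobar2 ⊚ G.coleibDefect +
      const (TensorProduct.assoc k H H H).toLinearMap ⊚ (G.coleibDefect ⊠ one) ⊚ G.comul -
      (const (τ 𝒜) ⊠ G.coleibDefect) ⊚ G.comul := by
  -- `Δ x` is not a pure tensor, so moving `d` through `Δ ⊗ 1` and `1 ⊗ Δ` is stated on all of `H ⊗
  -- H` and only afterwards evaluated at `Δ x`.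
  have h₁ : const (TensorProduct.assoc k H H H).toLinearMap ⊚ (G.comul ⊠ one) ⊚ G.d2 =
      const (TensorProduct.assoc k H H H).toLinearMap ⊚ (G.coleibDefect ⊠ one) +
      G.d3 ⊚ const (TensorProduct.assoc k H H H).toLinearMap ⊚ (G.comul ⊠ one) :=
    hext₂ 𝒜 fun p q x y hx hy => by
      simp only [app_add, app_comp, app_tmap, app_one, coleibDefect, app_sub, d3_assoc,
        app_τ_τ (G.homog_comul hx), st_sub_left, map_sub, map_add, map_smul, G.app_d2 hx,
        st_smul_left]
      abel
  have h₂ : (one ⊠ G.comul) ⊚ G.d2 =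
      const (τ 𝒜) ⊠ G.coleibDefect + G.d3 ⊚ (one ⊠ G.comul) :=
    hext₂ 𝒜 fun p q x y hx hy => by
      simp only [app_add, app_comp, app_tmap, app_one, coleibDefect, app_sub, G.app_d3 hx,
        app_τ hx, st_sub_right, map_add, map_smul, G.app_d2 hx, st_smul_left]
      module
  refine ext_app fun x => ?_
  have h₁' := congrArg (fun f => app f (app G.comul x)) h₁
  have h₂' := congrArg (fun f => app f (app G.comul x)) h₂
  simp only [app_comp, app_add] at h₁' h₂'
  simp only [coassocDefect, cobar2, app_add, app_sub, app_comp, map_sub]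
  rw [show app G.comul (app G.d x) = app G.coleibDefect x + app G.d2 (app G.comul x) by
    simp [coleibDefect]]
  simp only [map_add, h₁', h₂']
  abel

/-- The edges of the associativity pentagon: each of the five bracketings of a fourfold product
occurs twice, with opposite signs. -/
theorem assocDefect_pentagon :
    G.mul ⊚ (one ⊠ G.assocDefect) - G.assocDefect ⊚ G.bar3 +
      G.mul ⊚ (G.assocDefect ⊠ one) ⊚
        const (TensorProduct.assoc k H (H ⊗[k] H) H).symm.toLinearMap ⊚
        (one ⊠ const (TensorProduct.assoc k H H H).symm.toLinearMap) = 0 :=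
  ext₄ fun x y z w => by
    simp only [app_add, app_sub, app_comp, app_tmap, app_one, assocDefect, bar3, bar2,
      app_assoc_symm, app_zero, map_sub, st_sub_left, st_sub_right]
    abel

theorem coassocDefect_pentagon :
    (one ⊠ G.coassocDefect) ⊚ G.comul - G.cobar3 ⊚ G.coassocDefect +
      (one ⊠ const (TensorProduct.assoc k H H H).toLinearMap) ⊚
        const (TensorProduct.assoc k H (H ⊗[k] H) H).toLinearMap ⊚
        (G.coassocDefect ⊠ one) ⊚ G.comul = 0 := by
  -- Coherence of the associativity isomorphisms, needed because `T k H 3` is bracketed to the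
  -- right.
  have hp : ∀ (w : ℕ → H ⊗[k] H) (z y : ℕ → H),
      app (one ⊠ const (TensorProduct.assoc k H H H).toLinearMap)
        (app (const (TensorProduct.assoc k H (H ⊗[k] H) H).toLinearMap)
          (st k (app (const (TensorProduct.assoc k H H H).toLinearMap) (st k w z)) y)) =
      app (const (TensorProduct.assoc k H H (H ⊗[k] H)).toLinearMap) (st k w (st k z y)) := by
    intro w z y
    have : (one ⊠ const (TensorProduct.assoc k H H H).toLinearMap) ⊚
        const (TensorProduct.assoc k H (H ⊗[k] H) H).toLinearMap ⊚
          (const (TensorProduct.assoc k H H H).toLinearMap ⊠ one) =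
        const (TensorProduct.assoc k H H (H ⊗[k] H)).toLinearMap ⊚
          const (TensorProduct.assoc k (H ⊗[k] H) H H).toLinearMap := by
      refine (((gen_true.tmul gen_true).tmul gen_true).tmul gen_true).ext ?_
      rintro _ ⟨_, y, ⟨_, z, ⟨a, b, -, -, rfl⟩, -, rfl⟩, -, rfl⟩
      simp
    have h := congrArg (fun f => app f (st k (st k w z) y)) this
    simpa only [app_comp, app_tmap, app_one, app_assoc] using h
  have h₂ : ∀ (u : ℕ → H ⊗[k] H) (y : ℕ → H),
      app (one ⊠ const (TensorProduct.assoc k H H H).toLinearMap)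
        (app (const (TensorProduct.assoc k H (H ⊗[k] H) H).toLinearMap)
          (st k (app G.cobar2 u) y)) =
      app (const (TensorProduct.assoc k H H (H ⊗[k] H)).toLinearMap) (app (G.comul ⊠ one)
        (app (const (TensorProduct.assoc k H H H).toLinearMap) (st k u y))) -
      app (one ⊠ G.cobar2) (app (const (TensorProduct.assoc k H H H).toLinearMap) (st k u y)) -
      app (const (TensorProduct.assoc k H H (H ⊗[k] H)).toLinearMap)
        (st k u (app G.comul y)) := by
    intro u y
    have : (one ⊠ const (TensorProduct.assoc k H H H).toLinearMap) ⊚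
        const (TensorProduct.assoc k H (H ⊗[k] H) H).toLinearMap ⊚ (G.cobar2 ⊠ one) =
        const (TensorProduct.assoc k H H (H ⊗[k] H)).toLinearMap ⊚ (G.comul ⊠ one) ⊚
          const (TensorProduct.assoc k H H H).toLinearMap -
        (one ⊠ G.cobar2) ⊚ const (TensorProduct.assoc k H H H).toLinearMap -
        const (TensorProduct.assoc k H H (H ⊗[k] H)).toLinearMap ⊚ (one ⊠ G.comul) := by
      refine ((gen_true.tmul gen_true).tmul gen_true).ext ?_
      rintro _ ⟨_, y, ⟨a, b, -, -, rfl⟩, -, rfl⟩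
      simp only [app_sub, app_comp, app_tmap, app_one, cobar2, app_assoc, hp,
        st_sub_left, st_sub_right, map_sub]
      abel
    have h := congrArg (fun f => app f (st k u y)) this
    simpa only [app_comp, app_tmap, app_one, app_assoc, app_sub] using h
  -- The coassociativity defect is `cobar2` after `Δ`, so the claim follows from an identity on `H ⊗
  -- H` composed with one coproduct; on `H ⊗ H` pure tensors suffice.
  have key : (one ⊠ (G.cobar2 ⊚ G.comul)) - G.cobar3 ⊚ G.cobar2 +
      (one ⊠ const (TensorProduct.assoc k H H H).toLinearMap) ⊚
        const (TensorProduct.assoc k H (H ⊗[k] H) H).toLinearMap ⊚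
        ((G.cobar2 ⊚ G.comul) ⊠ one) = 0 := by
    refine (gen_true.tmul gen_true).ext ?_
    rintro _ ⟨x, y, -, -, rfl⟩
    simp only [app_add, app_sub, app_comp, app_tmap, app_one, h₂, cobar3, app_zero]
    rw [show app G.cobar2 (st k x y) = app (const (TensorProduct.assoc k H H H).toLinearMap)
      (st k (app G.comul x) y) - st k x (app G.comul y) by simp [cobar2]]
    simp only [map_sub, app_tmap, app_one]
    abel
  have hC : G.coassocDefect = G.cobar2 ⊚ G.comul :=
    ext_app fun x => by simp [coassocDefect, cobar2]
  rw [hC]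
  refine ext_app fun x => ?_
  have h := congrArg (fun f => app f (app G.comul x)) key
  simpa only [app_comp, app_add, app_sub, app_zero] using h

end PreHopf

namespace PreHopf

open FormalMap

variable {k : Type u} [Field k] {H : Type v} [AddCommGroup H] [Module k H]
  {𝒜 : ℕ → Submodule k H} [DirectSum.Decomposition 𝒜] (G : PreHopf 𝒜)

/-! #### Syzygies that involve both the product and the coproduct -/

/-- This is `u v - u' v' = (u - u') v + u' (v - v')`, where `u, u'` are the two bracketings in the
first tensor factor and `v, v'` those in the second. -/
theorem star_assocDefect :
    G.star ⊚ (G.star ⊠ one) ⊚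
        const (TensorProduct.assoc k (H ⊗[k] H) (H ⊗[k] H) (H ⊗[k] H)).symm.toLinearMap -
      G.star ⊚ (one ⊠ G.star) =
    (G.assocDefect ⊠ one) ⊚ (const (TensorProduct.assoc k H H H).toLinearMap ⊠ G.mul) ⊚
        const (midSwap 𝒜 (H ⊗[k] H) H) ⊚ (((one ⊠ G.mul) ⊚ const (midSwap 𝒜 H H)) ⊠ one) ⊚
        const (TensorProduct.assoc k (H ⊗[k] H) (H ⊗[k] H) (H ⊗[k] H)).symm.toLinearMap +
      (one ⊠ G.assocDefect) ⊚ (G.mul ⊠ one) ⊚ const (midSwap 𝒜 H (H ⊗[k] H)) ⊚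
        (one ⊠ ((G.mul ⊠ one) ⊚ const (midSwap 𝒜 H H))) :=
  hext₂₂₂ 𝒜 fun p q r s l m a b c e i j ha hb hc he hi hj => by
    simp only [app_add, app_sub, app_comp, app_tmap, app_one, app_assoc_symm, app_assoc,
      G.app_star _ _ hb hc, G.app_star _ _ he hi, st_smul_left, st_smul_right, map_smul,
      G.app_star _ _ (G.homog_mul hb he) hi, G.app_star _ _ hb (G.homog_mul hc hi),
      app_midSwap _ _ hb hc, app_midSwap _ _ he hi, app_midSwap _ _ hb (G.homog_mul hc hi),
      app_midSwap _ _ (G.homog_mul hb he) hi, assocDefect, st_sub_left, st_sub_right,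
      add_mul, mul_add, pow_add]
    module

/-- Replacing `Δ` of a product by the product of coproducts costs a compatibility defect, once for
each of the two products in each bracketing. What is left is the associator of `Δ x`, `Δ y`, `Δ z`
in `H ⊗ H`, given by `star_assocDefect`. -/
theorem comul_assocDefect :
    G.comul ⊚ G.assocDefect =
      G.compatDefect ⊚ G.bar2 +
      G.ract2 ⊚ (G.compatDefect ⊠ one) ⊚ const (TensorProduct.assoc k H H H).symm.toLinearMap -
      G.lact2 ⊚ (one ⊠ G.compatDefect) + (G.assocDefect ⊠ one) ⊚ G.rcoact3 +
      (one ⊠ G.assocDefect) ⊚ G.lcoact3 :=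
  hext₃ 𝒜 fun p q r x y z hx hy hz => by
    have h := congrArg (fun f => app f (st k (app G.comul x)
      (st k (app G.comul y) (app G.comul z)))) G.star_assocDefect
    simp only [app_add, app_sub, app_comp, app_tmap, app_one, app_assoc_symm] at h
    simp only [rcoact3, lcoact3, rcoact2, lcoact2, bar2, app_add, app_sub, app_comp, app_tmap,
      app_one, app_assoc_symm]
    rw [add_assoc, ← h]
    simp only [assocDefect, compatDefect, lact2, ract2, star, app_sub, app_comp, app_tmap, app_one,
      app_assoc_symm, map_sub, st_sub_left, st_sub_right]
    abel

theorem d2_star : G.d2 ⊚ G.star =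
    (G.leibDefect ⊠ one) ⊚ (one ⊠ G.mul) ⊚ const (midSwap 𝒜 H H) +
    (const (τ 𝒜) ⊠ G.leibDefect) ⊚ (G.mul ⊠ one) ⊚ const (midSwap 𝒜 H H) +
    G.star ⊚ (G.d2 ⊠ one + (const (τ 𝒜) ⊠ const (τ 𝒜)) ⊠ G.d2) :=
  hext₂₂ 𝒜 fun p q r s a b c e ha hb hc he => by
    simp only [app_add, app_sub, app_comp, app_tmap, app_one, leibDefect, G.app_star _ _ hb hc,
      app_midSwap _ _ hb hc, map_smul, map_add, G.app_d2 (G.homog_mul ha hc), G.app_d2 ha,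
      G.app_d2 hb, G.app_d2 hc, app_τ ha, app_τ hb, app_τ (G.homog_mul ha hc), st_add_left,
      st_add_right, st_sub_left, st_sub_right, st_smul_left, st_smul_right,
      G.app_star _ _ (G.homog_d hb) hc, G.app_star _ _ hb (G.homog_d hc), add_mul, mul_add,
      pow_add, one_mul, mul_one]
    rcases neg_one_pow_eq_or k q with h | h <;> rcases neg_one_pow_eq_or k r with h' | h' <;>
      simp only [h, h'] <;> module

/-- In `Δ(d(xy)) - Δ(dx · y) ∓ Δ(x · dy)`, both `Δ` past `μ` and `Δ` past `d` are exchanged at the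
cost of defects. The remainder is the failure of `d2` to be a derivation of the product of `H ⊗ H`,
computed in `d2_star`. -/
theorem comul_leibDefect :
    G.comul ⊚ G.leibDefect =
      G.coleibDefect ⊚ G.mul + G.d2 ⊚ G.compatDefect - G.compatDefect ⊚ G.d2 -
      G.lact2 ⊚ (const (τ 𝒜) ⊠ G.coleibDefect) - G.ract2 ⊚ (G.coleibDefect ⊠ one) +
      (G.leibDefect ⊠ one) ⊚ G.rcoact2 + (const (τ 𝒜) ⊠ G.leibDefect) ⊚ G.lcoact2 :=
  hext₂ 𝒜 fun p q x y hx hy => by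
    have h := congrArg (fun f => app f (st k (app G.comul x) (app G.comul y))) G.d2_star
    simp only [app_add, app_comp, app_tmap, app_one, app_τ_τ (G.homog_comul hx)] at h
    simp only [rcoact2, lcoact2, app_add, app_sub, app_comp, app_tmap]
    have h' : app (G.leibDefect ⊠ one) (app (one ⊠ G.mul) (app (const (midSwap 𝒜 H H))
        (st k (app G.comul x) (app G.comul y)))) +
        app (const (τ 𝒜) ⊠ G.leibDefect) (app (G.mul ⊠ one) (app (const (midSwap 𝒜 H H))
        (st k (app G.comul x) (app G.comul y)))) =
        app G.d2 (app G.star (st k (app G.comul x) (app G.comul y))) -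
        app G.star (st k (app G.d2 (app G.comul x)) (app G.comul y) +
          st k ((-1 : k) ^ p • app G.comul x) (app G.d2 (app G.comul y))) := by
      rw [h]; abel
    rw [add_assoc, h']
    simp only [leibDefect, coleibDefect, compatDefect, lact2, ract2, star, app_sub, app_comp,
      app_tmap, app_one, map_sub, map_add, map_smul, st_sub_left, st_sub_right, st_smul_left,
      G.app_d2 hx, app_τ hx]
    module


/-- The associativity isomorphism as a constant series. -/
abbrev asc (A B C : Type v) [AddCommGroup A] [Module k A] [AddCommGroup B] [Module k B]
    [AddCommGroup C] [Module k C] : FormalMap k ((A ⊗[k] B) ⊗[k] C) (A ⊗[k] (B ⊗[k] C)) :=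
  const (TensorProduct.assoc k A B C).toLinearMap

/-- The inverse of the associativity isomorphism as a constant series. -/
abbrev ascSymm (A B C : Type v) [AddCommGroup A] [Module k A] [AddCommGroup B] [Module k B]
    [AddCommGroup C] [Module k C] : FormalMap k (A ⊗[k] (B ⊗[k] C)) ((A ⊗[k] B) ⊗[k] C) :=
  const (TensorProduct.assoc k A B C).symm.toLinearMap

variable (𝒜) in
/-- The signed exchange of inner factors as a constant series. -/
abbrev msw (A B : Type v) [AddCommGroup A] [Module k A] [AddCommGroup B] [Module k B] :
    FormalMap k ((A ⊗[k] H) ⊗[k] (H ⊗[k] B)) ((A ⊗[k] H) ⊗[k] (H ⊗[k] B)) :=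
  const (midSwap 𝒜 A B)

variable (𝒜) in
/-- The signed exchange `(a ⊗ w) ⊗ (y ⊗ b) ↦ ± (a ⊗ y) ⊗ (w ⊗ b)` with `w` in `H ⊗ H`. -/
def blockSwapL (B : Type v) [AddCommGroup B] [Module k B] :
    FormalMap k ((H ⊗[k] (H ⊗[k] H)) ⊗[k] (H ⊗[k] B)) ((H ⊗[k] H) ⊗[k] ((H ⊗[k] H) ⊗[k] B)) :=
  (one ⊠ ascSymm H H B) ⊚ msw 𝒜 H (H ⊗[k] B) ⊚ asc (H ⊗[k] H) H (H ⊗[k] B) ⊚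
    msw 𝒜 (H ⊗[k] H) B ⊚ (ascSymm H H H ⊠ one)

variable (𝒜) in
/-- The signed exchange `(a ⊗ x) ⊗ (z ⊗ b) ↦ ± (a ⊗ z) ⊗ (x ⊗ b)` with `z` in `H ⊗ H`. -/
def blockSwapR (A : Type v) [AddCommGroup A] [Module k A] :
    FormalMap k ((A ⊗[k] H) ⊗[k] ((H ⊗[k] H) ⊗[k] H)) ((A ⊗[k] (H ⊗[k] H)) ⊗[k] (H ⊗[k] H)) :=
  (asc A H H ⊠ one) ⊚ msw 𝒜 (A ⊗[k] H) H ⊚ ascSymm (A ⊗[k] H) H (H ⊗[k] H) ⊚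
    msw 𝒜 A (H ⊗[k] H) ⊚ (one ⊠ asc H H H)

theorem app_blockSwapL_tmul {B : Type v} [AddCommGroup B] [Module k B] {r s q : ℕ}
    (a : ℕ → H) {w z y : ℕ → H} (b : ℕ → B) (hw : Homog 𝒜 r w) (hz : Homog 𝒜 s z)
    (hy : Homog 𝒜 q y) :
    app (blockSwapL 𝒜 B) (st k (st k a (st k w z)) (st k y b)) =
      (-1 : k) ^ ((r + s) * q) • st k (st k a y) (st k (st k w z) b) := by
  simp only [blockSwapL, app_comp, app_tmap, app_one, app_assoc_symm, app_midSwap _ _ hz hy,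
    map_smul, app_assoc, app_midSwap _ _ hw hy, smul_smul, add_mul, pow_add]
  rw [mul_comm]

theorem app_blockSwapR_tmul {A : Type v} [AddCommGroup A] [Module k A] {r s q : ℕ}
    (a : ℕ → A) {x w z : ℕ → H} (b : ℕ → H) (hx : Homog 𝒜 q x) (hw : Homog 𝒜 r w)
    (hz : Homog 𝒜 s z) :
    app (blockSwapR 𝒜 A) (st k (st k a x) (st k (st k w z) b)) =
      (-1 : k) ^ (q * (r + s)) • st k (st k a (st k w z)) (st k x b) := by
  simp only [blockSwapR, app_comp, app_tmap, app_one, app_assoc_symm, app_midSwap _ _ hx hz,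
    map_smul, app_assoc, app_midSwap _ _ hx hw, smul_smul, mul_add, pow_add]

/-- By `Homog.ext_gt` the sign depends only on the total degree of `w`, so the formula may be
applied to `w = Δ x`. -/
theorem app_blockSwapL {B : Type v} [AddCommGroup B] [Module k B] {r q : ℕ}
    (a : ℕ → H) {w : ℕ → H ⊗[k] H} {y : ℕ → H} (b : ℕ → B) (hw : Homog (gt 𝒜 𝒜) r w)
    (hy : Homog 𝒜 q y) :
    app (blockSwapL 𝒜 B) (st k (st k a w) (st k y b)) =
      (-1 : k) ^ (r * q) • st k (st k a y) (st k w b) := by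
  have := Homog.ext_gt (s := r) (f := blockSwapL 𝒜 B ⊚ insR _ (st k y b) ⊚ insL _ a)
    (g := (-1 : k) ^ (r * q) • (insL _ (st k a y) ⊚ insR (H ⊗[k] H) b))
    (fun i j hij x z hx hz => by
      subst hij
      simp only [app_comp, app_insL, app_insR, app_smul]
      exact app_blockSwapL_tmul a b hx hz hy) hw
  simpa only [app_comp, app_insL, app_insR, app_smul] using this

theorem app_blockSwapR {A : Type v} [AddCommGroup A] [Module k A] {r q : ℕ}
    (a : ℕ → A) {x : ℕ → H} {w : ℕ → H ⊗[k] H} (b : ℕ → H) (hx : Homog 𝒜 q x)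
    (hw : Homog (gt 𝒜 𝒜) r w) :
    app (blockSwapR 𝒜 A) (st k (st k a x) (st k w b)) =
      (-1 : k) ^ (q * r) • st k (st k a w) (st k x b) := by
  have := Homog.ext_gt (s := r) (f := blockSwapR 𝒜 A ⊚ insL _ (st k a x) ⊚ insR _ b)
    (g := (-1 : k) ^ (q * r) • (insR _ (st k x b) ⊚ insL (H ⊗[k] H) a))
    (fun i j hij w z hw' hz => by
      subst hij
      simp only [app_comp, app_insL, app_insR, app_smul]
      exact app_blockSwapR_tmul a b hx hw' hz) hw
  simpa only [app_comp, app_insL, app_insR, app_smul] using this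

/-- Since `Δ` has degree `0`, moving past `x` and moving past `Δ x` produce the same sign. -/
theorem comul_blockSwapL (B : Type v) [AddCommGroup B] [Module k B] :
    (one ⊠ (G.comul ⊠ one)) ⊚ const (midSwap 𝒜 H B) =
      blockSwapL 𝒜 B ⊚ ((one ⊠ G.comul) ⊠ one) := by
  refine (((gen_homog 𝒜).tmul (gen_homog 𝒜)).tmul ((gen_homog 𝒜).tmul gen_true)).ext ?_
  rintro _ ⟨_, _, ⟨a, x, ⟨p, ha⟩, ⟨q, hx⟩, rfl⟩, ⟨y, b, ⟨r, hy⟩, -, rfl⟩, rfl⟩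
  simp only [app_comp, app_tmap, app_one, app_midSwap _ _ hx hy, map_smul,
    app_blockSwapL _ _ (G.homog_comul hx) hy]

theorem comul_blockSwapR (A : Type v) [AddCommGroup A] [Module k A] :
    ((one ⊠ G.comul) ⊠ one) ⊚ const (midSwap 𝒜 A H) =
      blockSwapR 𝒜 A ⊚ (one ⊠ (G.comul ⊠ one)) := by
  refine ((gen_true.tmul (gen_homog 𝒜)).tmul ((gen_homog 𝒜).tmul (gen_homog 𝒜))).ext ?_
  rintro _ ⟨_, _, ⟨a, x, -, ⟨q, hx⟩, rfl⟩, ⟨y, b, ⟨r, hy⟩, -, rfl⟩, rfl⟩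
  simp only [app_comp, app_tmap, app_one, app_midSwap _ _ hx hy, map_smul,
    app_blockSwapR _ _ hx (G.homog_comul hy)]

/-- Both sides are the product of `H ⊗ H ⊗ H`, factor by factor, with two ways of bringing the
factors together; the two Koszul signs agree. -/
theorem star_blockSwap :
    (G.mul ⊠ G.star) ⊚ blockSwapL 𝒜 (H ⊗[k] H) ⊚
        (one ⊠ const (TensorProduct.assoc k H H H).toLinearMap) =
      const (TensorProduct.assoc k H H H).toLinearMap ⊚ (G.star ⊠ G.mul) ⊚
        blockSwapR 𝒜 (H ⊗[k] H) ⊚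
        (const (TensorProduct.assoc k H H H).symm.toLinearMap ⊠ one) := by
  refine (((gen_homog 𝒜).tmul ((gen_homog 𝒜).tmul (gen_homog 𝒜))).tmul
    (((gen_homog 𝒜).tmul (gen_homog 𝒜)).tmul (gen_homog 𝒜))).ext ?_
  rintro _ ⟨_, _, ⟨a, _, -, ⟨b, c, ⟨q, hb⟩, ⟨r, hc⟩, rfl⟩, rfl⟩,
    ⟨_, j, ⟨e, i, ⟨s, he⟩, ⟨l, hi⟩, rfl⟩, -, rfl⟩, rfl⟩
  simp only [app_comp, app_tmap, app_one, app_assoc, app_assoc_symm,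
    app_blockSwapL_tmul _ _ hb hc he, app_blockSwapR_tmul _ _ hc he hi, map_smul,
    G.app_star _ _ hc hi, G.app_star _ _ hb he, st_smul_left, st_smul_right, smul_smul, add_mul,
    mul_add, pow_add]
  congr 1
  ring

/-- The left action is multiplication by the iterated coproduct `(1 ⊗ Δ) Δ x`. The right action in
`app_ract3` uses `(Δ ⊗ 1) Δ y` instead; without coassociativity the distinction matters. -/
theorem app_lact3 (x : ℕ → H) (w : ℕ → H ⊗[k] (H ⊗[k] H)) :
    app G.lact3 (st k x w) = app (G.mul ⊠ G.star) (app (blockSwapL 𝒜 (H ⊗[k] H))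
      (st k (app (one ⊠ G.comul) (app G.comul x)) w)) := by
  have h := congrArg (fun f => app f (st k (app G.comul x) w)) (G.comul_blockSwapL (H ⊗[k] H))
  simp only [app_comp, app_tmap, app_one] at h
  have h' : G.mul ⊠ G.lact2 = (G.mul ⊠ G.star) ⊚ (one ⊠ (G.comul ⊠ one)) := by
    refine (gen_true.tmul gen_true).ext ?_
    rintro _ ⟨u, w, -, -, rfl⟩
    simp only [app_comp, app_tmap, app_one, lact2, star]
  rw [← h, ← app_comp (G.mul ⊠ G.star), ← h']
  simp only [lact3, app_comp, app_tmap, app_one]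

theorem app_ract3 (w : ℕ → H ⊗[k] (H ⊗[k] H)) (y : ℕ → H) :
    app G.ract3 (st k w y) = app (const (TensorProduct.assoc k H H H).toLinearMap)
      (app (G.star ⊠ G.mul) (app (blockSwapR 𝒜 (H ⊗[k] H))
        (st k (app (const (TensorProduct.assoc k H H H).symm.toLinearMap) w)
          (app (G.comul ⊠ one) (app G.comul y))))) := by
  have h := congrArg (fun f => app f (st k (app (const
    (TensorProduct.assoc k H H H).symm.toLinearMap) w) (app G.comul y)))
    (G.comul_blockSwapR (H ⊗[k] H))
  simp only [app_comp, app_tmap, app_one] at h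
  have h' : G.ract2 ⊠ G.mul = (G.star ⊠ G.mul) ⊚ ((one ⊠ G.comul) ⊠ one) := by
    refine (gen_true.tmul gen_true).ext ?_
    rintro _ ⟨u, w, -, -, rfl⟩
    simp only [app_comp, app_tmap, app_one, ract2, star]
  rw [← h, ← app_comp (G.star ⊠ G.mul), ← h']
  simp only [ract3, app_comp, app_tmap]

/-- The two ways of multiplying the threefold coproducts `x₁ ⊗ Δ x₂` and `Δ y₁ ⊗ y₂`. -/
theorem lact3_eq_ract3 (x y : ℕ → H) :
    app G.lact3 (st k x (app (const (TensorProduct.assoc k H H H).toLinearMap)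
      (app (G.comul ⊠ one) (app G.comul y)))) =
    app G.ract3 (st k (app (one ⊠ G.comul) (app G.comul x)) y) := by
  have h := congrArg (fun f => app f (st k (app (one ⊠ G.comul) (app G.comul x))
    (app (G.comul ⊠ one) (app G.comul y)))) G.star_blockSwap
  simp only [app_comp, app_tmap, app_one] at h
  rw [app_lact3, app_ract3, h]

theorem comul_one_star : (G.comul ⊠ one) ⊚ G.star =
    (G.compatDefect ⊠ one) ⊚ (one ⊠ G.mul) ⊚ const (midSwap 𝒜 H H) +
    (G.star ⊠ G.mul) ⊚ blockSwapR 𝒜 (H ⊗[k] H) ⊚ ((G.comul ⊠ one) ⊠ (G.comul ⊠ one)) :=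
  hext₂₂ 𝒜 fun p q r s a b c e ha hb hc he => by
    simp only [app_add, app_comp, app_tmap, app_one, G.app_star _ _ hb hc, app_midSwap _ _ hb hc,
      app_blockSwapR _ _ hb (G.homog_comul hc), map_smul, compatDefect, app_sub, st_sub_left]
    module

theorem one_comul_star : (one ⊠ G.comul) ⊚ G.star =
    (one ⊠ G.compatDefect) ⊚ (G.mul ⊠ one) ⊚ const (midSwap 𝒜 H H) +
    (G.mul ⊠ G.star) ⊚ blockSwapL 𝒜 (H ⊗[k] H) ⊚ ((one ⊠ G.comul) ⊠ (one ⊠ G.comul)) :=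
  hext₂₂ 𝒜 fun p q r s a b c e ha hb hc he => by
    simp only [app_add, app_comp, app_tmap, app_one, G.app_star _ _ hb hc, app_midSwap _ _ hb hc,
      app_blockSwapL _ _ (G.homog_comul hb) hc, map_smul, compatDefect, app_sub, st_sub_right]
    module

/-- After `Δ(xy)` is expanded, `Δ ⊗ 1` and `1 ⊗ Δ` are multiplicative up to compatibility defects
(`comul_one_star`, `one_comul_star`). There remains the difference of the products of the two kinds
of threefold coproducts of `x` and `y`. The mixed product of `(1 ⊗ Δ) Δ x` and `(Δ ⊗ 1) Δ y` occurs
in both action terms, with opposite signs, and cancels by `lact3_eq_ract3`. -/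
theorem coassocDefect_mul :
    G.coassocDefect ⊚ G.mul = G.cobar2 ⊚ G.compatDefect +
      const (TensorProduct.assoc k H H H).toLinearMap ⊚ (G.compatDefect ⊠ one) ⊚ G.rcoact2 -
      (one ⊠ G.compatDefect) ⊚ G.lcoact2 + G.lact3 ⊚ (one ⊠ G.coassocDefect) +
      G.ract3 ⊚ (G.coassocDefect ⊠ one) :=
  hext₂ 𝒜 fun p q x y hx hy => by
    have h₁ := congrArg (fun f => app f (st k (app G.comul x) (app G.comul y))) G.comul_one_star
    have h₂ := congrArg (fun f => app f (st k (app G.comul x) (app G.comul y))) G.one_comul_star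
    have hs : ∀ w : ℕ → (H ⊗[k] H) ⊗[k] H,
        app (const (TensorProduct.assoc k H H H).symm.toLinearMap)
          (app (const (TensorProduct.assoc k H H H).toLinearMap) w) = w := fun w => by
      funext n
      simp only [app_const_apply]
      exact (TensorProduct.assoc k H H H).symm_apply_apply _
    have hr := G.app_ract3 (app (const (TensorProduct.assoc k H H H).toLinearMap)
      (app (G.comul ⊠ one) (app G.comul x))) y
    have hl := G.app_lact3 x (app (one ⊠ G.comul) (app G.comul y))
    rw [hs] at hr
    simp only [app_add, app_comp, app_tmap] at h₁ h₂
    rw [← hl] at h₂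
    replace h₁ := congrArg (app (const (TensorProduct.assoc k H H H).toLinearMap)) h₁
    rw [map_add, ← hr] at h₁
    simp only [coassocDefect, cobar2, app_add, app_sub, app_comp, app_tmap, app_one, rcoact2,
      lcoact2, st_sub_left, st_sub_right, map_sub, lact3_eq_ract3]
    rw [show app G.comul (app G.mul (st k x y)) = app G.compatDefect (st k x y) +
      app G.star (st k (app G.comul x) (app G.comul y)) by simp [compatDefect]]
    simp only [map_add, h₁, h₂]
    abel

end PreHopf

/-! ### The low tensor powers as plain tensor products. -/

section Powers
variable (k : Type u) [Field k] (H : Type v) [AddCommGroup H] [Module k H]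

/-- `T k H 1` and `H ⊗ H` agree only by unfolding `TP`. The explicit type given to `@Eq` fixes the
plain form, in which later rewriting can proceed. -/
theorem pair_eq : @Eq (H ⊗[k] H →ₗ[k] H ⊗[k] H) ((pair k H).toLinearMap)
    (LinearMap.id) := by
  refine TensorProduct.ext' fun x y => rfl

theorem pair_symm_eq : @Eq (H ⊗[k] H →ₗ[k] H ⊗[k] H) ((pair k H).symm.toLinearMap)
    (LinearMap.id) := by
  refine TensorProduct.ext' fun x y => rfl

theorem snoc_zero : @Eq (H ⊗[k] H →ₗ[k] H ⊗[k] H) ((snoc k H 0).toLinearMap)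
    (LinearMap.id) := by
  refine TensorProduct.ext' fun x y => rfl

theorem snoc_zero_symm :
    @Eq (H ⊗[k] H →ₗ[k] H ⊗[k] H) ((snoc k H 0).symm.toLinearMap)
    (LinearMap.id) := by
  refine TensorProduct.ext' fun x y => rfl

theorem snoc_one : @Eq ((H ⊗[k] H) ⊗[k] H →ₗ[k] H ⊗[k] (H ⊗[k] H)) ((snoc k H 1).toLinearMap)
    ((TensorProduct.assoc k H H H).toLinearMap) := by
  refine TensorProduct.ext_threefold fun x y z => rfl

theorem snoc_one_symm :
    @Eq (H ⊗[k] (H ⊗[k] H) →ₗ[k] (H ⊗[k] H) ⊗[k] H) ((snoc k H 1).symm.toLinearMap)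
    ((TensorProduct.assoc k H H H).symm.toLinearMap) := by
  refine TensorProduct.ext_threefold' fun x y z => rfl

theorem snoc_two_symm :
    @Eq (H ⊗[k] (H ⊗[k] (H ⊗[k] H)) →ₗ[k] (H ⊗[k] (H ⊗[k] H)) ⊗[k] H) ((snoc k H 2).symm.toLinearMap)
    ((TensorProduct.assoc k H (H ⊗[k] H) H).symm.toLinearMap ∘ₗ
      TensorProduct.map LinearMap.id (TensorProduct.assoc k H H H).symm.toLinearMap) := by
  rw [← snoc_one_symm]
  show TensorProduct.map (LinearMap.id : H ⊗[k] (H ⊗[k] H) →ₗ[k] _) (LinearMap.id : H →ₗ[k] H) ∘ₗ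
    (TensorProduct.assoc k H (H ⊗[k] H) H).symm.toLinearMap ∘ₗ
    TensorProduct.map (LinearMap.id : H →ₗ[k] H) ((snoc k H 1).symm.toLinearMap :
      H ⊗[k] (H ⊗[k] H) →ₗ[k] (H ⊗[k] H) ⊗[k] H) = _
  rw [TensorProduct.map_id]
  rfl

theorem snoc_two :
    @Eq ((H ⊗[k] (H ⊗[k] H)) ⊗[k] H →ₗ[k] H ⊗[k] (H ⊗[k] (H ⊗[k] H))) ((snoc k H 2).toLinearMap)
    (TensorProduct.map LinearMap.id (TensorProduct.assoc k H H H).toLinearMap ∘ₗ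
      (TensorProduct.assoc k H (H ⊗[k] H) H).toLinearMap) := by
  rw [← snoc_one]
  show (TensorProduct.map (LinearMap.id : H →ₗ[k] H) ((snoc k H 1).toLinearMap :
      (H ⊗[k] H) ⊗[k] H →ₗ[k] H ⊗[k] (H ⊗[k] H)) ∘ₗ
    (TensorProduct.assoc k H (H ⊗[k] H) H).toLinearMap) ∘ₗ
    TensorProduct.map (LinearMap.id : H ⊗[k] (H ⊗[k] H) →ₗ[k] _) (LinearMap.id : H →ₗ[k] H) = _
  rw [TensorProduct.map_id]
  rfl

end Powers

/-! ### The Hochschild–Cartier differential in low arities -/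

/-- The constant terms of `G` are the operations of `X`. -/
structure PreHopf.Lifts {k : Type u} [Field k] {H : Type v} [AddCommGroup H] [Module k H]
    {𝒜 : ℕ → Submodule k H} [DirectSum.Decomposition 𝒜] (G : PreHopf 𝒜)
    (X : DGHopfAlgebra 𝒜) : Prop where
  d_zero : G.d 0 = X.d
  mul_zero : G.mul 0 = X.mul
  comul_zero : G.comul 0 = X.comul

section Forms

variable {k : Type u} [Field k] {H V V' W W' : Type*} [AddCommGroup H] [Module k H]
  [AddCommGroup V] [Module k V] [AddCommGroup V'] [Module k V'] [AddCommGroup W] [Module k W]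
  [AddCommGroup W'] [Module k W']

/-- The shape of the Hochschild differential, for given actions `l`, `r` and bar map `b`. -/
def barForm (t : H →ₗ[k] H) (c : k) (f : V →ₗ[k] W) (l : H ⊗[k] W →ₗ[k] W) (b : V' →ₗ[k] V)
    (r : W ⊗[k] H →ₗ[k] W) (e : V' →ₗ[k] H ⊗[k] V) (s : V' →ₗ[k] V ⊗[k] H) : V' →ₗ[k] W :=
  l ∘ₗ TensorProduct.map t f ∘ₗ e - f ∘ₗ b +
    c • (r ∘ₗ TensorProduct.map f LinearMap.id ∘ₗ s)

/-- The shape of the Cartier differential, for given coactions `l`, `r` and cobar map `b`. -/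
def cobarForm (t : H →ₗ[k] H) (c : k) (f : V →ₗ[k] W) (l : V →ₗ[k] H ⊗[k] V) (b : W →ₗ[k] W')
    (r : V →ₗ[k] V ⊗[k] H) (e : H ⊗[k] W →ₗ[k] W') (s : W ⊗[k] H →ₗ[k] W') : V →ₗ[k] W' :=
  e ∘ₗ TensorProduct.map t f ∘ₗ l - b ∘ₗ f +
    c • (s ∘ₗ TensorProduct.map f LinearMap.id ∘ₗ r)

end Forms

namespace DGHopfAlgebra

open FormalMap PreHopf

variable {k : Type u} [Field k] {H : Type v} [AddCommGroup H] [Module k H]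
  {𝒜 : ℕ → Submodule k H} [DirectSum.Decomposition 𝒜] {X : DGHopfAlgebra 𝒜} {G : PreHopf 𝒜}


/-- This and the following lemmas match the structure maps of the complex in low arity with the
constant terms of the corresponding series attached to `G`, so that leading coefficients of series
identities can be compared with `D`. -/
theorem lact_zero (h : G.Lifts X) : @Eq (H ⊗[k] H →ₗ[k] H) (X.lact 0)
    (G.mul 0) := by
  rw [h.mul_zero]; exact TensorProduct.ext' fun _ _ => rfl

theorem lact_one (h : G.Lifts X) : @Eq (H ⊗[k] (H ⊗[k] H) →ₗ[k] H ⊗[k] H) (X.lact 1)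
    (G.lact2 0) := by
  simp only [lact2, comp_zero, tmap_zero, const_zero, one_zero]
  show TensorProduct.map X.mul (X.lact 0 : H ⊗[k] H →ₗ[k] H) ∘ₗ midSwap 𝒜 H H ∘ₗ
    TensorProduct.map X.comul LinearMap.id = _
  rw [lact_zero h, h.mul_zero, h.comul_zero]; rfl

theorem lact_two (h : G.Lifts X) : @Eq (H ⊗[k] (H ⊗[k] (H ⊗[k] H)) →ₗ[k] H ⊗[k] (H ⊗[k] H)) (X.lact 2)
    (G.lact3 0) := by
  simp only [lact3, comp_zero, tmap_zero, const_zero, one_zero]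
  show TensorProduct.map X.mul (X.lact 1 : H ⊗[k] (H ⊗[k] H) →ₗ[k] H ⊗[k] H) ∘ₗ
    midSwap 𝒜 H (H ⊗[k] H) ∘ₗ TensorProduct.map X.comul LinearMap.id = _
  rw [lact_one h, h.mul_zero, h.comul_zero]; rfl

theorem ract_zero (h : G.Lifts X) : @Eq (H ⊗[k] H →ₗ[k] H) (X.ract 0)
    (G.mul 0) := by
  rw [h.mul_zero]; exact TensorProduct.ext' fun _ _ => rfl

theorem ract_one (h : G.Lifts X) : @Eq ((H ⊗[k] H) ⊗[k] H →ₗ[k] H ⊗[k] H) (X.ract 1)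
    (G.ract2 0) := by
  simp only [ract2, comp_zero, tmap_zero, const_zero, one_zero]
  show ((snoc k H 0).toLinearMap : H ⊗[k] H →ₗ[k] H ⊗[k] H) ∘ₗ
    TensorProduct.map (X.ract 0 : H ⊗[k] H →ₗ[k] H) X.mul ∘ₗ midSwap 𝒜 H H ∘ₗ
    TensorProduct.map ((snoc k H 0).symm.toLinearMap : H ⊗[k] H →ₗ[k] H ⊗[k] H) X.comul = _
  rw [ract_zero h, h.mul_zero, h.comul_zero, snoc_zero, snoc_zero_symm]; rfl

theorem ract_two (h : G.Lifts X) : @Eq ((H ⊗[k] (H ⊗[k] H)) ⊗[k] H →ₗ[k] H ⊗[k] (H ⊗[k] H)) (X.ract 2)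
    (G.ract3 0) := by
  simp only [ract3, comp_zero, tmap_zero, const_zero]
  show ((snoc k H 1).toLinearMap : (H ⊗[k] H) ⊗[k] H →ₗ[k] H ⊗[k] (H ⊗[k] H)) ∘ₗ
    TensorProduct.map (X.ract 1 : (H ⊗[k] H) ⊗[k] H →ₗ[k] H ⊗[k] H) X.mul ∘ₗ
    midSwap 𝒜 (H ⊗[k] H) H ∘ₗ
    TensorProduct.map ((snoc k H 1).symm.toLinearMap :
      H ⊗[k] (H ⊗[k] H) →ₗ[k] (H ⊗[k] H) ⊗[k] H) X.comul = _
  rw [ract_one h, h.mul_zero, h.comul_zero, snoc_one, snoc_one_symm]; rfl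

theorem lcoact_zero (h : G.Lifts X) : @Eq (H →ₗ[k] H ⊗[k] H) (X.lcoact 0)
    (G.comul 0) := by
  rw [h.comul_zero]
  show TensorProduct.map (LinearMap.id : H →ₗ[k] H) (LinearMap.id : H →ₗ[k] H) ∘ₗ X.comul = _
  rw [TensorProduct.map_id]; rfl

theorem lcoact_one (h : G.Lifts X) : @Eq (H ⊗[k] H →ₗ[k] H ⊗[k] (H ⊗[k] H)) (X.lcoact 1)
    (G.lcoact2 0) := by
  simp only [lcoact2, comp_zero, tmap_zero, const_zero, one_zero]
  show TensorProduct.map X.mul LinearMap.id ∘ₗ midSwap 𝒜 H H ∘ₗ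
    TensorProduct.map X.comul (X.lcoact 0 : H →ₗ[k] H ⊗[k] H) = _
  rw [lcoact_zero h, h.mul_zero, h.comul_zero]; rfl

theorem lcoact_two (h : G.Lifts X) : @Eq (H ⊗[k] (H ⊗[k] H) →ₗ[k] H ⊗[k] (H ⊗[k] (H ⊗[k] H))) (X.lcoact 2)
    (G.lcoact3 0) := by
  simp only [lcoact3, comp_zero, tmap_zero, const_zero, one_zero]
  show TensorProduct.map X.mul LinearMap.id ∘ₗ midSwap 𝒜 H (H ⊗[k] H) ∘ₗ
    TensorProduct.map X.comul (X.lcoact 1 : H ⊗[k] H →ₗ[k] H ⊗[k] (H ⊗[k] H)) = _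
  rw [lcoact_one h, h.mul_zero, h.comul_zero]; rfl

theorem rcoact_zero (h : G.Lifts X) : @Eq (H →ₗ[k] H ⊗[k] H) (X.rcoact 0)
    (G.comul 0) := by
  rw [h.comul_zero]
  show TensorProduct.map (LinearMap.id : H →ₗ[k] H) (LinearMap.id : H →ₗ[k] H) ∘ₗ X.comul = _
  rw [TensorProduct.map_id]; rfl

theorem rcoact_one (h : G.Lifts X) : @Eq (H ⊗[k] H →ₗ[k] (H ⊗[k] H) ⊗[k] H) (X.rcoact 1)
    (G.rcoact2 0) := by
  simp only [rcoact2, comp_zero, tmap_zero, const_zero, one_zero]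
  show TensorProduct.map ((snoc k H 0).toLinearMap : H ⊗[k] H →ₗ[k] H ⊗[k] H) X.mul ∘ₗ
    midSwap 𝒜 H H ∘ₗ TensorProduct.map (X.rcoact 0 : H →ₗ[k] H ⊗[k] H) X.comul ∘ₗ
    ((snoc k H 0).symm.toLinearMap : H ⊗[k] H →ₗ[k] H ⊗[k] H) = _
  rw [rcoact_zero h, h.mul_zero, h.comul_zero, snoc_zero, snoc_zero_symm]; rfl

theorem rcoact_two (h : G.Lifts X) : @Eq (H ⊗[k] (H ⊗[k] H) →ₗ[k] (H ⊗[k] (H ⊗[k] H)) ⊗[k] H) (X.rcoact 2)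
    (G.rcoact3 0) := by
  simp only [rcoact3, comp_zero, tmap_zero, const_zero]
  show TensorProduct.map ((snoc k H 1).toLinearMap :
      (H ⊗[k] H) ⊗[k] H →ₗ[k] H ⊗[k] (H ⊗[k] H)) X.mul ∘ₗ
    midSwap 𝒜 (H ⊗[k] H) H ∘ₗ
    TensorProduct.map (X.rcoact 1 : H ⊗[k] H →ₗ[k] (H ⊗[k] H) ⊗[k] H) X.comul ∘ₗ
    ((snoc k H 1).symm.toLinearMap : H ⊗[k] (H ⊗[k] H) →ₗ[k] (H ⊗[k] H) ⊗[k] H) = _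
  rw [rcoact_one h, h.mul_zero, h.comul_zero, snoc_one, snoc_one_symm]; rfl

theorem bar_zero (h : G.Lifts X) : @Eq (H ⊗[k] H →ₗ[k] H) (X.bar 0)
    (G.mul 0) := by
  rw [h.mul_zero]; exact TensorProduct.ext' fun _ _ => rfl

theorem bar_one (h : G.Lifts X) : @Eq (H ⊗[k] (H ⊗[k] H) →ₗ[k] H ⊗[k] H) (X.bar 1)
    (G.bar2 0) := by
  simp only [bar2, Pi.sub_apply, comp_zero, tmap_zero, const_zero, one_zero]
  show TensorProduct.map X.mul LinearMap.id ∘ₗ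
    (TensorProduct.assoc k H H H).symm.toLinearMap ∘ₗ
    TensorProduct.map (LinearMap.id : H →ₗ[k] H) (LinearMap.id : H ⊗[k] H →ₗ[k] H ⊗[k] H) -
    TensorProduct.map LinearMap.id (X.bar 0 : H ⊗[k] H →ₗ[k] H) = _
  rw [bar_zero h, h.mul_zero, TensorProduct.map_id]; rfl

theorem bar_two (h : G.Lifts X) : @Eq (H ⊗[k] (H ⊗[k] (H ⊗[k] H)) →ₗ[k] H ⊗[k] (H ⊗[k] H)) (X.bar 2)
    (G.bar3 0) := by
  simp only [bar3, Pi.sub_apply, comp_zero, tmap_zero, const_zero, one_zero]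
  show TensorProduct.map X.mul LinearMap.id ∘ₗ
    (TensorProduct.assoc k H H (H ⊗[k] H)).symm.toLinearMap ∘ₗ
    TensorProduct.map (LinearMap.id : H →ₗ[k] H)
      (LinearMap.id : H ⊗[k] (H ⊗[k] H) →ₗ[k] H ⊗[k] (H ⊗[k] H)) -
    TensorProduct.map LinearMap.id (X.bar 1 : H ⊗[k] (H ⊗[k] H) →ₗ[k] H ⊗[k] H) = _
  rw [bar_one h, h.mul_zero, TensorProduct.map_id]; rfl

theorem cobar_zero (h : G.Lifts X) : @Eq (H →ₗ[k] H ⊗[k] H) (X.cobar 0)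
    (G.comul 0) := by
  rw [h.comul_zero]
  show ((pair k H).toLinearMap : H ⊗[k] H →ₗ[k] H ⊗[k] H) ∘ₗ X.comul = _
  rw [pair_eq]; rfl

theorem cobar_one (h : G.Lifts X) : @Eq (H ⊗[k] H →ₗ[k] H ⊗[k] (H ⊗[k] H)) (X.cobar 1)
    (G.cobar2 0) := by
  simp only [cobar2, Pi.sub_apply, comp_zero, tmap_zero, const_zero, one_zero]
  show TensorProduct.map (LinearMap.id : H →ₗ[k] H) (LinearMap.id : H ⊗[k] H →ₗ[k] H ⊗[k] H) ∘ₗ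
    (TensorProduct.assoc k H H H).toLinearMap ∘ₗ TensorProduct.map X.comul LinearMap.id -
    TensorProduct.map LinearMap.id (X.cobar 0 : H →ₗ[k] H ⊗[k] H) = _
  rw [cobar_zero h, h.comul_zero, TensorProduct.map_id]; rfl

theorem cobar_two (h : G.Lifts X) : @Eq (H ⊗[k] (H ⊗[k] H) →ₗ[k] H ⊗[k] (H ⊗[k] (H ⊗[k] H))) (X.cobar 2)
    (G.cobar3 0) := by
  simp only [cobar3, Pi.sub_apply, comp_zero, tmap_zero, const_zero, one_zero]
  show TensorProduct.map (LinearMap.id : H →ₗ[k] H)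
      (LinearMap.id : H ⊗[k] (H ⊗[k] H) →ₗ[k] H ⊗[k] (H ⊗[k] H)) ∘ₗ
    (TensorProduct.assoc k H H (H ⊗[k] H)).toLinearMap ∘ₗ
    TensorProduct.map X.comul LinearMap.id -
    TensorProduct.map LinearMap.id (X.cobar 1 : H ⊗[k] H →ₗ[k] H ⊗[k] (H ⊗[k] H)) = _
  rw [cobar_one h, h.comul_zero, TensorProduct.map_id]; rfl

theorem dInt_zero (h : G.Lifts X) : @Eq (H →ₗ[k] H) (X.dInt 0)
    (G.d 0) := by
  rw [h.d_zero]; rfl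

theorem dInt_one (h : G.Lifts X) : @Eq (H ⊗[k] H →ₗ[k] H ⊗[k] H) (X.dInt 1)
    (G.d2 0) := by
  simp only [d2, Pi.add_apply, tmap_zero, const_zero, one_zero]
  rw [h.d_zero]; rfl

theorem dInt_two (h : G.Lifts X) : @Eq (H ⊗[k] (H ⊗[k] H) →ₗ[k] H ⊗[k] (H ⊗[k] H)) (X.dInt 2)
    (G.d3 0) := by
  simp only [d3, Pi.add_apply, tmap_zero, const_zero, one_zero]
  rw [← dInt_one h, h.d_zero]; rfl

theorem barC_zero_zero (h : G.Lifts X) (p : ℕ) (f : H →ₗ[k] H) :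
    @Eq (H ⊗[k] H →ₗ[k] H) (X.barC p 0 0 f)
    (G.mul 0 ∘ₗ TensorProduct.map (τ 𝒜 ^ p) f - f ∘ₗ G.mul 0 +
        G.mul 0 ∘ₗ TensorProduct.map f LinearMap.id) := by
  -- With the structure maps as variables the formula for `barC` holds by `rfl`. Their values are
  -- then supplied as equations at the plain types, which avoids rewriting inside terms typed with
  -- `T k H i`. The same device recurs below.
  have key : ∀ (l : H ⊗[k] H →ₗ[k] H) (b : (H ⊗[k] H) →ₗ[k] H) (r : H ⊗[k] H →ₗ[k] H)
      (s : (H ⊗[k] H) →ₗ[k] H ⊗[k] H), X.lact 0 = l → X.bar 0 = b → X.ract 0 = r →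
      (snoc k H 0).symm.toLinearMap = s → @Eq ((H ⊗[k] H) →ₗ[k] H) (X.barC p 0 0 f)
        (barForm (τ 𝒜 ^ p) ((-1 : k) ^ 2) f l b r LinearMap.id s) := by
    rintro _ _ _ _ rfl rfl rfl rfl; rfl
  rw [key _ _ _ _ (lact_zero h) (bar_zero h) (ract_zero h) (snoc_zero_symm k H), barForm]
  simp only [LinearMap.comp_id]
  module

theorem barC_one_zero (h : G.Lifts X) (p : ℕ) (f : H ⊗[k] H →ₗ[k] H) :
    @Eq (H ⊗[k] (H ⊗[k] H) →ₗ[k] H) (X.barC p 1 0 f)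
    (G.mul 0 ∘ₗ TensorProduct.map (τ 𝒜 ^ p) f - f ∘ₗ G.bar2 0 -
        G.mul 0 ∘ₗ TensorProduct.map f LinearMap.id ∘ₗ
          (TensorProduct.assoc k H H H).symm.toLinearMap) := by
  have key : ∀ (l : H ⊗[k] H →ₗ[k] H) (b : (H ⊗[k] (H ⊗[k] H)) →ₗ[k] (H ⊗[k] H)) (r : H ⊗[k] H →ₗ[k] H)
      (s : (H ⊗[k] (H ⊗[k] H)) →ₗ[k] (H ⊗[k] H) ⊗[k] H), X.lact 0 = l → X.bar 1 = b → X.ract 0 = r →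
      (snoc k H 1).symm.toLinearMap = s → @Eq ((H ⊗[k] (H ⊗[k] H)) →ₗ[k] H) (X.barC p 1 0 f)
        (barForm (τ 𝒜 ^ p) ((-1 : k) ^ 3) f l b r LinearMap.id s) := by
    rintro _ _ _ _ rfl rfl rfl rfl; rfl
  rw [key _ _ _ _ (lact_zero h) (bar_one h) (ract_zero h) (snoc_one_symm k H), barForm]
  simp only [LinearMap.comp_id]
  module

theorem barC_two_zero (h : G.Lifts X) (p : ℕ) (f : H ⊗[k] (H ⊗[k] H) →ₗ[k] H) :
    @Eq (H ⊗[k] (H ⊗[k] (H ⊗[k] H)) →ₗ[k] H) (X.barC p 2 0 f)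
    (G.mul 0 ∘ₗ TensorProduct.map (τ 𝒜 ^ p) f - f ∘ₗ G.bar3 0 +
        G.mul 0 ∘ₗ TensorProduct.map f LinearMap.id ∘ₗ
          (TensorProduct.assoc k H (H ⊗[k] H) H).symm.toLinearMap ∘ₗ
          TensorProduct.map LinearMap.id (TensorProduct.assoc k H H H).symm.toLinearMap) := by
  have key : ∀ (l : H ⊗[k] H →ₗ[k] H) (b : (H ⊗[k] (H ⊗[k] (H ⊗[k] H))) →ₗ[k] (H ⊗[k] (H ⊗[k] H))) (r : H ⊗[k] H →ₗ[k] H)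
      (s : (H ⊗[k] (H ⊗[k] (H ⊗[k] H))) →ₗ[k] (H ⊗[k] (H ⊗[k] H)) ⊗[k] H), X.lact 0 = l → X.bar 2 = b → X.ract 0 = r →
      (snoc k H 2).symm.toLinearMap = s → @Eq ((H ⊗[k] (H ⊗[k] (H ⊗[k] H))) →ₗ[k] H) (X.barC p 2 0 f)
        (barForm (τ 𝒜 ^ p) ((-1 : k) ^ 4) f l b r LinearMap.id s) := by
    rintro _ _ _ _ rfl rfl rfl rfl; rfl
  rw [key _ _ _ _ (lact_zero h) (bar_two h) (ract_zero h) (snoc_two_symm k H), barForm]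
  simp only [LinearMap.comp_id]
  module

theorem barC_zero_one (h : G.Lifts X) (p : ℕ) (f : H →ₗ[k] H ⊗[k] H) :
    @Eq (H ⊗[k] H →ₗ[k] H ⊗[k] H) (X.barC p 0 1 f)
    (G.lact2 0 ∘ₗ TensorProduct.map (τ 𝒜 ^ p) f - f ∘ₗ G.mul 0 +
        G.ract2 0 ∘ₗ TensorProduct.map f LinearMap.id) := by
  have key : ∀ (l : H ⊗[k] (H ⊗[k] H) →ₗ[k] (H ⊗[k] H)) (b : (H ⊗[k] H) →ₗ[k] H) (r : (H ⊗[k] H) ⊗[k] H →ₗ[k] (H ⊗[k] H))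
      (s : (H ⊗[k] H) →ₗ[k] H ⊗[k] H), X.lact 1 = l → X.bar 0 = b → X.ract 1 = r →
      (snoc k H 0).symm.toLinearMap = s → @Eq ((H ⊗[k] H) →ₗ[k] (H ⊗[k] H)) (X.barC p 0 1 f)
        (barForm (τ 𝒜 ^ p) ((-1 : k) ^ 2) f l b r LinearMap.id s) := by
    rintro _ _ _ _ rfl rfl rfl rfl; rfl
  rw [key _ _ _ _ (lact_one h) (bar_zero h) (ract_one h) (snoc_zero_symm k H), barForm]
  simp only [LinearMap.comp_id]
  module

theorem barC_one_one (h : G.Lifts X) (p : ℕ) (f : H ⊗[k] H →ₗ[k] H ⊗[k] H) :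
    @Eq (H ⊗[k] (H ⊗[k] H) →ₗ[k] H ⊗[k] H) (X.barC p 1 1 f)
    (G.lact2 0 ∘ₗ TensorProduct.map (τ 𝒜 ^ p) f - f ∘ₗ G.bar2 0 -
        G.ract2 0 ∘ₗ TensorProduct.map f LinearMap.id ∘ₗ
          (TensorProduct.assoc k H H H).symm.toLinearMap) := by
  have key : ∀ (l : H ⊗[k] (H ⊗[k] H) →ₗ[k] (H ⊗[k] H)) (b : (H ⊗[k] (H ⊗[k] H)) →ₗ[k] (H ⊗[k] H)) (r : (H ⊗[k] H) ⊗[k] H →ₗ[k] (H ⊗[k] H))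
      (s : (H ⊗[k] (H ⊗[k] H)) →ₗ[k] (H ⊗[k] H) ⊗[k] H), X.lact 1 = l → X.bar 1 = b → X.ract 1 = r →
      (snoc k H 1).symm.toLinearMap = s → @Eq ((H ⊗[k] (H ⊗[k] H)) →ₗ[k] (H ⊗[k] H)) (X.barC p 1 1 f)
        (barForm (τ 𝒜 ^ p) ((-1 : k) ^ 3) f l b r LinearMap.id s) := by
    rintro _ _ _ _ rfl rfl rfl rfl; rfl
  rw [key _ _ _ _ (lact_one h) (bar_one h) (ract_one h) (snoc_one_symm k H), barForm]
  simp only [LinearMap.comp_id]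
  module

theorem barC_zero_two (h : G.Lifts X) (p : ℕ) (f : H →ₗ[k] H ⊗[k] (H ⊗[k] H)) :
    @Eq (H ⊗[k] H →ₗ[k] H ⊗[k] (H ⊗[k] H)) (X.barC p 0 2 f)
    (G.lact3 0 ∘ₗ TensorProduct.map (τ 𝒜 ^ p) f - f ∘ₗ G.mul 0 +
        G.ract3 0 ∘ₗ TensorProduct.map f LinearMap.id) := by
  have key : ∀ (l : H ⊗[k] (H ⊗[k] (H ⊗[k] H)) →ₗ[k] (H ⊗[k] (H ⊗[k] H))) (b : (H ⊗[k] H) →ₗ[k] H) (r : (H ⊗[k] (H ⊗[k] H)) ⊗[k] H →ₗ[k] (H ⊗[k] (H ⊗[k] H)))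
      (s : (H ⊗[k] H) →ₗ[k] H ⊗[k] H), X.lact 2 = l → X.bar 0 = b → X.ract 2 = r →
      (snoc k H 0).symm.toLinearMap = s → @Eq ((H ⊗[k] H) →ₗ[k] (H ⊗[k] (H ⊗[k] H))) (X.barC p 0 2 f)
        (barForm (τ 𝒜 ^ p) ((-1 : k) ^ 2) f l b r LinearMap.id s) := by
    rintro _ _ _ _ rfl rfl rfl rfl; rfl
  rw [key _ _ _ _ (lact_two h) (bar_zero h) (ract_two h) (snoc_zero_symm k H), barForm]
  simp only [LinearMap.comp_id]
  module

theorem cobarC_zero_zero (h : G.Lifts X) (p : ℕ) (f : H →ₗ[k] H) :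
    @Eq (H →ₗ[k] H ⊗[k] H) (X.cobarC p 0 0 f)
    (TensorProduct.map (τ 𝒜 ^ p) f ∘ₗ G.comul 0 - G.comul 0 ∘ₗ f +
        TensorProduct.map f LinearMap.id ∘ₗ G.comul 0) := by
  have key : ∀ (l : H →ₗ[k] H ⊗[k] H) (b : H →ₗ[k] (H ⊗[k] H)) (r : H →ₗ[k] H ⊗[k] H)
      (s : H ⊗[k] H →ₗ[k] (H ⊗[k] H)), X.lcoact 0 = l → X.cobar 0 = b → X.rcoact 0 = r →
      (snoc k H 0).toLinearMap = s → @Eq (H →ₗ[k] (H ⊗[k] H)) (X.cobarC p 0 0 f)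
        (cobarForm (τ 𝒜 ^ p) ((-1 : k) ^ 2) f l b r LinearMap.id s) := by
    rintro _ _ _ _ rfl rfl rfl rfl; rfl
  rw [key _ _ _ _ (lcoact_zero h) (cobar_zero h) (rcoact_zero h) (snoc_zero k H), cobarForm]
  simp only [LinearMap.id_comp]
  module

theorem cobarC_zero_one (h : G.Lifts X) (p : ℕ) (f : H →ₗ[k] H ⊗[k] H) :
    @Eq (H →ₗ[k] H ⊗[k] (H ⊗[k] H)) (X.cobarC p 0 1 f)
    (TensorProduct.map (τ 𝒜 ^ p) f ∘ₗ G.comul 0 - G.cobar2 0 ∘ₗ f -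
        (TensorProduct.assoc k H H H).toLinearMap ∘ₗ TensorProduct.map f LinearMap.id ∘ₗ
          G.comul 0) := by
  have key : ∀ (l : H →ₗ[k] H ⊗[k] H) (b : (H ⊗[k] H) →ₗ[k] (H ⊗[k] (H ⊗[k] H))) (r : H →ₗ[k] H ⊗[k] H)
      (s : (H ⊗[k] H) ⊗[k] H →ₗ[k] (H ⊗[k] (H ⊗[k] H))), X.lcoact 0 = l → X.cobar 1 = b → X.rcoact 0 = r →
      (snoc k H 1).toLinearMap = s → @Eq (H →ₗ[k] (H ⊗[k] (H ⊗[k] H))) (X.cobarC p 0 1 f)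
        (cobarForm (τ 𝒜 ^ p) ((-1 : k) ^ 3) f l b r LinearMap.id s) := by
    rintro _ _ _ _ rfl rfl rfl rfl; rfl
  rw [key _ _ _ _ (lcoact_zero h) (cobar_one h) (rcoact_zero h) (snoc_one k H), cobarForm]
  simp only [LinearMap.id_comp]
  module

theorem cobarC_zero_two (h : G.Lifts X) (p : ℕ) (f : H →ₗ[k] H ⊗[k] (H ⊗[k] H)) :
    @Eq (H →ₗ[k] H ⊗[k] (H ⊗[k] (H ⊗[k] H))) (X.cobarC p 0 2 f)
    (TensorProduct.map (τ 𝒜 ^ p) f ∘ₗ G.comul 0 - G.cobar3 0 ∘ₗ f +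
        (TensorProduct.map LinearMap.id (TensorProduct.assoc k H H H).toLinearMap ∘ₗ
          (TensorProduct.assoc k H (H ⊗[k] H) H).toLinearMap) ∘ₗ
          TensorProduct.map f LinearMap.id ∘ₗ G.comul 0) := by
  have key : ∀ (l : H →ₗ[k] H ⊗[k] H) (b : (H ⊗[k] (H ⊗[k] H)) →ₗ[k] (H ⊗[k] (H ⊗[k] (H ⊗[k] H)))) (r : H →ₗ[k] H ⊗[k] H)
      (s : (H ⊗[k] (H ⊗[k] H)) ⊗[k] H →ₗ[k] (H ⊗[k] (H ⊗[k] (H ⊗[k] H)))), X.lcoact 0 = l → X.cobar 2 = b → X.rcoact 0 = r →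
      (snoc k H 2).toLinearMap = s → @Eq (H →ₗ[k] (H ⊗[k] (H ⊗[k] (H ⊗[k] H)))) (X.cobarC p 0 2 f)
        (cobarForm (τ 𝒜 ^ p) ((-1 : k) ^ 4) f l b r LinearMap.id s) := by
    rintro _ _ _ _ rfl rfl rfl rfl; rfl
  rw [key _ _ _ _ (lcoact_zero h) (cobar_two h) (rcoact_zero h) (snoc_two k H), cobarForm]
  simp only [LinearMap.id_comp]
  module

theorem cobarC_one_zero (h : G.Lifts X) (p : ℕ) (f : H ⊗[k] H →ₗ[k] H) :
    @Eq (H ⊗[k] H →ₗ[k] H ⊗[k] H) (X.cobarC p 1 0 f)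
    (TensorProduct.map (τ 𝒜 ^ p) f ∘ₗ G.lcoact2 0 - G.comul 0 ∘ₗ f +
        TensorProduct.map f LinearMap.id ∘ₗ G.rcoact2 0) := by
  have key : ∀ (l : (H ⊗[k] H) →ₗ[k] H ⊗[k] (H ⊗[k] H)) (b : H →ₗ[k] (H ⊗[k] H)) (r : (H ⊗[k] H) →ₗ[k] (H ⊗[k] H) ⊗[k] H)
      (s : H ⊗[k] H →ₗ[k] (H ⊗[k] H)), X.lcoact 1 = l → X.cobar 0 = b → X.rcoact 1 = r →
      (snoc k H 0).toLinearMap = s → @Eq ((H ⊗[k] H) →ₗ[k] (H ⊗[k] H)) (X.cobarC p 1 0 f)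
        (cobarForm (τ 𝒜 ^ p) ((-1 : k) ^ 2) f l b r LinearMap.id s) := by
    rintro _ _ _ _ rfl rfl rfl rfl; rfl
  rw [key _ _ _ _ (lcoact_one h) (cobar_zero h) (rcoact_one h) (snoc_zero k H), cobarForm]
  simp only [LinearMap.id_comp]
  module

theorem cobarC_one_one (h : G.Lifts X) (p : ℕ) (f : H ⊗[k] H →ₗ[k] H ⊗[k] H) :
    @Eq (H ⊗[k] H →ₗ[k] H ⊗[k] (H ⊗[k] H)) (X.cobarC p 1 1 f)
    (TensorProduct.map (τ 𝒜 ^ p) f ∘ₗ G.lcoact2 0 - G.cobar2 0 ∘ₗ f -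
        (TensorProduct.assoc k H H H).toLinearMap ∘ₗ TensorProduct.map f LinearMap.id ∘ₗ
          G.rcoact2 0) := by
  have key : ∀ (l : (H ⊗[k] H) →ₗ[k] H ⊗[k] (H ⊗[k] H)) (b : (H ⊗[k] H) →ₗ[k] (H ⊗[k] (H ⊗[k] H))) (r : (H ⊗[k] H) →ₗ[k] (H ⊗[k] H) ⊗[k] H)
      (s : (H ⊗[k] H) ⊗[k] H →ₗ[k] (H ⊗[k] (H ⊗[k] H))), X.lcoact 1 = l → X.cobar 1 = b → X.rcoact 1 = r →
      (snoc k H 1).toLinearMap = s → @Eq ((H ⊗[k] H) →ₗ[k] (H ⊗[k] (H ⊗[k] H))) (X.cobarC p 1 1 f)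
        (cobarForm (τ 𝒜 ^ p) ((-1 : k) ^ 3) f l b r LinearMap.id s) := by
    rintro _ _ _ _ rfl rfl rfl rfl; rfl
  rw [key _ _ _ _ (lcoact_one h) (cobar_one h) (rcoact_one h) (snoc_one k H), cobarForm]
  simp only [LinearMap.id_comp]
  module

theorem cobarC_two_zero (h : G.Lifts X) (p : ℕ) (f : H ⊗[k] (H ⊗[k] H) →ₗ[k] H) :
    @Eq (H ⊗[k] (H ⊗[k] H) →ₗ[k] H ⊗[k] H) (X.cobarC p 2 0 f)
    (TensorProduct.map (τ 𝒜 ^ p) f ∘ₗ G.lcoact3 0 - G.comul 0 ∘ₗ f +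
        TensorProduct.map f LinearMap.id ∘ₗ G.rcoact3 0) := by
  have key : ∀ (l : (H ⊗[k] (H ⊗[k] H)) →ₗ[k] H ⊗[k] (H ⊗[k] (H ⊗[k] H))) (b : H →ₗ[k] (H ⊗[k] H)) (r : (H ⊗[k] (H ⊗[k] H)) →ₗ[k] (H ⊗[k] (H ⊗[k] H)) ⊗[k] H)
      (s : H ⊗[k] H →ₗ[k] (H ⊗[k] H)), X.lcoact 2 = l → X.cobar 0 = b → X.rcoact 2 = r →
      (snoc k H 0).toLinearMap = s → @Eq ((H ⊗[k] (H ⊗[k] H)) →ₗ[k] (H ⊗[k] H)) (X.cobarC p 2 0 f)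
        (cobarForm (τ 𝒜 ^ p) ((-1 : k) ^ 2) f l b r LinearMap.id s) := by
    rintro _ _ _ _ rfl rfl rfl rfl; rfl
  rw [key _ _ _ _ (lcoact_two h) (cobar_zero h) (rcoact_two h) (snoc_zero k H), cobarForm]
  simp only [LinearMap.id_comp]
  module

theorem dC_zero_zero (h : G.Lifts X) (p : ℕ) (f : H →ₗ[k] H) :
    @Eq (H →ₗ[k] H) (X.dC p 0 0 f)
    ((-1 : k) ^ p • (f ∘ₗ G.d 0) - G.d 0 ∘ₗ f) := by
  rw [← dInt_zero h]; rfl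

theorem dC_one_zero (h : G.Lifts X) (p : ℕ) (f : H ⊗[k] H →ₗ[k] H) :
    @Eq (H ⊗[k] H →ₗ[k] H) (X.dC p 1 0 f)
    ((-1 : k) ^ p • (f ∘ₗ G.d2 0) - G.d 0 ∘ₗ f) := by
  rw [← dInt_zero h, ← dInt_one h]; rfl

theorem dC_zero_one (h : G.Lifts X) (p : ℕ) (f : H →ₗ[k] H ⊗[k] H) :
    @Eq (H →ₗ[k] H ⊗[k] H) (X.dC p 0 1 f)
    ((-1 : k) ^ p • (f ∘ₗ G.d 0) - G.d2 0 ∘ₗ f) := by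
  rw [← dInt_zero h, ← dInt_one h]; rfl

theorem dC_two_zero (h : G.Lifts X) (p : ℕ) (f : H ⊗[k] (H ⊗[k] H) →ₗ[k] H) :
    @Eq (H ⊗[k] (H ⊗[k] H) →ₗ[k] H) (X.dC p 2 0 f)
    ((-1 : k) ^ p • (f ∘ₗ G.d3 0) - G.d 0 ∘ₗ f) := by
  rw [← dInt_zero h, ← dInt_two h]; rfl

theorem dC_one_one (h : G.Lifts X) (p : ℕ) (f : H ⊗[k] H →ₗ[k] H ⊗[k] H) :
    @Eq (H ⊗[k] H →ₗ[k] H ⊗[k] H) (X.dC p 1 1 f)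
    ((-1 : k) ^ p • (f ∘ₗ G.d2 0) - G.d2 0 ∘ₗ f) := by
  rw [← dInt_one h]; rfl

theorem dC_zero_two (h : G.Lifts X) (p : ℕ) (f : H →ₗ[k] H ⊗[k] (H ⊗[k] H)) :
    @Eq (H →ₗ[k] H ⊗[k] (H ⊗[k] H)) (X.dC p 0 2 f)
    ((-1 : k) ^ p • (f ∘ₗ G.d 0) - G.d3 0 ∘ₗ f) := by
  rw [← dInt_zero h, ← dInt_two h]; rfl

end DGHopfAlgebra

/-! ### The obstruction cocycle -/

theorem map_neg_right {k : Type u} [Field k] {V W V' W' : Type*} [AddCommGroup V] [Module k V]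
    [AddCommGroup W] [Module k W] [AddCommGroup V'] [Module k V'] [AddCommGroup W'] [Module k W']
    (f : V →ₗ[k] W) (g : V' →ₗ[k] W') : TensorProduct.map f (-g) = -TensorProduct.map f g := by
  exact TensorProduct.ext' fun x y => by simp [TensorProduct.tmul_neg]

theorem map_neg_left {k : Type u} [Field k] {V W V' W' : Type*} [AddCommGroup V] [Module k V]
    [AddCommGroup W] [Module k W] [AddCommGroup V'] [Module k V'] [AddCommGroup W'] [Module k W']
    (f : V →ₗ[k] W) (g : V' →ₗ[k] W') : TensorProduct.map (-f) g = -TensorProduct.map f g := by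
  exact TensorProduct.ext' fun x y => by simp [TensorProduct.neg_tmul]

section
variable {k : Type u} [Field k] {H : Type v} [AddCommGroup H] [Module k H]
  {𝒜 : ℕ → Submodule k H} [DirectSum.Decomposition 𝒜]

theorem τ_mul_τ : (τ 𝒜 : H →ₗ[k] H) ∘ₗ τ 𝒜 = LinearMap.id := by
  have : FormalMap.const (τ 𝒜 : H →ₗ[k] H) ⊚ FormalMap.const (τ 𝒜) = FormalMap.one :=
    hext₁ 𝒜 fun p x hx => by
      rw [FormalMap.app_comp, app_τ hx, map_smul, app_τ hx, smul_smul, ← pow_add, ← two_mul]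
      simp
  simpa using congrFun this 0

/-- Needed for the component `d²` of the obstruction: it has degree `2`, so it passes elements
without a sign. -/
theorem τ_pow_two : (τ 𝒜 : H →ₗ[k] H) ^ 2 = LinearMap.id := by
  rw [pow_two]; exact τ_mul_τ

end

namespace DGHopfAlgebra

open FormalMap PreHopf

variable {k : Type u} [Field k] {H : Type v} [AddCommGroup H] [Module k H]
  {𝒜 : ℕ → Submodule k H} [DirectSum.Decomposition 𝒜]

/-- The family with components of tridegrees `(1,1,1)`, `(0,2,1)`, `(0,1,2)`. -/
def famTwo (d : H →ₗ[k] H) (m : H ⊗[k] H →ₗ[k] H) (c : H →ₗ[k] H ⊗[k] H) : Family k H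
  | 1, 0, 0 => d
  | 0, 1, 0 => m
  | 0, 0, 1 => c
  | _, _, _ => 0

theorem infinitesimal_eq (d : H →ₗ[k] H) (m : H ⊗[k] H →ₗ[k] H) (c : H →ₗ[k] H ⊗[k] H) :
    infinitesimal k H d m c = famTwo d m c := by
  have hm : @Eq (H ⊗[k] H →ₗ[k] H) (infinitesimal k H d m c 0 1 0) m := by
    have key : ∀ s : H ⊗[k] H →ₗ[k] H ⊗[k] H, (pair k H).symm.toLinearMap = s → s = LinearMap.id →
      @Eq (H ⊗[k] H →ₗ[k] H) ((single k H).toLinearMap ∘ₗ m ∘ₗ s) m := by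
      rintro s - rfl; rfl
    exact key _ rfl (pair_symm_eq k H)
  have hc : @Eq (H →ₗ[k] H ⊗[k] H) (infinitesimal k H d m c 0 0 1) c := by
    have key : ∀ s : H ⊗[k] H →ₗ[k] H ⊗[k] H, (pair k H).toLinearMap = s → s = LinearMap.id →
      @Eq (H →ₗ[k] H ⊗[k] H) (s ∘ₗ c ∘ₗ (single k H).symm.toLinearMap) c := by
      rintro s - rfl; rfl
    exact key _ rfl (pair_eq k H)
  funext p i j
  rcases p with _ | _ | p <;> rcases i with _ | _ | i <;> rcases j with _ | _ | j <;>
    first | rfl | exact hm | exact hc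

/-- The family with components of tridegrees `(2,1,1)`, `(1,2,1)`, `(1,1,2)`, `(0,3,1)`,
`(0,2,2)`, `(0,1,3)`. -/
def famThree (Q : H →ₗ[k] H) (F : H ⊗[k] H →ₗ[k] H) (E : H →ₗ[k] H ⊗[k] H)
    (A : H ⊗[k] (H ⊗[k] H) →ₗ[k] H) (B : H ⊗[k] H →ₗ[k] H ⊗[k] H)
    (C : H →ₗ[k] H ⊗[k] (H ⊗[k] H)) : Family k H
  | 2, 0, 0 => Q
  | 1, 1, 0 => F
  | 1, 0, 1 => E
  | 0, 2, 0 => A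
  | 0, 1, 1 => B
  | 0, 0, 2 => C
  | _, _, _ => 0

theorem famThree_eq_zero (Q : H →ₗ[k] H) (F : H ⊗[k] H →ₗ[k] H) (E : H →ₗ[k] H ⊗[k] H)
    (A : H ⊗[k] (H ⊗[k] H) →ₗ[k] H) (B : H ⊗[k] H →ₗ[k] H ⊗[k] H)
    (C : H →ₗ[k] H ⊗[k] (H ⊗[k] H)) (p i j : ℕ) (h : p + i + j ≠ 2) :
    famThree Q F E A B C p i j = 0 := by
  rcases p with _ | _ | _ | p <;> rcases i with _ | _ | _ | i <;> rcases j with _ | _ | _ | j <;>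
    first | rfl | exact absurd rfl h

/-- Each of the three parts of `D` raises exactly one of `p`, `i`, `j` by one. -/
theorem D_eq_zero_of_support (X : DGHopfAlgebra 𝒜) (c : Family k H) (r : ℕ)
    (hc : ∀ p i j, p + i + j ≠ r → c p i j = 0) (p i j : ℕ) (h : p + i + j ≠ r + 1) :
    X.D c p i j = 0 := by
  have h₁ : X.dTerm c p i j = 0 := by
    rcases p with _ | p
    · rfl
    · simp only [dTerm]; rw [hc p i j (by omega)]; simp
  have h₂ : X.barTerm c p i j = 0 := by
    rcases i with _ | i
    · rfl
    · simp only [barTerm]; rw [hc p i j (by omega)]; simp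
  have h₃ : X.cobarTerm c p i j = 0 := by
    rcases j with _ | j
    · rfl
    · simp only [cobarTerm]; rw [hc p i j (by omega)]; simp
  show X.dTerm c p i j + X.barTerm c p i j + X.cobarTerm c p i j = 0
  rw [h₁, h₂, h₃]; simp

/-- The leading coefficients of the defects. -/
def obstruction (G : PreHopf 𝒜) (n : ℕ) : Family k H :=
  famThree (G.sqDefect n) (G.leibDefect n) (G.coleibDefect n) (-G.assocDefect n)
    (G.compatDefect n) (G.coassocDefect n)

/-- The axioms of a differential graded bialgebra hold for `G` at order `i`. -/
structure HoldsAt (G : PreHopf 𝒜) (i : ℕ) : Prop where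
  sq : G.sqDefect i = 0
  leib : G.leibDefect i = 0
  coleib : G.coleibDefect i = 0
  assoc : G.assocDefect i = 0
  compat : G.compatDefect i = 0
  coassoc : G.coassocDefect i = 0

variable {X : DGHopfAlgebra 𝒜} {G : PreHopf 𝒜} {n : ℕ}

/-- The pattern of all ten components: take the syzygy, read off its coefficient of order `n` with
`Lead` (the lower coefficients of the defects vanish by `hv`), and match it with the explicit form
of `D` in that tridegree. -/
theorem D_obstruction_d_d (h : G.Lifts X) (hv : ∀ i < n, HoldsAt G i) :
    X.D (obstruction G n) 3 0 0 = 0 := by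
  have hQ : Lead n G.sqDefect (G.sqDefect n) := ⟨fun i hi => (hv i hi).sq, rfl⟩
  -- The powers of `-1` are the signs of `D` in this tridegree, and the zeros are the parts of `D`
  -- absent for index reasons.
  have key : ∀ x : H →ₗ[k] H,
      X.dC 2 0 0 (G.sqDefect n) = x →
      (-1 : k) ^ 2 • x + 0 + 0 = 0 → X.D (obstruction G n) 3 0 0 = 0 := by
    rintro _ rfl e; exact e
  refine key _ (dC_zero_zero h _ _) ?_
  have hs := Lead.eq G.sqDefect_d (hQ.comp_left G.d) (Lead.comp_right G.d hQ)
  linear_combination (norm := module) hs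

theorem D_obstruction_d_mul (h : G.Lifts X) (hv : ∀ i < n, HoldsAt G i) :
    X.D (obstruction G n) 2 1 0 = 0 := by
  have hQ : Lead n G.sqDefect (G.sqDefect n) := ⟨fun i hi => (hv i hi).sq, rfl⟩
  have hF : Lead n G.leibDefect (G.leibDefect n) := ⟨fun i hi => (hv i hi).leib, rfl⟩
  have key : ∀ x y : (H ⊗[k] H) →ₗ[k] H,
      X.dC 1 1 0 (G.leibDefect n) = x → X.barC 2 0 0 (G.sqDefect n) = y →
      (-1 : k) ^ 4 • x + (-1 : k) ^ 3 • y + 0 = 0 → X.D (obstruction G n) 2 1 0 = 0 := by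
    rintro _ _ rfl rfl e; exact e
  refine key _ _ (dC_one_zero h _ _) (barC_zero_zero h _ _) ?_
  have hs := Lead.eq G.leibDefect_d ((Lead.comp_right G.d hF).add (hF.comp_left G.d2))
    ((hQ.comp_left G.mul).sub (Lead.comp_right G.mul ((hQ.tmap_left one).add
      (Lead.tmap_right one hQ))))
  simp only [one_zero, LinearMap.comp_add] at hs
  simp only [pow_one, τ_pow_two]
  linear_combination (norm := module) -hs

theorem D_obstruction_d_comul (h : G.Lifts X) (hv : ∀ i < n, HoldsAt G i) :
    X.D (obstruction G n) 2 0 1 = 0 := by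
  have hQ : Lead n G.sqDefect (G.sqDefect n) := ⟨fun i hi => (hv i hi).sq, rfl⟩
  have hE : Lead n G.coleibDefect (G.coleibDefect n) := ⟨fun i hi => (hv i hi).coleib, rfl⟩
  have key : ∀ x y : H →ₗ[k] (H ⊗[k] H),
      X.dC 1 0 1 (G.coleibDefect n) = x → X.cobarC 2 0 0 (G.sqDefect n) = y →
      (-1 : k) ^ 3 • x + 0 + (-1 : k) ^ 4 • y = 0 → X.D (obstruction G n) 2 0 1 = 0 := by
    rintro _ _ rfl rfl e; exact e
  refine key _ _ (dC_zero_one h _ _) (cobarC_zero_zero h _ _) ?_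
  have hs := Lead.eq G.coleibDefect_d ((hE.comp_left G.d).add (Lead.comp_right G.d2 hE))
    ((Lead.comp_right G.comul hQ).sub (((hQ.tmap_left one).add
      (Lead.tmap_right one hQ)).comp_left G.comul))
  simp only [one_zero, LinearMap.add_comp] at hs
  simp only [pow_one, τ_pow_two]
  linear_combination (norm := module) hs

/-- Here the sign of `-assocDefect` in `obstruction` is needed: with it the signs of `D` match those
of `assocDefect_d`. -/
theorem D_obstruction_d_assoc (h : G.Lifts X) (hv : ∀ i < n, HoldsAt G i) :
    X.D (obstruction G n) 1 2 0 = 0 := by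
  have hA : Lead n G.assocDefect (G.assocDefect n) := ⟨fun i hi => (hv i hi).assoc, rfl⟩
  have hF : Lead n G.leibDefect (G.leibDefect n) := ⟨fun i hi => (hv i hi).leib, rfl⟩
  have key : ∀ x y : (H ⊗[k] (H ⊗[k] H)) →ₗ[k] H,
      X.dC 0 2 0 (-G.assocDefect n) = x → X.barC 1 1 0 (G.leibDefect n) = y →
      (-1 : k) ^ 6 • x + (-1 : k) ^ 2 • y + 0 = 0 → X.D (obstruction G n) 1 2 0 = 0 := by
    rintro _ _ rfl rfl e; exact e
  refine key _ _ (dC_two_zero h _ _) (barC_one_zero h _ _) ?_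
  have hs := Lead.eq G.assocDefect_d ((Lead.comp_right G.d hA).sub (hA.comp_left G.d3))
    (((hF.comp_left G.bar2).add (Lead.comp_right G.mul ((hF.tmap_left one).comp_left _))).sub
      (Lead.comp_right G.mul (Lead.tmap_right _ hF)))
  simp only [one_zero, const_zero] at hs
  simp only [pow_zero, pow_one,
    LinearMap.neg_comp, LinearMap.comp_neg]
  linear_combination (norm := module) hs

theorem D_obstruction_d_compat (h : G.Lifts X) (hv : ∀ i < n, HoldsAt G i) :
    X.D (obstruction G n) 1 1 1 = 0 := by
  have hB : Lead n G.compatDefect (G.compatDefect n) := ⟨fun i hi => (hv i hi).compat, rfl⟩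
  have hE : Lead n G.coleibDefect (G.coleibDefect n) := ⟨fun i hi => (hv i hi).coleib, rfl⟩
  have hF : Lead n G.leibDefect (G.leibDefect n) := ⟨fun i hi => (hv i hi).leib, rfl⟩
  have key : ∀ x y z : (H ⊗[k] H) →ₗ[k] (H ⊗[k] H),
      X.dC 0 1 1 (G.compatDefect n) = x → X.barC 1 0 1 (G.coleibDefect n) = y → X.cobarC 1 1 0 (G.leibDefect n) = z →
      (-1 : k) ^ 6 • x + (-1 : k) ^ 4 • y + (-1 : k) ^ 3 • z = 0 → X.D (obstruction G n) 1 1 1 = 0 := by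
    rintro _ _ _ rfl rfl rfl e; exact e
  refine key _ _ _ (dC_one_one h _ _) (barC_zero_one h _ _) (cobarC_one_zero h _ _) ?_
  have hs := Lead.eq G.comul_leibDefect (Lead.comp_right G.comul hF)
    (((((((hE.comp_left G.mul).add (Lead.comp_right G.d2 hB)).sub (hB.comp_left G.d2)).sub
      (Lead.comp_right G.lact2 (Lead.tmap_right _ hE))).sub
      (Lead.comp_right G.ract2 (hE.tmap_left one))).add ((hF.tmap_left one).comp_left G.rcoact2)).add
      ((Lead.tmap_right _ hF).comp_left G.lcoact2))
  simp only [one_zero, const_zero] at hs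
  simp only [pow_zero, pow_one]
  linear_combination (norm := module) hs

theorem D_obstruction_d_coassoc (h : G.Lifts X) (hv : ∀ i < n, HoldsAt G i) :
    X.D (obstruction G n) 1 0 2 = 0 := by
  have hC : Lead n G.coassocDefect (G.coassocDefect n) := ⟨fun i hi => (hv i hi).coassoc, rfl⟩
  have hE : Lead n G.coleibDefect (G.coleibDefect n) := ⟨fun i hi => (hv i hi).coleib, rfl⟩
  have key : ∀ x y : H →ₗ[k] (H ⊗[k] (H ⊗[k] H)),
      X.dC 0 0 2 (G.coassocDefect n) = x → X.cobarC 1 0 1 (G.coleibDefect n) = y →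
      (-1 : k) ^ 4 • x + 0 + (-1 : k) ^ 2 • y = 0 → X.D (obstruction G n) 1 0 2 = 0 := by
    rintro _ _ rfl rfl e; exact e
  refine key _ _ (dC_zero_two h _ _) (cobarC_zero_one h _ _) ?_
  have hs := Lead.eq G.coassocDefect_d ((hC.comp_left G.d).sub (Lead.comp_right G.d3 hC))
    (((Lead.comp_right G.cobar2 hE).add (Lead.comp_right _ ((hE.tmap_left one).comp_left G.comul))).sub
      ((Lead.tmap_right _ hE).comp_left G.comul))
  simp only [one_zero, const_zero] at hs
  simp only [pow_zero, pow_one]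
  linear_combination (norm := module) hs

theorem D_obstruction_bar_assoc (h : G.Lifts X) (hv : ∀ i < n, HoldsAt G i) :
    X.D (obstruction G n) 0 3 0 = 0 := by
  have hA : Lead n G.assocDefect (G.assocDefect n) := ⟨fun i hi => (hv i hi).assoc, rfl⟩
  have key : ∀ x : (H ⊗[k] (H ⊗[k] (H ⊗[k] H))) →ₗ[k] H,
      X.barC 0 2 0 (-G.assocDefect n) = x →
      0 + (-1 : k) ^ 1 • x + 0 = 0 → X.D (obstruction G n) 0 3 0 = 0 := by
    rintro _ rfl e; exact e
  refine key _ (barC_two_zero h _ _) ?_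
  have hs := congrFun G.assocDefect_pentagon n
  rw [((((Lead.comp_right G.mul (Lead.tmap_right one hA)).sub (hA.comp_left G.bar3)).add
    (Lead.comp_right G.mul ((hA.tmap_left one).comp_left _)))).2] at hs
  simp only [one_zero, const_zero, comp_zero, tmap_zero, Pi.zero_apply] at hs
  simp only [pow_zero, pow_one, Module.End.one_eq_id, map_neg_left, map_neg_right,
    LinearMap.neg_comp, LinearMap.comp_neg]
  linear_combination (norm := module) hs

theorem D_obstruction_bar_compat (h : G.Lifts X) (hv : ∀ i < n, HoldsAt G i) :
    X.D (obstruction G n) 0 2 1 = 0 := by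
  have hA : Lead n G.assocDefect (G.assocDefect n) := ⟨fun i hi => (hv i hi).assoc, rfl⟩
  have hB : Lead n G.compatDefect (G.compatDefect n) := ⟨fun i hi => (hv i hi).compat, rfl⟩
  have key : ∀ x y : (H ⊗[k] (H ⊗[k] H)) →ₗ[k] (H ⊗[k] H),
      X.barC 0 1 1 (G.compatDefect n) = x → X.cobarC 0 2 0 (-G.assocDefect n) = y →
      0 + (-1 : k) ^ 2 • x + (-1 : k) ^ 0 • y = 0 → X.D (obstruction G n) 0 2 1 = 0 := by
    rintro _ _ rfl rfl e; exact e
  refine key _ _ (barC_one_one h _ _) (cobarC_two_zero h _ _) ?_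
  have hs := Lead.eq G.comul_assocDefect (Lead.comp_right G.comul hA)
    (((((hB.comp_left G.bar2).add (Lead.comp_right G.ract2 ((hB.tmap_left one).comp_left _))).sub
    (Lead.comp_right G.lact2 (Lead.tmap_right one hB))).add
    ((hA.tmap_left one).comp_left G.rcoact3)).add ((Lead.tmap_right one hA).comp_left G.lcoact3))
  simp only [one_zero, const_zero] at hs
  simp only [pow_zero, Module.End.one_eq_id, map_neg_left, map_neg_right,
    LinearMap.neg_comp, LinearMap.comp_neg]
  linear_combination (norm := module) hs

theorem D_obstruction_cobar_compat (h : G.Lifts X) (hv : ∀ i < n, HoldsAt G i) :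
    X.D (obstruction G n) 0 1 2 = 0 := by
  have hB : Lead n G.compatDefect (G.compatDefect n) := ⟨fun i hi => (hv i hi).compat, rfl⟩
  have hC : Lead n G.coassocDefect (G.coassocDefect n) := ⟨fun i hi => (hv i hi).coassoc, rfl⟩
  have key : ∀ x y : (H ⊗[k] H) →ₗ[k] (H ⊗[k] (H ⊗[k] H)),
      X.barC 0 0 2 (G.coassocDefect n) = x → X.cobarC 0 1 1 (G.compatDefect n) = y →
      0 + (-1 : k) ^ 3 • x + (-1 : k) ^ 0 • y = 0 → X.D (obstruction G n) 0 1 2 = 0 := by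
    rintro _ _ rfl rfl e; exact e
  refine key _ _ (barC_zero_two h _ _) (cobarC_one_one h _ _) ?_
  have hs := Lead.eq G.coassocDefect_mul (hC.comp_left G.mul)
    (((((Lead.comp_right G.cobar2 hB).add
    (Lead.comp_right _ ((hB.tmap_left one).comp_left G.rcoact2))).sub
    ((Lead.tmap_right one hB).comp_left G.lcoact2)).add
    (Lead.comp_right G.lact3 (Lead.tmap_right one hC))).add
    (Lead.comp_right G.ract3 (hC.tmap_left one)))
  simp only [one_zero, const_zero] at hs
  simp only [pow_zero, Module.End.one_eq_id]
  linear_combination (norm := module) hs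

theorem D_obstruction_cobar_coassoc (h : G.Lifts X) (hv : ∀ i < n, HoldsAt G i) :
    X.D (obstruction G n) 0 0 3 = 0 := by
  have hC : Lead n G.coassocDefect (G.coassocDefect n) := ⟨fun i hi => (hv i hi).coassoc, rfl⟩
  have key : ∀ x : H →ₗ[k] (H ⊗[k] (H ⊗[k] (H ⊗[k] H))),
      X.cobarC 0 0 2 (G.coassocDefect n) = x →
      0 + 0 + (-1 : k) ^ 0 • x = 0 → X.D (obstruction G n) 0 0 3 = 0 := by
    rintro _ rfl e; exact e
  refine key _ (cobarC_zero_two h _ _) ?_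
  have hs := congrFun G.coassocDefect_pentagon n
  rw [((((Lead.tmap_right one hC).comp_left G.comul).sub (Lead.comp_right G.cobar3 hC)).add
    (Lead.comp_right _ (Lead.comp_right _ ((hC.tmap_left one).comp_left G.comul)))).2] at hs
  simp only [one_zero, const_zero, tmap_zero, Pi.zero_apply] at hs
  simp only [pow_zero, Module.End.one_eq_id]
  simp only [LinearMap.comp_assoc]
  linear_combination (norm := module) hs

theorem sum_eq_three_cases {P : ℕ → ℕ → ℕ → Prop} (h₁ : P 3 0 0) (h₂ : P 2 1 0) (h₃ : P 2 0 1)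
    (h₄ : P 1 2 0) (h₅ : P 1 1 1) (h₆ : P 1 0 2) (h₇ : P 0 3 0) (h₈ : P 0 2 1) (h₉ : P 0 1 2)
    (h₀ : P 0 0 3) {p i j : ℕ} (hs : p + i + j = 3) : P p i j := by
  have hp : p ≤ 3 := by omega
  have hi : i ≤ 3 := by omega
  obtain rfl : j = 3 - p - i := by omega
  interval_cases p <;> interval_cases i <;> first | assumption | omega

theorem D_obstruction (h : G.Lifts X) (hv : ∀ i < n, HoldsAt G i) :
    X.D (obstruction G n) = 0 := by
  funext p i j
  rcases eq_or_ne (p + i + j) 3 with hs | hs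
  · exact sum_eq_three_cases (P := fun p i j => X.D (obstruction G n) p i j = 0)
      (D_obstruction_d_d h hv) (D_obstruction_d_mul h hv) (D_obstruction_d_comul h hv)
      (D_obstruction_d_assoc h hv) (D_obstruction_d_compat h hv) (D_obstruction_d_coassoc h hv)
      (D_obstruction_bar_assoc h hv) (D_obstruction_bar_compat h hv)
      (D_obstruction_cobar_compat h hv) (D_obstruction_cobar_coassoc h hv) hs
  · exact X.D_eq_zero_of_support _ 2 (famThree_eq_zero _ _ _ _ _ _) p i j hs

end DGHopfAlgebra

/-! ### Correcting the coefficients of order `n` -/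

theorem map_comp_map_comp {k : Type u} [Field k] {U V W V' W' V'' W'' : Type*}
    [AddCommGroup U] [Module k U] [AddCommGroup V] [Module k V]
    [AddCommGroup W] [Module k W] [AddCommGroup V'] [Module k V'] [AddCommGroup W'] [Module k W']
    [AddCommGroup V''] [Module k V''] [AddCommGroup W''] [Module k W'']
    (f : V' →ₗ[k] V'') (g : W' →ₗ[k] W'') (f' : V →ₗ[k] V') (g' : W →ₗ[k] W')
    (h : U →ₗ[k] V ⊗[k] W) :
    TensorProduct.map f g ∘ₗ TensorProduct.map f' g' ∘ₗ h =
      TensorProduct.map (f ∘ₗ f') (g ∘ₗ g') ∘ₗ h := by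
  rw [TensorProduct.map_comp, LinearMap.comp_assoc]

namespace DGHopfAlgebra

open FormalMap PreHopf

variable {k : Type u} [Field k] {H : Type v} [AddCommGroup H] [Module k H]
  {𝒜 : ℕ → Submodule k H} [DirectSum.Decomposition 𝒜] {X : DGHopfAlgebra 𝒜} {G G' : PreHopf 𝒜}
  {n : ℕ} {bd : H →ₗ[k] H} {bm : H ⊗[k] H →ₗ[k] H} {bc : H →ₗ[k] H ⊗[k] H}

/-- The change of the defect at order `n` is its first variation, computed by `Diff`. This is `-D b`
in the relevant component, and `D b` is the old defect, so the new one vanishes. The five lemmas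
below follow the same argument; for associativity both the defect and its variation enter with the
opposite sign. -/
theorem sqDefect_eq_zero (h : G.Lifts X) (hn : n ≠ 0) (hd : Diff n G.d G'.d bd)
    (hD : X.D (famTwo bd bm bc) = obstruction G n) : G'.sqDefect n = 0 := by
  have key : ∀ x : H →ₗ[k] H, X.dC 1 0 0 bd = x →
      X.D (famTwo bd bm bc) 2 0 0 = obstruction G n 2 0 0 →
      (-1 : k) ^ 2 • x + 0 + 0 = G.sqDefect n := by
    rintro _ rfl e; exact e
  have e := key _ (dC_zero_zero h _ _) (by rw [hD])
  have c : Diff n G.sqDefect G'.sqDefect _ := Diff.comp hn hd hd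
  rw [c.2, ← e]
  module

theorem leibDefect_eq_zero (h : G.Lifts X) (hn : n ≠ 0) (hd : Diff n G.d G'.d bd)
    (hm : Diff n G.mul G'.mul bm)
    (hD : X.D (famTwo bd bm bc) = obstruction G n) : G'.leibDefect n = 0 := by
  have key : ∀ x y : H ⊗[k] H →ₗ[k] H, X.dC 0 1 0 bm = x → X.barC 1 0 0 bd = y →
      X.D (famTwo bd bm bc) 1 1 0 = obstruction G n 1 1 0 →
      (-1 : k) ^ 4 • x + (-1 : k) ^ 2 • y + 0 = G.leibDefect n := by
    rintro _ _ rfl rfl e; exact e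
  have e := key _ _ (dC_one_zero h _ _) (barC_zero_zero h _ _) (by rw [hD])
  have c : Diff n G.leibDefect G'.leibDefect _ := (Diff.comp hn hd hm).sub
    (Diff.comp hn hm ((Diff.tmap hn hd (Diff.refl one)).add
      (Diff.tmap hn (Diff.refl (const (τ 𝒜))) hd)))
  rw [c.2, ← e]
  simp only [one_zero, const_zero, d2, Pi.add_apply, tmap_zero, TensorProduct.map_zero_left,
    TensorProduct.map_zero_right, LinearMap.comp_add, LinearMap.comp_zero, pow_one]
  module

theorem coleibDefect_eq_zero (h : G.Lifts X) (hn : n ≠ 0) (hd : Diff n G.d G'.d bd)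
    (hc : Diff n G.comul G'.comul bc)
    (hD : X.D (famTwo bd bm bc) = obstruction G n) : G'.coleibDefect n = 0 := by
  have key : ∀ x y : H →ₗ[k] H ⊗[k] H, X.dC 0 0 1 bc = x → X.cobarC 1 0 0 bd = y →
      X.D (famTwo bd bm bc) 1 0 1 = obstruction G n 1 0 1 →
      (-1 : k) ^ 3 • x + 0 + (-1 : k) ^ 2 • y = G.coleibDefect n := by
    rintro _ _ rfl rfl e; exact e
  have e := key _ _ (dC_zero_one h _ _) (cobarC_zero_zero h _ _) (by rw [hD])
  have c : Diff n G.coleibDefect G'.coleibDefect _ := (Diff.comp hn hc hd).sub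
    (Diff.comp hn ((Diff.tmap hn hd (Diff.refl one)).add
      (Diff.tmap hn (Diff.refl (const (τ 𝒜))) hd)) hc)
  rw [c.2, ← e]
  simp only [one_zero, const_zero, d2, Pi.add_apply, tmap_zero, TensorProduct.map_zero_left,
    TensorProduct.map_zero_right, LinearMap.add_comp, LinearMap.zero_comp, pow_one]
  module

theorem assocDefect_eq_zero (h : G.Lifts X) (hn : n ≠ 0) (hm : Diff n G.mul G'.mul bm)
    (hD : X.D (famTwo bd bm bc) = obstruction G n) : G'.assocDefect n = 0 := by
  have key : ∀ x : H ⊗[k] (H ⊗[k] H) →ₗ[k] H, X.barC 0 1 0 bm = x →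
      X.D (famTwo bd bm bc) 0 2 0 = obstruction G n 0 2 0 →
      0 + (-1 : k) ^ 1 • x + 0 = -G.assocDefect n := by
    rintro _ rfl e; exact e
  have e := key _ (barC_one_zero h _ _) (by rw [hD])
  have c : Diff n G.assocDefect G'.assocDefect _ :=
    (Diff.comp hn hm (Diff.comp hn (Diff.tmap hn hm (Diff.refl one)) (Diff.refl _))).sub
    (Diff.comp hn hm (Diff.tmap hn (Diff.refl one) hm))
  rw [c.2, ← neg_neg (G.assocDefect n), ← e]
  simp only [one_zero, const_zero, bar2, Pi.sub_apply, tmap_zero, TensorProduct.map_zero_left,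
    TensorProduct.map_zero_right, LinearMap.add_comp, LinearMap.comp_add, LinearMap.comp_sub,
    comp_zero, LinearMap.zero_comp, LinearMap.comp_zero, pow_zero, Module.End.one_eq_id]
  module

theorem coassocDefect_eq_zero (h : G.Lifts X) (hn : n ≠ 0) (hc : Diff n G.comul G'.comul bc)
    (hD : X.D (famTwo bd bm bc) = obstruction G n) : G'.coassocDefect n = 0 := by
  have key : ∀ x : H →ₗ[k] H ⊗[k] (H ⊗[k] H), X.cobarC 0 0 1 bc = x →
      X.D (famTwo bd bm bc) 0 0 2 = obstruction G n 0 0 2 →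
      0 + 0 + (-1 : k) ^ 0 • x = G.coassocDefect n := by
    rintro _ rfl e; exact e
  have e := key _ (cobarC_zero_one h _ _) (by rw [hD])
  have c : Diff n G.coassocDefect G'.coassocDefect _ :=
    (Diff.comp hn (Diff.refl _) (Diff.comp hn (Diff.tmap hn hc (Diff.refl one)) hc)).sub
    (Diff.comp hn (Diff.tmap hn (Diff.refl one) hc) hc)
  rw [c.2, ← e]
  simp only [one_zero, const_zero, cobar2, Pi.sub_apply, tmap_zero, TensorProduct.map_zero_left,
    TensorProduct.map_zero_right, LinearMap.add_comp, LinearMap.comp_add, LinearMap.sub_comp,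
    comp_zero, LinearMap.zero_comp, LinearMap.comp_zero, pow_zero, Module.End.one_eq_id,
    LinearMap.comp_assoc]
  module

theorem compatDefect_eq_zero (h : G.Lifts X) (hn : n ≠ 0) (hm : Diff n G.mul G'.mul bm)
    (hc : Diff n G.comul G'.comul bc)
    (hD : X.D (famTwo bd bm bc) = obstruction G n) : G'.compatDefect n = 0 := by
  have key : ∀ x y : H ⊗[k] H →ₗ[k] H ⊗[k] H, X.barC 0 0 1 bc = x → X.cobarC 0 1 0 bm = y →
      X.D (famTwo bd bm bc) 0 1 1 = obstruction G n 0 1 1 →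
      0 + (-1 : k) ^ 2 • x + (-1 : k) ^ 0 • y = G.compatDefect n := by
    rintro _ _ rfl rfl e; exact e
  have e := key _ _ (barC_zero_one h _ _) (cobarC_one_zero h _ _) (by rw [hD])
  have c : Diff n G.compatDefect G'.compatDefect _ := (Diff.comp hn hc hm).sub
    (Diff.comp hn (Diff.comp hn (Diff.tmap hn hm hm) (Diff.refl _)) (Diff.tmap hn hc hc))
  rw [c.2, ← e]
  simp only [one_zero, const_zero, lact2, ract2, lcoact2, rcoact2, PreHopf.star, tmap_zero,
    LinearMap.add_comp, LinearMap.comp_add, comp_zero, LinearMap.zero_comp, LinearMap.comp_zero, pow_zero, Module.End.one_eq_id,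
    LinearMap.comp_assoc, map_comp_map_comp, ← TensorProduct.map_comp, LinearMap.id_comp,
    LinearMap.comp_id]
  module

/-- Adding `tⁿ b` with `D b` the obstruction makes the axioms hold at order `n`. -/
theorem holdsAt_of_D_eq_obstruction (h : G.Lifts X) (hn : n ≠ 0) (hd : Diff n G.d G'.d bd)
    (hm : Diff n G.mul G'.mul bm) (hc : Diff n G.comul G'.comul bc)
    (hD : X.D (famTwo bd bm bc) = obstruction G n) : HoldsAt G' n :=
  ⟨sqDefect_eq_zero h hn hd hD, leibDefect_eq_zero h hn hd hm hD,
    coleibDefect_eq_zero h hn hd hc hD, assocDefect_eq_zero h hn hm hD,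
    compatDefect_eq_zero h hn hm hc hD, coassocDefect_eq_zero h hn hc hD⟩

/-- The axioms at order `n` only involve the coefficients of order at most `n`. -/
theorem HoldsAt.congr (hd : EqTo n G.d G'.d) (hm : EqTo n G.mul G'.mul)
    (hc : EqTo n G.comul G'.comul) (h : HoldsAt G n) : HoldsAt G' n where
  sq := by
    rw [← h.sq]; exact ((hd.comp hd) n le_rfl).symm
  leib := by
    rw [← h.leib]
    exact (((hd.comp hm).sub (hm.comp ((hd.tmap (EqTo.refl _)).add
      ((EqTo.refl _).tmap hd)))) n le_rfl).symm
  coleib := by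
    rw [← h.coleib]
    exact (((hc.comp hd).sub (((hd.tmap (EqTo.refl _)).add
      ((EqTo.refl _).tmap hd)).comp hc)) n le_rfl).symm
  assoc := by
    rw [← h.assoc]
    exact (((hm.comp ((hm.tmap (EqTo.refl _)).comp (EqTo.refl _))).sub
      (hm.comp ((EqTo.refl _).tmap hm))) n le_rfl).symm
  compat := by
    rw [← h.compat]
    exact (((hc.comp hm).sub (((hm.tmap hm).comp (EqTo.refl _)).comp (hc.tmap hc))) n le_rfl).symm
  coassoc := by
    rw [← h.coassoc]
    exact ((((EqTo.refl _).comp ((hc.tmap (EqTo.refl _)).comp hc)).sub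
      (((EqTo.refl _).tmap hc).comp hc)) n le_rfl).symm

end DGHopfAlgebra

/-! ### Scalar series -/

section Scalars

open Finset.HasAntidiagonal (antidiagonal)

variable {k : Type u} [Field k]
variable {U V W V' W' : Type*} [AddCommGroup U] [Module k U] [AddCommGroup V] [Module k V]
  [AddCommGroup W] [Module k W] [AddCommGroup V'] [Module k V'] [AddCommGroup W'] [Module k W']

namespace FormalMap

/-- Multiplication of a series of vectors by a series of scalars. -/
def sm (s : ℕ → k) (y : ℕ → V) : ℕ → V := fun n => ∑ ab ∈ antidiagonal n, s ab.1 • y ab.2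

/-- This is `k[[t]]`-linearity; the two sides differ in the order in which the scalar and the map
split off their share of `n`. -/
theorem app_sm (g : FormalMap k V W) (s : ℕ → k) (y : ℕ → V) :
    app g (sm s y) = sm s (app g y) := by
  funext n
  simp only [app_apply, sm, map_sum, map_smul, Finset.smul_sum]
  rw [← sum_antidiagonal_assoc (fun a b c => s b • g a (y c)) n,
    ← sum_antidiagonal_assoc (fun a b c => s a • g b (y c)) n]
  exact Finset.sum_congr rfl fun p _ => (Finset.Nat.sum_antidiagonal_swap
    (f := fun a => s a.1 • g a.2 (y p.2)))

@[simp] theorem sm_zero_left (y : ℕ → V) : sm (0 : ℕ → k) y = 0 := by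
  funext n; simp [sm]

@[simp] theorem sm_zero_right (s : ℕ → k) : sm s (0 : ℕ → V) = 0 := by
  funext n; simp [sm]

theorem st_sm_left (s : ℕ → k) (x : ℕ → V) (y : ℕ → W) : st k (sm s x) y = sm s (st k x y) := by
  rw [← app_insR, app_sm, app_insR]

theorem st_sm_right (s : ℕ → k) (x : ℕ → V) (y : ℕ → W) : st k x (sm s y) = sm s (st k x y) := by
  rw [← app_insL, app_sm, app_insL]

theorem app_lid (s : ℕ → k) (y : ℕ → V) :
    app (const (TensorProduct.lid k V).toLinearMap) (st k s y) = sm s y := by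
  funext n; simp [app_const_st, sm]

theorem app_rid (s : ℕ → k) (y : ℕ → V) :
    app (const (TensorProduct.rid k V).toLinearMap) (st k y s) = sm s y := by
  funext n
  rw [app_const_st, ← Finset.Nat.sum_antidiagonal_swap]; simp [sm]

theorem sm_sm (s s' : ℕ → k) (y : ℕ → V) : sm (sm s s') y = sm s (sm s' y) := by
  rw [← app_lid (sm s s'), st_sm_left, app_sm, app_lid]

theorem sm_comm (s s' : ℕ → k) : sm s s' = sm s' s := by
  funext n
  rw [sm, ← Finset.Nat.sum_antidiagonal_swap]
  exact Finset.sum_congr rfl fun _ _ => mul_comm _ _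

theorem sm_ser_left (s : k) (y : ℕ → V) : sm (ser s) y = s • y := by
  funext n
  refine (sum_antidiagonal_eq_right (fun a b => (ser s : ℕ → k) a • y b) n fun b hb => ?_).trans ?_
  · simp [ser, Nat.sub_ne_zero_of_lt hb]
  · simp [ser]

theorem comp_const (g : FormalMap k V W) (f : U →ₗ[k] V) (n : ℕ) :
    (g ⊚ const f) n = g n ∘ₗ f :=
  sum_antidiagonal_eq_left (fun a b => g a ∘ₗ const f b) n
    fun a ha => by rw [const_succ f (Nat.sub_ne_zero_of_lt ha), LinearMap.comp_zero]

theorem const_comp (g : V →ₗ[k] W) (f : FormalMap k U V) (n : ℕ) :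
    (const g ⊚ f) n = g ∘ₗ f n :=
  sum_antidiagonal_eq_right (fun a b => const g a ∘ₗ f b) n
    fun a ha => by rw [const_succ g (Nat.sub_ne_zero_of_lt ha), LinearMap.zero_comp]

theorem const_add (f g : V →ₗ[k] W) : const (f + g) = const f + const g := by
  funext n
  by_cases h : n = 0 <;> simp [const, h]

theorem const_comp_const (g : V →ₗ[k] W) (f : U →ₗ[k] V) : const g ⊚ const f = const (g ∘ₗ f) := by
  funext n
  rw [comp_const]
  by_cases h : n = 0 <;> simp [const, h]

theorem const_tmap_const (f : V →ₗ[k] W) (g : V' →ₗ[k] W') :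
    const f ⊠ const g = const (TensorProduct.map f g) := by
  funext n
  refine (sum_antidiagonal_eq_left (fun a b => TensorProduct.map (const f a) (const g b)) n
    fun a ha => ?_).trans ?_
  · rw [const_succ g (Nat.sub_ne_zero_of_lt ha), TensorProduct.map_zero_right]
  · by_cases h : n = 0 <;> simp [const, h]

theorem app_const_mk (x : V) (y : ℕ → W) :
    app (const (TensorProduct.mk k V W x)) y = st k (ser x) y := by
  rw [← app_insL]
  congr 2
  funext n
  by_cases h : n = 0 <;> simp [const, insL, ser, h]

theorem app_const_mk_flip (x : V) (y : ℕ → W) :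
    app (const ((TensorProduct.mk k W V).flip x)) y = st k y (ser x) := by
  rw [← app_insR]
  congr 2
  funext n
  by_cases h : n = 0 <;> simp [const, insR, ser, h]

variable (W) in
/-- Applying a functional to the left factor. -/
def evL (ε : V →ₗ[k] k) : V ⊗[k] W →ₗ[k] W :=
  (TensorProduct.lid k W).toLinearMap ∘ₗ TensorProduct.map ε LinearMap.id

variable (W) in
/-- Applying a functional to the right factor. -/
def evR (ε : V →ₗ[k] k) : W ⊗[k] V →ₗ[k] W :=
  (TensorProduct.rid k W).toLinearMap ∘ₗ TensorProduct.map LinearMap.id ε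

@[simp] theorem evL_tmul (ε : V →ₗ[k] k) (x : V) (y : W) : evL W ε (x ⊗ₜ y) = ε x • y := by
  simp [evL]

@[simp] theorem evR_tmul (ε : V →ₗ[k] k) (x : V) (y : W) : evR W ε (y ⊗ₜ x) = ε x • y := by
  simp [evR]

theorem app_evL (ε : V →ₗ[k] k) (x : ℕ → V) (y : ℕ → W) :
    app (const (evL W ε)) (st k x y) = sm (app (const ε) x) y := by
  funext n
  rw [app_const_st]
  simp [sm, app_const_apply]

theorem app_evR (ε : V →ₗ[k] k) (x : ℕ → V) (y : ℕ → W) :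
    app (const (evR W ε)) (st k y x) = sm (app (const ε) x) y := by
  funext n
  rw [app_const_st, ← Finset.Nat.sum_antidiagonal_swap]
  simp [sm, app_const_apply]

end FormalMap

end Scalars

/-! ### Normalized series -/

section

variable {k : Type u} [Field k] {H : Type v} [AddCommGroup H] [Module k H]
  (𝒜 : ℕ → Submodule k H) [DirectSum.Decomposition 𝒜]

theorem iSup_eq_top : ⨆ p, 𝒜 p = ⊤ :=
  (DirectSum.Decomposition.isInternal 𝒜).submodule_iSup_eq_top

theorem linearMap_ext_homogeneous {W : Type*} [AddCommGroup W] [Module k W] {f g : H →ₗ[k] W}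
    (h : ∀ p, ∀ x ∈ 𝒜 p, f x = g x) : f = g := by
  have : (⊤ : Submodule k H) ≤ LinearMap.eqLocus f g := by
    rw [← iSup_eq_top 𝒜]; exact iSup_le fun p x hx => h p x hx
  exact LinearMap.ext fun x => this Submodule.mem_top

end

namespace DGHopfAlgebra

open FormalMap PreHopf

variable {k : Type u} [Field k] {H : Type v} [AddCommGroup H] [Module k H]
  {𝒜 : ℕ → Submodule k H} [DirectSum.Decomposition 𝒜] (X : DGHopfAlgebra 𝒜)

/-- The unit element. -/
def e : H := X.unit 1

theorem e_mem : X.e ∈ 𝒜 0 := X.unit_deg 1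

theorem counit_e : X.counit X.e = 1 := LinearMap.congr_fun X.counit_unit 1

theorem unit_eq (c : k) : X.unit c = c • X.e := by
  rw [e, ← map_smul, smul_eq_mul, mul_one]

/-- By connectedness degree `0` is a line, and `X.e` spans it because its counit is `1`. -/
theorem eq_counit_smul_e {x : H} (hx : x ∈ 𝒜 0) : x = X.counit x • X.e := by
  obtain ⟨φ⟩ := X.connected
  have he : φ ⟨X.e, X.e_mem⟩ ≠ 0 := by
    intro h0
    rw [LinearEquiv.map_eq_zero_iff] at h0
    have : X.e = 0 := congrArg Subtype.val h0
    simpa [this] using X.counit_e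
  have h : (⟨x, hx⟩ : 𝒜 0) = (φ ⟨x, hx⟩ / φ ⟨X.e, X.e_mem⟩) • ⟨X.e, X.e_mem⟩ := by
    apply φ.injective
    rw [map_smul, smul_eq_mul, div_mul_cancel₀ _ he]
  have h' : x = (φ ⟨x, hx⟩ / φ ⟨X.e, X.e_mem⟩) • X.e := congrArg Subtype.val h
  generalize (φ ⟨x, hx⟩ / φ ⟨X.e, X.e_mem⟩) = c at h'
  rw [h', map_smul, X.counit_e, smul_eq_mul, mul_one]

theorem e_mul (y : H) : X.mul (X.e ⊗ₜ y) = y := by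
  simpa [e] using LinearMap.congr_fun X.unit_mul y

theorem mul_e (y : H) : X.mul (y ⊗ₜ X.e) = y := by
  simpa [e] using LinearMap.congr_fun X.mul_unit y

theorem comul_e : X.comul X.e = X.e ⊗ₜ X.e := by
  simpa [e] using LinearMap.congr_fun X.comul_unit 1

theorem evL_comul : evL H X.counit ∘ₗ X.comul = LinearMap.id := X.counit_comul

theorem evR_comul : evR H X.counit ∘ₗ X.comul = LinearMap.id := X.comul_counit

/-- The Leibniz rule for `e · e = e` gives `d e = d e + d e`. -/
theorem d_e : X.d X.e = 0 := by
  have h := LinearMap.congr_fun X.d_mul (X.e ⊗ₜ X.e)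
  simp only [LinearMap.comp_apply, LinearMap.add_apply, TensorProduct.map_tmul, map_add,
    LinearMap.id_apply, τ_of_mem X.e_mem, pow_zero, one_smul, e_mul, mul_e] at h
  simpa using h

theorem counit_d : X.counit ∘ₗ X.d = 0 :=
  linearMap_ext_homogeneous 𝒜 fun p x hx => X.counit_deg _ p.succ_ne_zero _ (X.d_deg p x hx)

theorem counit_τ : X.counit ∘ₗ τ 𝒜 = X.counit :=
  linearMap_ext_homogeneous 𝒜 fun p x hx => by
    rcases Nat.eq_zero_or_pos p with rfl | hp
    · rw [LinearMap.comp_apply, τ_of_mem hx]; simp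
    · rw [LinearMap.comp_apply, τ_of_mem hx, map_smul, X.counit_deg p hp.ne' x hx, smul_zero]

/-- The coefficients `b` of a differential, a product and a coproduct are normalized. -/
structure NormalCoeff (bd : H →ₗ[k] H) (bm : H ⊗[k] H →ₗ[k] H) (bc : H →ₗ[k] H ⊗[k] H) :
    Prop where
  d_e : bd X.e = 0
  counit_d : X.counit ∘ₗ bd = 0
  e_mul : ∀ y, bm (X.e ⊗ₜ y) = 0
  mul_e : ∀ y, bm (y ⊗ₜ X.e) = 0
  counit_mul : X.counit ∘ₗ bm = 0
  comul_e : bc X.e = 0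
  evL_comul : evL H X.counit ∘ₗ bc = 0
  evR_comul : evR H X.counit ∘ₗ bc = 0

/-- `G` lifts `X`, with normalized coefficients. -/
structure Normal (G : PreHopf 𝒜) : Prop extends G.Lifts X where
  coeff : ∀ i ≠ 0, X.NormalCoeff (G.d i) (G.mul i) (G.comul i)

variable {X} {G : PreHopf 𝒜}

namespace Normal

local notation "ε" => app (const (DGHopfAlgebra.counit X))

/-- Normalized higher coefficients vanish on tensors with a factor `X.e` and take values killed by
the counit. Hence the relations of the undeformed unit and counit, taken up in this and the next
lemmas, persist for the series without correction terms. -/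
theorem e_mul (h : X.Normal G) (y : ℕ → H) : app G.mul (st k (ser X.e) y) = y := by
  rw [← app_const_mk, ← app_comp]
  suffices e : G.mul ⊚ const (TensorProduct.mk k H H X.e) = one by rw [e, app_one]
  funext n
  rw [comp_const]
  ext y
  rcases eq_or_ne n 0 with rfl | hn
  · simp [h.mul_zero, X.e_mul]
  · simp [(h.coeff n hn).e_mul, one, const, hn]

theorem mul_e (h : X.Normal G) (y : ℕ → H) : app G.mul (st k y (ser X.e)) = y := by
  rw [← app_const_mk_flip, ← app_comp]
  suffices e : G.mul ⊚ const ((TensorProduct.mk k H H).flip X.e) = one by rw [e, app_one]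
  funext n
  rw [comp_const]
  ext y
  rcases eq_or_ne n 0 with rfl | hn
  · simp [h.mul_zero, X.mul_e]
  · simp [(h.coeff n hn).mul_e, one, const, hn]

theorem comul_e (h : X.Normal G) : app G.comul (ser X.e) = st k (ser X.e) (ser X.e) := by
  rw [st_ser]
  funext n
  rw [app_ser]
  rcases eq_or_ne n 0 with rfl | hn
  · simp [h.comul_zero, X.comul_e, ser]
  · simp [(h.coeff n hn).comul_e, ser, hn]

theorem d_e (h : X.Normal G) : app G.d (ser X.e) = 0 := by
  funext n
  rw [app_ser]
  rcases eq_or_ne n 0 with rfl | hn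
  · simp [h.d_zero, X.d_e]
  · simp [(h.coeff n hn).d_e]

theorem counit_d (h : X.Normal G) (x : ℕ → H) : ε (app G.d x) = 0 := by
  rw [← app_comp]
  suffices e : const X.counit ⊚ G.d = 0 by rw [e, app_zero]
  funext n
  rw [const_comp]
  rcases eq_or_ne n 0 with rfl | hn
  · simp [h.d_zero, X.counit_d]
  · simp [(h.coeff n hn).counit_d]

theorem counit_mul (h : X.Normal G) (x y : ℕ → H) :
    ε (app G.mul (st k x y)) = sm (ε x) (ε y) := by
  rw [← app_lid, ← app_tmap, ← app_comp, ← app_comp]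
  congr 2
  rw [const_tmap_const, const_comp_const]
  funext n
  rw [const_comp]
  rcases eq_or_ne n 0 with rfl | hn
  · simp [h.mul_zero, X.counit_mul]
  · simp [(h.coeff n hn).counit_mul, const_succ _ hn]

theorem evL_comul (h : X.Normal G) (x : ℕ → H) :
    app (const (evL H X.counit)) (app G.comul x) = x := by
  rw [← app_comp]
  suffices e : const (evL H X.counit) ⊚ G.comul = one by rw [e, app_one]
  funext n
  rw [const_comp]
  rcases eq_or_ne n 0 with rfl | hn
  · simp [h.comul_zero, X.evL_comul]
  · simp [(h.coeff n hn).evL_comul, one, const_succ _ hn]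

theorem evR_comul (h : X.Normal G) (x : ℕ → H) :
    app (const (evR H X.counit)) (app G.comul x) = x := by
  rw [← app_comp]
  suffices e : const (evR H X.counit) ⊚ G.comul = one by rw [e, app_one]
  funext n
  rw [const_comp]
  rcases eq_or_ne n 0 with rfl | hn
  · simp [h.comul_zero, X.evR_comul]
  · simp [(h.coeff n hn).evR_comul, one, const_succ _ hn]

theorem counit_τ (x : ℕ → H) : ε (app (const (τ 𝒜)) x) = ε x := by
  rw [← app_comp, const_comp_const, X.counit_τ]

theorem counit_homog {p : ℕ} (hp : p ≠ 0) {x : ℕ → H} (hx : Homog 𝒜 p x) : ε x = 0 := by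
  funext n
  rw [app_const_apply, X.counit_deg p hp _ (hx n)]; rfl

theorem homog_e : Homog 𝒜 0 (ser X.e) := Homog.ser X.e_mem

/-! #### The defects vanish on units -/

theorem sqDefect_e (h : X.Normal G) : app G.sqDefect (ser X.e) = 0 := by
  simp [sqDefect, h.d_e]

theorem leibDefect_e_left (h : X.Normal G) (y : ℕ → H) :
    app G.leibDefect (st k (ser X.e) y) = 0 := by
  simp [leibDefect, h.e_mul, app_d2 G homog_e, h.d_e]

theorem leibDefect_e_right (h : X.Normal G) (y : ℕ → H) :
    app G.leibDefect (st k y (ser X.e)) = 0 := by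
  simp [leibDefect, h.mul_e, d2, h.d_e]

theorem coleibDefect_e (h : X.Normal G) : app G.coleibDefect (ser X.e) = 0 := by
  simp [coleibDefect, h.comul_e, d2, h.d_e]

theorem assocDefect_e_left (h : X.Normal G) (y z : ℕ → H) :
    app G.assocDefect (st k (ser X.e) (st k y z)) = 0 := by
  simp [assocDefect, h.e_mul]

theorem assocDefect_e_mid (h : X.Normal G) (y z : ℕ → H) :
    app G.assocDefect (st k y (st k (ser X.e) z)) = 0 := by
  simp [assocDefect, h.e_mul, h.mul_e]

theorem assocDefect_e_right (h : X.Normal G) (y z : ℕ → H) :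
    app G.assocDefect (st k y (st k z (ser X.e))) = 0 := by
  simp [assocDefect, h.mul_e]

theorem coassocDefect_e (h : X.Normal G) : app G.coassocDefect (ser X.e) = 0 := by
  simp [coassocDefect, h.comul_e]

theorem star_e_left (h : X.Normal G) (u : ℕ → H ⊗[k] H) :
    app G.star (st k (st k (ser X.e) (ser X.e)) u) = u := by
  rw [← app_insL, ← app_comp]
  suffices e : G.star ⊚ insL (H ⊗[k] H) (st k (ser X.e) (ser X.e)) = one by rw [e, app_one]
  refine hext₂ 𝒜 fun p q x y hx hy => ?_
  rw [app_comp, app_insL, app_star G _ _ homog_e hx]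
  simp [h.e_mul]

theorem star_e_right (h : X.Normal G) (u : ℕ → H ⊗[k] H) :
    app G.star (st k u (st k (ser X.e) (ser X.e))) = u := by
  rw [← app_insR, ← app_comp]
  suffices e : G.star ⊚ insR (H ⊗[k] H) (st k (ser X.e) (ser X.e)) = one by rw [e, app_one]
  refine hext₂ 𝒜 fun p q x y hx hy => ?_
  rw [app_comp, app_insR, app_star G _ _ hy homog_e]
  simp [h.mul_e]

theorem compatDefect_e_left (h : X.Normal G) (y : ℕ → H) :
    app G.compatDefect (st k (ser X.e) y) = 0 := by
  simp [compatDefect, h.e_mul, h.comul_e, h.star_e_left]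

theorem compatDefect_e_right (h : X.Normal G) (y : ℕ → H) :
    app G.compatDefect (st k y (ser X.e)) = 0 := by
  simp [compatDefect, h.mul_e, h.comul_e, h.star_e_right]

/-! #### The counit annihilates the defects -/

theorem counit_sqDefect (h : X.Normal G) (x : ℕ → H) : ε (app G.sqDefect x) = 0 := by
  simp [sqDefect, h.counit_d]

theorem counit_leibDefect (h : X.Normal G) (x y : ℕ → H) :
    ε (app G.leibDefect (st k x y)) = 0 := by
  simp [leibDefect, h.counit_d, h.counit_mul, d2]

theorem counit_assocDefect (h : X.Normal G) (x y z : ℕ → H) :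
    ε (app G.assocDefect (st k x (st k y z))) = 0 := by
  simp [assocDefect, h.counit_mul, sm_sm]

theorem evL_d2 (h : X.Normal G) (u : ℕ → H ⊗[k] H) :
    app (const (evL H X.counit)) (app G.d2 u) = app G.d (app (const (evL H X.counit)) u) := by
  rw [← app_comp, ← app_comp]
  congr 2
  refine hext₂ 𝒜 fun p q x y hx hy => ?_
  simp only [app_comp, d2, app_add, app_tmap, app_one, map_add, app_evL, h.counit_d, counit_τ,
    sm_zero_left, zero_add, app_sm]

theorem evR_d2 (h : X.Normal G) (u : ℕ → H ⊗[k] H) :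
    app (const (evR H X.counit)) (app G.d2 u) = app G.d (app (const (evR H X.counit)) u) := by
  rw [← app_comp, ← app_comp]
  congr 2
  refine hext₂ 𝒜 fun p q x y hx hy => ?_
  simp only [app_comp, d2, app_add, app_tmap, app_one, map_add, app_evR, h.counit_d,
    sm_zero_left, add_zero, app_sm]

theorem evL_coleibDefect (h : X.Normal G) (x : ℕ → H) :
    app (const (evL H X.counit)) (app G.coleibDefect x) = 0 := by
  simp [coleibDefect, h.evL_comul, h.evL_d2]

theorem evR_coleibDefect (h : X.Normal G) (x : ℕ → H) :
    app (const (evR H X.counit)) (app G.coleibDefect x) = 0 := by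
  simp [coleibDefect, h.evR_comul, h.evR_d2]

theorem evL_star (h : X.Normal G) (u w : ℕ → H ⊗[k] H) :
    app (const (evL H X.counit)) (app G.star (st k u w)) =
      app G.mul (st k (app (const (evL H X.counit)) u) (app (const (evL H X.counit)) w)) := by
  rw [← app_tmap, ← app_comp, ← app_comp]
  congr 2
  refine hext₂₂ 𝒜 fun p q r s a b c e ha hb hc he => ?_
  rw [app_comp, app_star G _ _ hb hc, map_smul, app_comp, app_tmap, app_evL, app_evL, app_evL,
    h.counit_mul, st_sm_left, st_sm_right, app_sm, app_sm, sm_sm]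
  -- The counit sees `c` only when its degree `r` is `0`, and then the Koszul sign `(-1)^(q * r)` is
  -- trivial.
  rcases eq_or_ne r 0 with rfl | hr
  · simp
  · simp [counit_homog hr hc]

theorem evR_star (h : X.Normal G) (u w : ℕ → H ⊗[k] H) :
    app (const (evR H X.counit)) (app G.star (st k u w)) =
      app G.mul (st k (app (const (evR H X.counit)) u) (app (const (evR H X.counit)) w)) := by
  rw [← app_tmap, ← app_comp, ← app_comp]
  congr 2
  refine hext₂₂ 𝒜 fun p q r s a b c e ha hb hc he => ?_
  rw [app_comp, app_star G _ _ hb hc, map_smul, app_comp, app_tmap, app_evR, app_evR, app_evR,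
    h.counit_mul, st_sm_left, st_sm_right, app_sm, app_sm, sm_sm]
  rcases eq_or_ne q 0 with rfl | hr
  · simp
  · simp [counit_homog hr hb]

theorem evL_compatDefect (h : X.Normal G) (x y : ℕ → H) :
    app (const (evL H X.counit)) (app G.compatDefect (st k x y)) = 0 := by
  simp [compatDefect, h.evL_comul, h.evL_star]

theorem evR_compatDefect (h : X.Normal G) (x y : ℕ → H) :
    app (const (evR H X.counit)) (app G.compatDefect (st k x y)) = 0 := by
  simp [compatDefect, h.evR_comul, h.evR_star]

/-- Under the counit on the first factor, both `(Δ ⊗ 1) Δ` and `(1 ⊗ Δ) Δ` become `Δ`. The same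
happens for the two other factors. -/
theorem evL_coassocDefect (h : X.Normal G) (x : ℕ → H) :
    app (const (evL (H ⊗[k] H) X.counit)) (app G.coassocDefect x) = 0 := by
  have h₁ : const (evL (H ⊗[k] H) X.counit) ⊚
      const (TensorProduct.assoc k H H H).toLinearMap ⊚ (G.comul ⊠ one) = one := by
    refine hext₂ 𝒜 fun p q x y hx hy => ?_
    have : const (evL (H ⊗[k] H) X.counit) ⊚ const (TensorProduct.assoc k H H H).toLinearMap =
        const (evL H X.counit) ⊠ one := by
      rw [const_comp_const, one, const_tmap_const]
      congr 1
      ext; simp [TensorProduct.smul_tmul']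
    rw [app_comp, app_comp, ← app_comp (const _) (const _), this]
    simp [h.evL_comul]
  have h₂ : const (evL (H ⊗[k] H) X.counit) ⊚ (one ⊠ G.comul) =
      G.comul ⊚ const (evL H X.counit) := by
    refine hext₂ 𝒜 fun p q x y hx hy => ?_
    simp [app_evL, app_sm]
  have h₁' := fun u => congrArg (fun f => app f u) h₁
  have h₂' := fun u => congrArg (fun f => app f u) h₂
  simp only [app_comp, app_one] at h₁' h₂'
  simp [coassocDefect, h₁', h₂', h.evL_comul]

/-- Applying the counit to the middle factor. -/
theorem evM_coassocDefect (h : X.Normal G) (x : ℕ → H) :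
    app (one ⊠ const (evL H X.counit)) (app G.coassocDefect x) = 0 := by
  have h₁ : (one ⊠ const (evL H X.counit)) ⊚
      const (TensorProduct.assoc k H H H).toLinearMap ⊚ (G.comul ⊠ one) = one := by
    refine hext₂ 𝒜 fun p q x y hx hy => ?_
    have : (one ⊠ const (evL H X.counit)) ⊚ const (TensorProduct.assoc k H H H).toLinearMap =
        const (evR H X.counit) ⊠ one := by
      rw [one, const_tmap_const, const_comp_const, const_tmap_const]
      congr 1
      ext; simp [TensorProduct.smul_tmul]
    rw [app_comp, app_comp, ← app_comp _ (const _), this]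
    simp [h.evR_comul]
  have h₁' := fun u => congrArg (fun f => app f u) h₁
  have h₂ : (one ⊠ const (evL H X.counit)) ⊚ ((one : FormalMap k H H) ⊠ G.comul) = one := by
    refine hext₂ 𝒜 fun p q x y hx hy => ?_
    simp [h.evL_comul]
  have h₂' := fun u => congrArg (fun f => app f u) h₂
  simp only [app_comp, app_one] at h₁' h₂'
  simp [coassocDefect, h₁', h₂']

theorem evR_coassocDefect (h : X.Normal G) (x : ℕ → H) :
    app (one ⊠ const (evR H X.counit)) (app G.coassocDefect x) = 0 := by
  have h₁ : (one ⊠ const (evR H X.counit)) ⊚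
      const (TensorProduct.assoc k H H H).toLinearMap ⊚ (G.comul ⊠ one) =
        G.comul ⊚ const (evR H X.counit) := by
    refine hext₂ 𝒜 fun p q x y hx hy => ?_
    have : (one ⊠ const (evR H X.counit)) ⊚ const (TensorProduct.assoc k H H H).toLinearMap =
        const (evR (H ⊗[k] H) X.counit) := by
      rw [one, const_tmap_const, const_comp_const]
      congr 1
      ext; simp
    rw [app_comp, app_comp, ← app_comp _ (const _), this]
    simp [app_evR, app_sm]
  have h₁' := fun u => congrArg (fun f => app f u) h₁
  have h₂ : (one ⊠ const (evR H X.counit)) ⊚ ((one : FormalMap k H H) ⊠ G.comul) = one := by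
    refine hext₂ 𝒜 fun p q x y hx hy => ?_
    simp [h.evR_comul]
  have h₂' := fun u => congrArg (fun f => app f u) h₂
  simp only [app_comp, app_one] at h₁' h₂'
  simp [coassocDefect, h₁', h₂', h.evR_comul]

end Normal
end DGHopfAlgebra

/-! ### Normalized cochains -/

section

variable {k : Type u} [Field k] {H : Type v} [AddCommGroup H] [Module k H]
  (𝒜 : ℕ → Submodule k H)

/-- The identifications `single` and `cons` are identity equivalences, so the submodules of the
statement take their plain form; the degenerate and positive tensors are treated likewise below. -/
theorem tensorGr_zero : @Eq (ℕ → Submodule k H) (tensorGr 𝒜 0) 𝒜 :=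
  funext fun q => Submodule.map_id (𝒜 q)

theorem tensorGr_succ (i : ℕ) :
    @Eq (ℕ → Submodule k (H ⊗[k] T k H i)) (tensorGr 𝒜 (i + 1)) (gt 𝒜 (tensorGr 𝒜 i)) :=
  funext fun _ => iSup_congr fun ab => iSup_congr fun _ => Submodule.map_id
    (Submodule.map₂ (TensorProduct.mk k H (T k H i)) (𝒜 ab.1) (tensorGr 𝒜 i ab.2))

theorem tensorGr_one : @Eq (ℕ → Submodule k (H ⊗[k] H)) (tensorGr 𝒜 1) (gt 𝒜 𝒜) := by
  have key : ∀ 𝒢 : ℕ → Submodule k H, tensorGr 𝒜 0 = 𝒢 →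
      @Eq (ℕ → Submodule k (H ⊗[k] H)) (tensorGr 𝒜 1) (gt 𝒜 𝒢) := by
    rintro _ rfl; exact tensorGr_succ 𝒜 0
  exact key _ (tensorGr_zero 𝒜)

theorem tensorGr_two :
    @Eq (ℕ → Submodule k (H ⊗[k] (H ⊗[k] H))) (tensorGr 𝒜 2) (gt 𝒜 (gt 𝒜 𝒜)) := by
  have key : ∀ 𝒢 : ℕ → Submodule k (H ⊗[k] H), tensorGr 𝒜 1 = 𝒢 →
      @Eq (ℕ → Submodule k (H ⊗[k] (H ⊗[k] H))) (tensorGr 𝒜 2) (gt 𝒜 𝒢) := by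
    rintro _ rfl; exact tensorGr_succ 𝒜 1
  exact key _ (tensorGr_one 𝒜)

/-- The span of the elements of positive degree. -/
def posPart : Submodule k H := ⨆ q : ℕ, 𝒜 (q + 1)

theorem tensorPositive_zero : @Eq (Submodule k H) (tensorPositive 𝒜 0) (posPart 𝒜) :=
  Submodule.map_id (posPart 𝒜)

theorem tensorPositive_succ (i : ℕ) :
    @Eq (Submodule k (H ⊗[k] T k H i)) (tensorPositive 𝒜 (i + 1))
      (Submodule.map₂ (TensorProduct.mk k H (T k H i)) (posPart 𝒜) (tensorPositive 𝒜 i)) :=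
  Submodule.map_id (Submodule.map₂ (TensorProduct.mk k H (T k H i)) (posPart 𝒜)
    (tensorPositive 𝒜 i))

theorem tensorPositive_one : @Eq (Submodule k (H ⊗[k] H)) (tensorPositive 𝒜 1)
    (Submodule.map₂ (TensorProduct.mk k H H) (posPart 𝒜) (posPart 𝒜)) := by
  have key : ∀ P : Submodule k H, tensorPositive 𝒜 0 = P →
      @Eq (Submodule k (H ⊗[k] H)) (tensorPositive 𝒜 1)
        (Submodule.map₂ (TensorProduct.mk k H H) (posPart 𝒜) P) := by
    rintro _ rfl; exact tensorPositive_succ 𝒜 0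
  exact key _ (tensorPositive_zero 𝒜)

theorem tensorPositive_two : @Eq (Submodule k (H ⊗[k] (H ⊗[k] H))) (tensorPositive 𝒜 2)
    (Submodule.map₂ (TensorProduct.mk k H (H ⊗[k] H)) (posPart 𝒜)
      (Submodule.map₂ (TensorProduct.mk k H H) (posPart 𝒜) (posPart 𝒜))) := by
  have key : ∀ P : Submodule k (H ⊗[k] H), tensorPositive 𝒜 1 = P →
      @Eq (Submodule k (H ⊗[k] (H ⊗[k] H))) (tensorPositive 𝒜 2)
        (Submodule.map₂ (TensorProduct.mk k H (H ⊗[k] H)) (posPart 𝒜) P) := by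
    rintro _ rfl; exact tensorPositive_succ 𝒜 1
  exact key _ (tensorPositive_one 𝒜)

theorem tensorDegenerate_zero : @Eq (Submodule k H) (tensorDegenerate 𝒜 0) (𝒜 0) :=
  Submodule.map_id (𝒜 0)

theorem tensorDegenerate_succ (i : ℕ) :
    @Eq (Submodule k (H ⊗[k] T k H i)) (tensorDegenerate 𝒜 (i + 1))
      (Submodule.map₂ (TensorProduct.mk k H (T k H i)) (𝒜 0) ⊤ ⊔
        Submodule.map₂ (TensorProduct.mk k H (T k H i)) ⊤ (tensorDegenerate 𝒜 i)) :=
  Submodule.map_id (Submodule.map₂ (TensorProduct.mk k H (T k H i)) (𝒜 0) ⊤ ⊔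
    Submodule.map₂ (TensorProduct.mk k H (T k H i)) ⊤ (tensorDegenerate 𝒜 i))

theorem tensorDegenerate_one : @Eq (Submodule k (H ⊗[k] H)) (tensorDegenerate 𝒜 1)
    (Submodule.map₂ (TensorProduct.mk k H H) (𝒜 0) ⊤ ⊔
      Submodule.map₂ (TensorProduct.mk k H H) ⊤ (𝒜 0)) := by
  have key : ∀ P : Submodule k H, tensorDegenerate 𝒜 0 = P →
      @Eq (Submodule k (H ⊗[k] H)) (tensorDegenerate 𝒜 1)
        (Submodule.map₂ (TensorProduct.mk k H H) (𝒜 0) ⊤ ⊔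
          Submodule.map₂ (TensorProduct.mk k H H) ⊤ P) := by
    rintro _ rfl; exact tensorDegenerate_succ 𝒜 0
  exact key _ (tensorDegenerate_zero 𝒜)

theorem tensorDegenerate_two : @Eq (Submodule k (H ⊗[k] (H ⊗[k] H))) (tensorDegenerate 𝒜 2)
    (Submodule.map₂ (TensorProduct.mk k H (H ⊗[k] H)) (𝒜 0) ⊤ ⊔
      Submodule.map₂ (TensorProduct.mk k H (H ⊗[k] H)) ⊤
        (Submodule.map₂ (TensorProduct.mk k H H) (𝒜 0) ⊤ ⊔
          Submodule.map₂ (TensorProduct.mk k H H) ⊤ (𝒜 0))) := by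
  have key : ∀ P : Submodule k (H ⊗[k] H), tensorDegenerate 𝒜 1 = P →
      @Eq (Submodule k (H ⊗[k] (H ⊗[k] H))) (tensorDegenerate 𝒜 2)
        (Submodule.map₂ (TensorProduct.mk k H (H ⊗[k] H)) (𝒜 0) ⊤ ⊔
          Submodule.map₂ (TensorProduct.mk k H (H ⊗[k] H)) ⊤ P) := by
    rintro _ rfl; exact tensorDegenerate_succ 𝒜 1
  exact key _ (tensorDegenerate_one 𝒜)

end

namespace DGHopfAlgebra

open FormalMap PreHopf

variable {k : Type u} [Field k] {H : Type v} [AddCommGroup H] [Module k H]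
  {𝒜 : ℕ → Submodule k H} [DirectSum.Decomposition 𝒜] (X : DGHopfAlgebra 𝒜)
  {W : Type*} [AddCommGroup W] [Module k W]

/-- Degree `0` is spanned by `X.e`, so normalization in the arguments need only be tested on the
unit. -/
theorem vanish_zero {f : H →ₗ[k] W} (h : f X.e = 0) : 𝒜 0 ≤ LinearMap.ker f := fun x hx => by
  rw [LinearMap.mem_ker, X.eq_counit_smul_e hx, map_smul, h, smul_zero]

theorem vanish_left {V : Type*} [AddCommGroup V] [Module k V] {f : H ⊗[k] V →ₗ[k] W}
    (h : ∀ y, f (X.e ⊗ₜ y) = 0) :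
    Submodule.map₂ (TensorProduct.mk k H V) (𝒜 0) ⊤ ≤ LinearMap.ker f :=
  Submodule.map₂_le.2 fun _ hx y _ =>
    X.vanish_zero (f := f ∘ₗ (TensorProduct.mk k H V).flip y) (h y) hx

theorem vanish_right {V : Type*} [AddCommGroup V] [Module k V] {f : H ⊗[k] V →ₗ[k] W}
    {P : Submodule k V} (h : ∀ x, P ≤ LinearMap.ker (f ∘ₗ TensorProduct.mk k H V x)) :
    Submodule.map₂ (TensorProduct.mk k H V) ⊤ P ≤ LinearMap.ker f :=
  Submodule.map₂_le.2 fun x _ _ hy => h x hy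

theorem vanish_one {f : H ⊗[k] H →ₗ[k] W} (h₁ : ∀ y, f (X.e ⊗ₜ y) = 0)
    (h₂ : ∀ y, f (y ⊗ₜ X.e) = 0) :
    Submodule.map₂ (TensorProduct.mk k H H) (𝒜 0) ⊤ ⊔
      Submodule.map₂ (TensorProduct.mk k H H) ⊤ (𝒜 0) ≤ LinearMap.ker f :=
  sup_le (X.vanish_left h₁) (vanish_right fun x => X.vanish_zero (h₂ x))

theorem vanish_two {f : H ⊗[k] (H ⊗[k] H) →ₗ[k] W} (h₁ : ∀ y z, f (X.e ⊗ₜ (y ⊗ₜ z)) = 0)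
    (h₂ : ∀ y z, f (y ⊗ₜ (X.e ⊗ₜ z)) = 0) (h₃ : ∀ y z, f (y ⊗ₜ (z ⊗ₜ X.e)) = 0) :
    Submodule.map₂ (TensorProduct.mk k H (H ⊗[k] H)) (𝒜 0) ⊤ ⊔
      Submodule.map₂ (TensorProduct.mk k H (H ⊗[k] H)) ⊤
        (Submodule.map₂ (TensorProduct.mk k H H) (𝒜 0) ⊤ ⊔
          Submodule.map₂ (TensorProduct.mk k H H) ⊤ (𝒜 0)) ≤ LinearMap.ker f := by
  refine sup_le (X.vanish_left fun u => ?_)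
    (vanish_right fun x => X.vanish_one (h₂ x) fun y => h₃ x y)
  have : f ∘ₗ TensorProduct.mk k H (H ⊗[k] H) X.e = 0 := TensorProduct.ext' h₁
  exact LinearMap.congr_fun this u

/-- The projection to the elements of positive degree. -/
def proj : H →ₗ[k] H := LinearMap.id - X.counit.smulRight X.e

theorem proj_mem (x : H) : X.proj x ∈ posPart 𝒜 := by
  have : (⊤ : Submodule k H) ≤ (posPart 𝒜).comap X.proj := by
    rw [← iSup_eq_top 𝒜]
    refine iSup_le fun p x hx => ?_
    rw [Submodule.mem_comap]
    rcases p with _ | p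
    · have : X.proj x = 0 := by
        simp only [proj, LinearMap.sub_apply, LinearMap.id_apply, LinearMap.smulRight_apply]
        rw [← X.eq_counit_smul_e hx, sub_self]
      rw [this]; exact zero_mem _
    · have : X.proj x = x := by simp [proj, X.counit_deg _ p.succ_ne_zero x hx]
      rw [this]; exact Submodule.mem_iSup_of_mem p hx
  exact this Submodule.mem_top

theorem posPart_le_ker : posPart 𝒜 ≤ LinearMap.ker X.counit :=
  iSup_le fun p x hx => X.counit_deg _ p.succ_ne_zero x hx

theorem mem_posPart {x : H} (h : X.counit x = 0) : x ∈ posPart 𝒜 := by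
  have := X.proj_mem x
  simpa [proj, h] using this

/-- `proj ⊗ 1` subtracts `e ⊗ (ε ⊗ 1) u`, which is zero here. -/
theorem map_proj {V : Type*} [AddCommGroup V] [Module k V] {u : H ⊗[k] V}
    (h : evL V X.counit u = 0) : TensorProduct.map X.proj LinearMap.id u = u := by
  have : TensorProduct.map X.proj LinearMap.id =
      LinearMap.id - TensorProduct.mk k H V X.e ∘ₗ evL V X.counit :=
    TensorProduct.ext' fun x y => by simp [proj, TensorProduct.sub_tmul, TensorProduct.smul_tmul]
  rw [this]; simp [h]

theorem map_proj_right {V : Type*} [AddCommGroup V] [Module k V] {u : V ⊗[k] H}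
    (h : evR V X.counit u = 0) : TensorProduct.map LinearMap.id X.proj u = u := by
  have : TensorProduct.map LinearMap.id X.proj =
      LinearMap.id - (TensorProduct.mk k V H).flip X.e ∘ₗ evR V X.counit :=
    TensorProduct.ext' fun x y => by simp [proj, TensorProduct.tmul_sub]
  rw [this]; simp [h]

theorem map_mem_map₂ {V V' W' : Type*} [AddCommGroup V] [Module k V] [AddCommGroup V'] [Module k V']
    [AddCommGroup W'] [Module k W'] {f : V →ₗ[k] V'} {g : W →ₗ[k] W'} {P : Submodule k V'}
    {Q : Submodule k W'} (hf : ∀ x, f x ∈ P) (hg : ∀ x, g x ∈ Q) (u : V ⊗[k] W) :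
    TensorProduct.map f g u ∈ Submodule.map₂ (TensorProduct.mk k V' W') P Q := by
  induction u with
  | zero => simp
  | tmul x y => exact Submodule.apply_mem_map₂ _ (hf x) (hg y)
  | add u v hu hv => rw [map_add]; exact add_mem hu hv

/-- A tensor killed by the counit in each factor is fixed by `proj ⊗ proj`, and the image of that
map consists of tensors with positive factors. -/
theorem positive_one {u : H ⊗[k] H} (h₁ : evL H X.counit u = 0) (h₂ : evR H X.counit u = 0) :
    u ∈ Submodule.map₂ (TensorProduct.mk k H H) (posPart 𝒜) (posPart 𝒜) := by
  have : TensorProduct.map X.proj X.proj u = u := by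
    have e := TensorProduct.map_comp X.proj LinearMap.id LinearMap.id X.proj
    rw [LinearMap.comp_id, LinearMap.id_comp] at e
    rw [e, LinearMap.comp_apply, X.map_proj_right h₂, X.map_proj h₁]
  rw [← this]
  exact map_mem_map₂ X.proj_mem X.proj_mem u

theorem positive_two {u : H ⊗[k] (H ⊗[k] H)} (h₁ : evL _ X.counit u = 0)
    (h₂ : TensorProduct.map LinearMap.id (evL H X.counit) u = 0)
    (h₃ : TensorProduct.map LinearMap.id (evR H X.counit) u = 0) :
    u ∈ Submodule.map₂ (TensorProduct.mk k H (H ⊗[k] H)) (posPart 𝒜)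
      (Submodule.map₂ (TensorProduct.mk k H H) (posPart 𝒜) (posPart 𝒜)) := by
  have e₁ : TensorProduct.map LinearMap.id (TensorProduct.map X.proj LinearMap.id) u = u := by
    have : TensorProduct.map LinearMap.id (TensorProduct.map X.proj LinearMap.id) =
        LinearMap.id - TensorProduct.map LinearMap.id (TensorProduct.mk k H H X.e) ∘ₗ
          TensorProduct.map (LinearMap.id : H →ₗ[k] H) (evL H X.counit) := by
      ext x y z; simp [proj, TensorProduct.sub_tmul, TensorProduct.tmul_sub, TensorProduct.smul_tmul]
    rw [this]; simp [h₂]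
  have e₂ : TensorProduct.map LinearMap.id (TensorProduct.map LinearMap.id X.proj) u = u := by
    have : TensorProduct.map LinearMap.id (TensorProduct.map LinearMap.id X.proj) =
        LinearMap.id - TensorProduct.map LinearMap.id ((TensorProduct.mk k H H).flip X.e) ∘ₗ
          TensorProduct.map (LinearMap.id : H →ₗ[k] H) (evR H X.counit) := by
      ext x y z; simp [proj, TensorProduct.tmul_sub]
    rw [this]; simp [h₃]
  have : TensorProduct.map X.proj (TensorProduct.map X.proj X.proj) u = u := by
    have e : TensorProduct.map X.proj (TensorProduct.map X.proj X.proj) =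
        TensorProduct.map X.proj LinearMap.id ∘ₗ
        TensorProduct.map LinearMap.id (TensorProduct.map X.proj LinearMap.id) ∘ₗ
        TensorProduct.map LinearMap.id (TensorProduct.map LinearMap.id X.proj) := by
      ext x y z; simp
    rw [e, LinearMap.comp_apply, LinearMap.comp_apply, e₂, e₁, X.map_proj h₁]
  rw [← this]
  exact map_mem_map₂ X.proj_mem (map_mem_map₂ X.proj_mem X.proj_mem) u

end DGHopfAlgebra

section

variable {k : Type u} [Field k] {H : Type v} [AddCommGroup H] [Module k H]
  (𝒜 : ℕ → Submodule k H)

/-- Tensors with two factors, both of positive degree. -/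
abbrev pos₂ : Submodule k (H ⊗[k] H) :=
  Submodule.map₂ (TensorProduct.mk k H H) (posPart 𝒜) (posPart 𝒜)

/-- Tensors with three factors, all of positive degree. -/
abbrev pos₃ : Submodule k (H ⊗[k] (H ⊗[k] H)) :=
  Submodule.map₂ (TensorProduct.mk k H (H ⊗[k] H)) (posPart 𝒜) (pos₂ 𝒜)

/-- Tensors with two factors, one of degree `0`. -/
abbrev degen₂ : Submodule k (H ⊗[k] H) :=
  Submodule.map₂ (TensorProduct.mk k H H) (𝒜 0) ⊤ ⊔
    Submodule.map₂ (TensorProduct.mk k H H) ⊤ (𝒜 0)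

/-- Tensors with three factors, one of degree `0`. -/
abbrev degen₃ : Submodule k (H ⊗[k] (H ⊗[k] H)) :=
  Submodule.map₂ (TensorProduct.mk k H (H ⊗[k] H)) (𝒜 0) ⊤ ⊔
    Submodule.map₂ (TensorProduct.mk k H (H ⊗[k] H)) ⊤ (degen₂ 𝒜)

variable {V W : Type*} [AddCommGroup V] [Module k V] [AddCommGroup W] [Module k W]

/-- The conditions on a normalized cochain. -/
def IsCochain (𝒢 : ℕ → Submodule k V) (ℋ : ℕ → Submodule k W) (D : Submodule k V)
    (P : Submodule k W) (p : ℕ) (f : V →ₗ[k] W) : Prop :=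
  IsDeg 𝒢 ℋ p f ∧ (∀ x ∈ D, f x = 0) ∧ ∀ x, f x ∈ P

end

/-! ### Membership in the cochain spaces of low tridegree. -/

namespace DGHopfAlgebra

open FormalMap PreHopf

variable {k : Type u} [Field k] {H : Type v} [AddCommGroup H] [Module k H]
  {𝒜 : ℕ → Submodule k H}

theorem mem_cochains_zero_zero {p : ℕ} {f : H →ₗ[k] H} :
    f ∈ cochains 𝒜 p 0 0 ↔ IsCochain 𝒜 𝒜 (𝒜 0) (posPart 𝒜) p f := by
  have key : ∀ (𝒢 ℋ : ℕ → Submodule k H) (D P : Submodule k H), tensorGr 𝒜 0 = 𝒢 →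
      tensorGr 𝒜 0 = ℋ → tensorDegenerate 𝒜 0 = D → tensorPositive 𝒜 0 = P →
      (f ∈ cochains 𝒜 p 0 0 ↔ IsCochain 𝒢 ℋ D P p f) := by
    rintro _ _ _ _ rfl rfl rfl rfl; exact Iff.rfl
  exact key _ _ _ _ (tensorGr_zero 𝒜) (tensorGr_zero 𝒜) (tensorDegenerate_zero 𝒜)
    (tensorPositive_zero 𝒜)

theorem mem_cochains_one_zero {p : ℕ} {f : H ⊗[k] H →ₗ[k] H} :
    f ∈ cochains 𝒜 p 1 0 ↔ IsCochain (gt 𝒜 𝒜) 𝒜 (degen₂ 𝒜) (posPart 𝒜) p f := by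
  have key : ∀ (𝒢 : ℕ → Submodule k (H ⊗[k] H)) (ℋ : ℕ → Submodule k H)
      (D : Submodule k (H ⊗[k] H)) (P : Submodule k H), tensorGr 𝒜 1 = 𝒢 →
      tensorGr 𝒜 0 = ℋ → tensorDegenerate 𝒜 1 = D → tensorPositive 𝒜 0 = P →
      (f ∈ cochains 𝒜 p 1 0 ↔ IsCochain 𝒢 ℋ D P p f) := by
    rintro _ _ _ _ rfl rfl rfl rfl; exact Iff.rfl
  exact key _ _ _ _ (tensorGr_one 𝒜) (tensorGr_zero 𝒜) (tensorDegenerate_one 𝒜)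
    (tensorPositive_zero 𝒜)

theorem mem_cochains_zero_one {p : ℕ} {f : H →ₗ[k] H ⊗[k] H} :
    f ∈ cochains 𝒜 p 0 1 ↔ IsCochain 𝒜 (gt 𝒜 𝒜) (𝒜 0) (pos₂ 𝒜) p f := by
  have key : ∀ (𝒢 : ℕ → Submodule k H) (ℋ : ℕ → Submodule k (H ⊗[k] H))
      (D : Submodule k H) (P : Submodule k (H ⊗[k] H)), tensorGr 𝒜 0 = 𝒢 →
      tensorGr 𝒜 1 = ℋ → tensorDegenerate 𝒜 0 = D → tensorPositive 𝒜 1 = P →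
      (f ∈ cochains 𝒜 p 0 1 ↔ IsCochain 𝒢 ℋ D P p f) := by
    rintro _ _ _ _ rfl rfl rfl rfl; exact Iff.rfl
  exact key _ _ _ _ (tensorGr_zero 𝒜) (tensorGr_one 𝒜) (tensorDegenerate_zero 𝒜)
    (tensorPositive_one 𝒜)

theorem mem_cochains_two_zero {p : ℕ} {f : H ⊗[k] (H ⊗[k] H) →ₗ[k] H} :
    f ∈ cochains 𝒜 p 2 0 ↔ IsCochain (gt 𝒜 (gt 𝒜 𝒜)) 𝒜 (degen₃ 𝒜) (posPart 𝒜) p f := by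
  have key : ∀ (𝒢 : ℕ → Submodule k (H ⊗[k] (H ⊗[k] H))) (ℋ : ℕ → Submodule k H)
      (D : Submodule k (H ⊗[k] (H ⊗[k] H))) (P : Submodule k H), tensorGr 𝒜 2 = 𝒢 →
      tensorGr 𝒜 0 = ℋ → tensorDegenerate 𝒜 2 = D → tensorPositive 𝒜 0 = P →
      (f ∈ cochains 𝒜 p 2 0 ↔ IsCochain 𝒢 ℋ D P p f) := by
    rintro _ _ _ _ rfl rfl rfl rfl; exact Iff.rfl
  exact key _ _ _ _ (tensorGr_two 𝒜) (tensorGr_zero 𝒜) (tensorDegenerate_two 𝒜)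
    (tensorPositive_zero 𝒜)

theorem mem_cochains_one_one {p : ℕ} {f : H ⊗[k] H →ₗ[k] H ⊗[k] H} :
    f ∈ cochains 𝒜 p 1 1 ↔ IsCochain (gt 𝒜 𝒜) (gt 𝒜 𝒜) (degen₂ 𝒜) (pos₂ 𝒜) p f := by
  have key : ∀ (𝒢 ℋ : ℕ → Submodule k (H ⊗[k] H))
      (D P : Submodule k (H ⊗[k] H)), tensorGr 𝒜 1 = 𝒢 →
      tensorGr 𝒜 1 = ℋ → tensorDegenerate 𝒜 1 = D → tensorPositive 𝒜 1 = P →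
      (f ∈ cochains 𝒜 p 1 1 ↔ IsCochain 𝒢 ℋ D P p f) := by
    rintro _ _ _ _ rfl rfl rfl rfl; exact Iff.rfl
  exact key _ _ _ _ (tensorGr_one 𝒜) (tensorGr_one 𝒜) (tensorDegenerate_one 𝒜)
    (tensorPositive_one 𝒜)

theorem mem_cochains_zero_two {p : ℕ} {f : H →ₗ[k] H ⊗[k] (H ⊗[k] H)} :
    f ∈ cochains 𝒜 p 0 2 ↔ IsCochain 𝒜 (gt 𝒜 (gt 𝒜 𝒜)) (𝒜 0) (pos₃ 𝒜) p f := by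
  have key : ∀ (𝒢 : ℕ → Submodule k H) (ℋ : ℕ → Submodule k (H ⊗[k] (H ⊗[k] H)))
      (D : Submodule k H) (P : Submodule k (H ⊗[k] (H ⊗[k] H))), tensorGr 𝒜 0 = 𝒢 →
      tensorGr 𝒜 2 = ℋ → tensorDegenerate 𝒜 0 = D → tensorPositive 𝒜 2 = P →
      (f ∈ cochains 𝒜 p 0 2 ↔ IsCochain 𝒢 ℋ D P p f) := by
    rintro _ _ _ _ rfl rfl rfl rfl; exact Iff.rfl
  exact key _ _ _ _ (tensorGr_zero 𝒜) (tensorGr_two 𝒜) (tensorDegenerate_zero 𝒜)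
    (tensorPositive_two 𝒜)

variable [DirectSum.Decomposition 𝒜] {X : DGHopfAlgebra 𝒜}

/-! #### The obstruction is a normalized cochain -/

section
variable (G : PreHopf 𝒜)

theorem d2_deg : FDeg (gt 𝒜 𝒜) (gt 𝒜 𝒜) 1 G.d2 := by
  have h₁ : FDeg (gt 𝒜 𝒜) (gt 𝒜 𝒜) (1 + 0) (G.d ⊠ one) := G.d_deg.tmap FDeg.one
  have h₂ : FDeg (gt 𝒜 𝒜) (gt 𝒜 𝒜) (0 + 1) (const (τ 𝒜) ⊠ G.d) :=
    (FDeg.const IsDeg.τ).tmap G.d_deg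
  exact FDeg.add h₁ h₂

theorem sqDefect_deg : FDeg 𝒜 𝒜 2 G.sqDefect := G.d_deg.comp G.d_deg

theorem leibDefect_deg : FDeg (gt 𝒜 𝒜) 𝒜 1 G.leibDefect :=
  (G.d_deg.comp G.mul_deg).sub (G.mul_deg.comp (d2_deg G))

theorem coleibDefect_deg : FDeg 𝒜 (gt 𝒜 𝒜) 1 G.coleibDefect :=
  (G.comul_deg.comp G.d_deg).sub ((d2_deg G).comp G.comul_deg)

theorem assocDefect_deg : FDeg (gt 𝒜 (gt 𝒜 𝒜)) 𝒜 0 G.assocDefect := by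
  have h₁ : FDeg (gt 𝒜 (gt 𝒜 𝒜)) (gt 𝒜 𝒜) 0
      ((G.mul ⊠ one) ⊚ const (TensorProduct.assoc k H H H).symm.toLinearMap) :=
    (G.mul_deg.tmap FDeg.one).comp (FDeg.const IsDeg.assoc_symm)
  have h₂ : FDeg (gt 𝒜 (gt 𝒜 𝒜)) (gt 𝒜 𝒜) 0 (one ⊠ G.mul) :=
    FDeg.tmap (p := 0) (q := 0) FDeg.one G.mul_deg
  exact FDeg.sub (G.mul_deg.comp h₁) (G.mul_deg.comp h₂)

theorem compatDefect_deg : FDeg (gt 𝒜 𝒜) (gt 𝒜 𝒜) 0 G.compatDefect := by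
  have h₁ : FDeg (gt (gt 𝒜 𝒜) (gt 𝒜 𝒜)) (gt 𝒜 𝒜) 0 G.star :=
    (FDeg.tmap (p := 0) (q := 0) G.mul_deg G.mul_deg).comp (FDeg.const IsDeg.midSwap)
  have h₂ : FDeg (gt 𝒜 𝒜) (gt (gt 𝒜 𝒜) (gt 𝒜 𝒜)) 0 (G.comul ⊠ G.comul) :=
    FDeg.tmap (p := 0) (q := 0) G.comul_deg G.comul_deg
  exact FDeg.sub (G.comul_deg.comp G.mul_deg) (h₁.comp h₂)

theorem coassocDefect_deg : FDeg 𝒜 (gt 𝒜 (gt 𝒜 𝒜)) 0 G.coassocDefect :=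
  ((FDeg.const IsDeg.assoc).comp ((G.comul_deg.tmap FDeg.one).comp G.comul_deg)).sub
    ((FDeg.one.tmap G.comul_deg).comp G.comul_deg)

end

variable {G : PreHopf 𝒜}

theorem mem_pos_of_vanish {V : Type*} [AddCommGroup V] [Module k V] {f : V →ₗ[k] H}
    (h : X.counit ∘ₗ f = 0) (x : V) : f x ∈ posPart 𝒜 :=
  X.mem_posPart (LinearMap.congr_fun h x)

/-- The vanishing statements for series are evaluated on constant series and read off at order `n`.
They hold at every order, so neither this lemma nor its five analogues needs the axioms at lower
orders. -/
theorem sqDefect_mem (h : X.Normal G) (n : ℕ) : G.sqDefect n ∈ cochains 𝒜 2 0 0 := by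
  refine mem_cochains_zero_zero.2 ⟨sqDefect_deg G n, X.vanish_zero ?_, mem_pos_of_vanish
    (X := X) (LinearMap.ext fun x => ?_)⟩
  · simpa using congrFun h.sqDefect_e n
  · simpa [app_const_apply] using congrFun (h.counit_sqDefect (ser x)) n

theorem leibDefect_mem (h : X.Normal G) (n : ℕ) : G.leibDefect n ∈ cochains 𝒜 1 1 0 := by
  refine mem_cochains_one_zero.2 ⟨leibDefect_deg G n, X.vanish_one (fun y => ?_) fun y => ?_,
    mem_pos_of_vanish (X := X) (TensorProduct.ext' fun x y => ?_)⟩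
  · simpa [st_ser] using congrFun (h.leibDefect_e_left (ser y)) n
  · simpa [st_ser] using congrFun (h.leibDefect_e_right (ser y)) n
  · simpa [st_ser, app_const_apply] using congrFun (h.counit_leibDefect (ser x) (ser y)) n

theorem coleibDefect_mem (h : X.Normal G) (n : ℕ) : G.coleibDefect n ∈ cochains 𝒜 1 0 1 := by
  refine mem_cochains_zero_one.2 ⟨coleibDefect_deg G n, X.vanish_zero ?_, fun x =>
    X.positive_one ?_ ?_⟩
  · simpa using congrFun h.coleibDefect_e n
  · simpa [app_const_apply] using congrFun (h.evL_coleibDefect (ser x)) n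
  · simpa [app_const_apply] using congrFun (h.evR_coleibDefect (ser x)) n

theorem assocDefect_mem (h : X.Normal G) (n : ℕ) : G.assocDefect n ∈ cochains 𝒜 0 2 0 := by
  refine mem_cochains_two_zero.2 ⟨assocDefect_deg G n, X.vanish_two (fun y z => ?_)
    (fun y z => ?_) (fun y z => ?_), mem_pos_of_vanish (X := X)
    (TensorProduct.ext_threefold' fun x y z => ?_)⟩
  · simpa [st_ser] using congrFun (h.assocDefect_e_left (ser y) (ser z)) n
  · simpa [st_ser] using congrFun (h.assocDefect_e_mid (ser y) (ser z)) n
  · simpa [st_ser] using congrFun (h.assocDefect_e_right (ser y) (ser z)) n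
  · simpa [st_ser, app_const_apply] using
      congrFun (h.counit_assocDefect (ser x) (ser y) (ser z)) n

theorem compatDefect_mem (h : X.Normal G) (n : ℕ) : G.compatDefect n ∈ cochains 𝒜 0 1 1 := by
  have h₁ : evL H X.counit ∘ₗ G.compatDefect n = 0 := TensorProduct.ext' fun x y => by
    simpa [st_ser, app_const_apply] using congrFun (h.evL_compatDefect (ser x) (ser y)) n
  have h₂ : evR H X.counit ∘ₗ G.compatDefect n = 0 := TensorProduct.ext' fun x y => by
    simpa [st_ser, app_const_apply] using congrFun (h.evR_compatDefect (ser x) (ser y)) n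
  refine mem_cochains_one_one.2 ⟨compatDefect_deg G n, X.vanish_one (fun y => ?_) fun y => ?_,
    fun u => X.positive_one (LinearMap.congr_fun h₁ u) (LinearMap.congr_fun h₂ u)⟩
  · simpa [st_ser] using congrFun (h.compatDefect_e_left (ser y)) n
  · simpa [st_ser] using congrFun (h.compatDefect_e_right (ser y)) n

theorem coassocDefect_mem (h : X.Normal G) (n : ℕ) : G.coassocDefect n ∈ cochains 𝒜 0 0 2 := by
  refine mem_cochains_zero_two.2 ⟨coassocDefect_deg G n, X.vanish_zero ?_, fun x =>
    X.positive_two ?_ ?_ ?_⟩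
  · simpa using congrFun h.coassocDefect_e n
  · simpa [app_const_apply] using congrFun (h.evL_coassocDefect (ser x)) n
  · simpa [one, const_tmap_const, app_const_apply] using congrFun (h.evM_coassocDefect (ser x)) n
  · simpa [one, const_tmap_const, app_const_apply] using congrFun (h.evR_coassocDefect (ser x)) n

theorem sum_eq_two_cases {P : ℕ → ℕ → ℕ → Prop} (h₁ : P 2 0 0) (h₂ : P 1 1 0) (h₃ : P 1 0 1)
    (h₄ : P 0 2 0) (h₅ : P 0 1 1) (h₆ : P 0 0 2) {p i j : ℕ} (hs : p + i + j = 2) : P p i j := by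
  have hp : p ≤ 2 := by omega
  have hi : i ≤ 2 := by omega
  obtain rfl : j = 2 - p - i := by omega
  interval_cases p <;> interval_cases i <;> first | assumption | omega

theorem obstruction_mem (h : X.Normal G) (n : ℕ) : obstruction G n ∈ totalCochains 𝒜 3 := by
  intro p i j
  refine ⟨?_, fun hs => famThree_eq_zero _ _ _ _ _ _ p i j (by omega)⟩
  rcases eq_or_ne (p + i + j) 2 with hs | hs
  · exact sum_eq_two_cases (P := fun p i j => obstruction G n p i j ∈ cochains 𝒜 p i j)
      (sqDefect_mem h n) (leibDefect_mem h n) (coleibDefect_mem h n)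
      (neg_mem (assocDefect_mem h n)) (compatDefect_mem h n) (coassocDefect_mem h n) hs
  · rw [obstruction, famThree_eq_zero _ _ _ _ _ _ p i j hs]; exact zero_mem _

/-! #### Normalized `2`-cochains -/

variable (X)

theorem pos₂_le_evL : pos₂ 𝒜 ≤ LinearMap.ker (evL H X.counit) :=
  Submodule.map₂_le.2 fun x hx y _ => by
    have : X.counit x = 0 := X.posPart_le_ker hx
    simp [this]

theorem pos₂_le_evR : pos₂ 𝒜 ≤ LinearMap.ker (evR H X.counit) :=
  Submodule.map₂_le.2 fun x _ y hy => by
    have : X.counit y = 0 := X.posPart_le_ker hy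
    simp [this]

theorem normalCoeff_of_isCochain {bd : H →ₗ[k] H} {bm : H ⊗[k] H →ₗ[k] H}
    {bc : H →ₗ[k] H ⊗[k] H} (hd : IsCochain 𝒜 𝒜 (𝒜 0) (posPart 𝒜) 1 bd)
    (hm : IsCochain (gt 𝒜 𝒜) 𝒜 (degen₂ 𝒜) (posPart 𝒜) 0 bm)
    (hc : IsCochain 𝒜 (gt 𝒜 𝒜) (𝒜 0) (pos₂ 𝒜) 0 bc) : X.NormalCoeff bd bm bc where
  d_e := hd.2.1 _ X.e_mem
  counit_d := LinearMap.ext fun x => X.posPart_le_ker (hd.2.2 x)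
  e_mul _ := hm.2.1 _ (Submodule.mem_sup_left
    (Submodule.apply_mem_map₂ _ X.e_mem Submodule.mem_top))
  mul_e _ := hm.2.1 _ (Submodule.mem_sup_right
    (Submodule.apply_mem_map₂ _ Submodule.mem_top X.e_mem))
  counit_mul := LinearMap.ext fun x => X.posPart_le_ker (hm.2.2 x)
  comul_e := hc.2.1 _ X.e_mem
  evL_comul := LinearMap.ext fun x => X.pos₂_le_evL (hc.2.2 x)
  evR_comul := LinearMap.ext fun x => X.pos₂_le_evR (hc.2.2 x)

theorem eq_famTwo {b : Family k H} (hb : ∀ p i j, p + i + j + 1 ≠ 2 → b p i j = 0) :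
    b = famTwo (b 1 0 0) (b 0 1 0) (b 0 0 1) := by
  funext p i j
  rcases p with _ | _ | p <;> rcases i with _ | _ | i <;> rcases j with _ | _ | j <;>
    first | rfl | exact hb _ _ _ (by omega)

end DGHopfAlgebra

/-! ### Construction of the series order by order -/

/-- The limit takes its `i`-th entry from the `i`-th stage, which later stages do not alter. Since
`P n` may depend on the whole sequence, the limit is only claimed to agree up to `n` with some
sequence that satisfies `P n`. -/
theorem exists_limit {α : Type*} {P : ℕ → (ℕ → α) → Prop} (h₀ : ∃ s, P 0 s)
    (h : ∀ n s, P n s → ∃ s', P (n + 1) s' ∧ ∀ i ≤ n, s' i = s i) :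
    ∃ s : ℕ → α, ∀ n, ∃ s', P n s' ∧ ∀ i ≤ n, s' i = s i := by
  obtain ⟨s₀, hs₀⟩ := h₀
  choose f hf hf' using h
  let g : ∀ n, {s // P n s} := fun n =>
    Nat.rec ⟨s₀, hs₀⟩ (fun n s => ⟨f n s.1 s.2, hf n s.1 s.2⟩) n
  have hg : ∀ n m, n ≤ m → ∀ i ≤ n, (g m).1 i = (g n).1 i := by
    intro n m hnm
    induction m, hnm using Nat.le_induction with
    | base => exact fun _ _ => rfl
    | succ m hm ih => exact fun i hi => (hf' m (g m).1 (g m).2 i (hi.trans hm)).trans (ih i hi)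
  exact ⟨fun i => (g i).1 i, fun n => ⟨(g n).1, (g n).2, fun i hi => hg i n hi i le_rfl⟩⟩

namespace DGHopfAlgebra

open FormalMap PreHopf

variable {k : Type u} [Field k] {H : Type v} [AddCommGroup H] [Module k H]
  {𝒜 : ℕ → Submodule k H} [DirectSum.Decomposition 𝒜] (X : DGHopfAlgebra 𝒜)

theorem isDeg_mul : IsDeg (gt 𝒜 𝒜) 𝒜 0 X.mul := by
  have key : ∀ (𝒢 : ℕ → Submodule k (H ⊗[k] H)) (s : H ⊗[k] H →ₗ[k] H ⊗[k] H),
      tensorGr 𝒜 1 = 𝒢 → (pair k H).symm.toLinearMap = s →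
      ∀ p, ∀ x ∈ 𝒢 p, X.mul (s x) ∈ 𝒜 p := by
    rintro _ _ rfl rfl; exact X.mul_deg
  exact key _ _ (tensorGr_one 𝒜) (pair_symm_eq k H)

theorem isDeg_comul : IsDeg 𝒜 (gt 𝒜 𝒜) 0 X.comul := by
  have key : ∀ (𝒢 : ℕ → Submodule k (H ⊗[k] H)) (s : H ⊗[k] H →ₗ[k] H ⊗[k] H),
      tensorGr 𝒜 1 = 𝒢 → (pair k H).toLinearMap = s →
      ∀ p, ∀ x ∈ 𝒜 p, s (X.comul x) ∈ 𝒢 p := by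
    rintro _ _ rfl rfl; exact X.comul_deg
  exact key _ _ (tensorGr_one 𝒜) (pair_eq k H)

/-- The constant series. -/
def toPreHopf : PreHopf 𝒜 where
  d := const X.d
  mul := const X.mul
  comul := const X.comul
  d_deg := FDeg.const X.d_deg
  mul_deg := FDeg.const X.isDeg_mul
  comul_deg := FDeg.const X.isDeg_comul

theorem toPreHopf_normal : X.Normal X.toPreHopf where
  d_zero := rfl
  mul_zero := rfl
  comul_zero := rfl
  coeff i hi := by
    simp only [toPreHopf, const_succ _ hi]
    constructor <;> simp

theorem toPreHopf_holdsAt (n : ℕ) : HoldsAt X.toPreHopf n where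
  sq := by simp [toPreHopf, sqDefect, const_comp_const, X.d_comp_d, const]
  leib := by
    simp only [toPreHopf, leibDefect, d2, one, const_tmap_const, const_comp_const, Pi.sub_apply]
    rw [X.d_mul, ← const_add, const_comp_const, sub_self]
  coleib := by
    simp only [toPreHopf, coleibDefect, d2, one, const_tmap_const, const_comp_const, Pi.sub_apply]
    rw [X.comul_d, ← const_add, const_comp_const, sub_self]
  assoc := by
    simp only [toPreHopf, assocDefect, one, const_tmap_const, const_comp_const, Pi.sub_apply]
    rw [← LinearMap.comp_assoc, X.mul_assoc, sub_eq_zero]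
    congr 1
    ext; simp
  compat := by
    simp only [toPreHopf, compatDefect, PreHopf.star, const_tmap_const, const_comp_const,
      Pi.sub_apply]
    rw [X.comul_mul, LinearMap.comp_assoc, sub_self]
  coassoc := by
    simp only [toPreHopf, coassocDefect, one, const_tmap_const, const_comp_const, Pi.sub_apply]
    rw [X.comul_coassoc, sub_self]

/-- Used at order `1` for the undeformed structure, where the condition `D b = obstruction` on the
prescribed coefficients becomes the cocycle condition. -/
theorem HoldsAt.obstruction_eq_zero {G : PreHopf 𝒜} {n : ℕ} (h : HoldsAt G n) :
    obstruction G n = 0 := by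
  funext p i j
  rw [obstruction, h.sq, h.leib, h.coleib, h.assoc, h.compat, h.coassoc, neg_zero]
  rcases p with _ | _ | _ | p <;> rcases i with _ | _ | _ | i <;> rcases j with _ | _ | _ | j <;>
    rfl

variable {X} {G : PreHopf 𝒜} {n : ℕ}

/-- Changing the coefficients at order `n` by a normalized cochain with prescribed differential. -/
theorem exists_correction_of_isCochain (h : X.Normal G) (hn : n ≠ 0) (hv : ∀ i < n, HoldsAt G i)
    {bd : H →ₗ[k] H} {bm : H ⊗[k] H →ₗ[k] H} {bc : H →ₗ[k] H ⊗[k] H}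
    (hd : IsCochain 𝒜 𝒜 (𝒜 0) (posPart 𝒜) 1 bd)
    (hm : IsCochain (gt 𝒜 𝒜) 𝒜 (degen₂ 𝒜) (posPart 𝒜) 0 bm)
    (hc : IsCochain 𝒜 (gt 𝒜 𝒜) (𝒜 0) (pos₂ 𝒜) 0 bc)
    (hD : X.D (famTwo bd bm bc) = obstruction G n) :
    ∃ G' : PreHopf 𝒜, X.Normal G' ∧ (∀ i ≤ n, HoldsAt G' i) ∧ Diff n G.d G'.d bd ∧
      Diff n G.mul G'.mul bm ∧ Diff n G.comul G'.comul bc := by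
  have hN := X.normalCoeff_of_isCochain hd hm hc
  have deg : ∀ {V W : Type v} [AddCommGroup V] [Module k V] [AddCommGroup W] [Module k W]
      {𝒢 : ℕ → Submodule k V} {ℋ : ℕ → Submodule k W} {p : ℕ} {f : FormalMap k V W}
      {a : V →ₗ[k] W}, FDeg 𝒢 ℋ p f → IsDeg 𝒢 ℋ p a →
      FDeg 𝒢 ℋ p (Function.update f n (f n + a)) := by
    intro V W _ _ _ _ 𝒢 ℋ p f a hf ha i
    rcases eq_or_ne i n with rfl | hi
    · rw [Function.update_self]; exact (hf i).add ha
    · rw [Function.update_of_ne hi]; exact hf i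
  have diff : ∀ {V W : Type v} [AddCommGroup V] [Module k V] [AddCommGroup W] [Module k W]
      (f : FormalMap k V W) (a : V →ₗ[k] W), Diff n f (Function.update f n (f n + a)) a :=
    fun f a => ⟨fun i hi => Function.update_of_ne hi.ne _ _, Function.update_self _ _ _⟩
  let G' : PreHopf 𝒜 :=
    { d := Function.update G.d n (G.d n + bd)
      mul := Function.update G.mul n (G.mul n + bm)
      comul := Function.update G.comul n (G.comul n + bc)
      d_deg := deg G.d_deg hd.1
      mul_deg := deg G.mul_deg hm.1
      comul_deg := deg G.comul_deg hc.1 }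
  have hd' : Diff n G.d G'.d bd := diff _ _
  have hm' : Diff n G.mul G'.mul bm := diff _ _
  have hc' : Diff n G.comul G'.comul bc := diff _ _
  refine ⟨G', ⟨⟨?_, ?_, ?_⟩, fun i hi => ?_⟩, fun i hi => ?_, hd', hm', hc'⟩
  · rw [← h.d_zero]; exact hd'.1 0 (Nat.pos_of_ne_zero hn)
  · rw [← h.mul_zero]; exact hm'.1 0 (Nat.pos_of_ne_zero hn)
  · rw [← h.comul_zero]; exact hc'.1 0 (Nat.pos_of_ne_zero hn)
  · rcases eq_or_ne i n with rfl | hin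
    · have := h.coeff i hi
      rw [hd'.2, hm'.2, hc'.2]
      exact ⟨by simp [this.d_e, hN.d_e], by simp [LinearMap.comp_add, this.counit_d, hN.counit_d],
        fun y => by simp [this.e_mul, hN.e_mul], fun y => by simp [this.mul_e, hN.mul_e],
        by simp [LinearMap.comp_add, this.counit_mul, hN.counit_mul],
        by simp [this.comul_e, hN.comul_e],
        by simp [LinearMap.comp_add, this.evL_comul, hN.evL_comul],
        by simp [LinearMap.comp_add, this.evR_comul, hN.evR_comul]⟩
    · simpa only [G', Function.update_of_ne hin] using h.coeff i hi
  -- Below `n` the coefficients are unchanged, so the axioms carry over; at order `n` the hypothesis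
  -- on `D` applies.
  · rcases hi.lt_or_eq with hi | rfl
    · exact (hv i hi).congr (fun j hj => (hd'.1 j (hj.trans_lt hi)).symm)
        (fun j hj => (hm'.1 j (hj.trans_lt hi)).symm) fun j hj => (hc'.1 j (hj.trans_lt hi)).symm
    · exact holdsAt_of_D_eq_obstruction h.toLifts hn hd' hm' hc' hD

theorem exists_correction (h : X.Normal G) (hn : n ≠ 0) (hv : ∀ i < n, HoldsAt G i)
    {b : Family k H} (hb : b ∈ totalCochains 𝒜 2) (hD : X.D b = obstruction G n) :
    ∃ G' : PreHopf 𝒜, X.Normal G' ∧ (∀ i ≤ n, HoldsAt G' i) ∧ Diff n G.d G'.d (b 1 0 0) ∧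
      Diff n G.mul G'.mul (b 0 1 0) ∧ Diff n G.comul G'.comul (b 0 0 1) :=
  exists_correction_of_isCochain h hn hv (mem_cochains_zero_zero.1 (hb 1 0 0).1)
    (mem_cochains_one_zero.1 (hb 0 1 0).1) (mem_cochains_zero_one.1 (hb 0 0 1).1)
    (by rw [← hD]; exact congrArg X.D (eq_famTwo fun p i j => (hb p i j).2).symm)

theorem exists_obstruction_eq (hX : Subsingleton (X.Cohomology 3)) (h : X.Normal G)
    (hv : ∀ i < n, HoldsAt G i) : ∃ b ∈ totalCochains 𝒜 2, X.D b = obstruction G n := by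
  have hz : obstruction G n ∈ X.cocycles 3 := ⟨obstruction_mem h n, D_obstruction h.toLifts hv⟩
  have : (Submodule.Quotient.mk ⟨_, hz⟩ : X.Cohomology 3) = 0 := Subsingleton.elim _ _
  rw [Submodule.Quotient.mk_eq_zero] at this
  -- The truncated difference `3 - 1` in `coboundaries` reduces to `2`, so membership unfolds to the
  -- claim.
  exact this

/-- A formal differential graded bialgebra with the given coefficients of order `1`. -/
theorem exists_bialgebra (hX : Subsingleton (X.Cohomology 3)) (d₁ : H →ₗ[k] H)
    (μ₁ : H ⊗[k] H →ₗ[k] H) (Δ₁ : H →ₗ[k] H ⊗[k] H) (hc : infinitesimal k H d₁ μ₁ Δ₁ ∈ X.cocycles 2) :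
    ∃ G : PreHopf 𝒜, X.Normal G ∧ (∀ n, HoldsAt G n) ∧ G.d 1 = d₁ ∧ G.mul 1 = μ₁ ∧
      G.comul 1 = Δ₁ := by
  rw [infinitesimal_eq] at hc
  -- The three series are bundled into one sequence of triples, to which `exists_limit` applies.
  -- Stage `n` is correct up to order `n + 1`, as the first stage must already contain the
  -- prescribed coefficients of order `1`.
  let P : ℕ → (ℕ → (H →ₗ[k] H) × (H ⊗[k] H →ₗ[k] H) × (H →ₗ[k] H ⊗[k] H)) → Prop := fun n s =>
    ∃ G : PreHopf 𝒜, (X.Normal G ∧ (∀ i ≤ n + 1, HoldsAt G i) ∧ G.d 1 = d₁ ∧ G.mul 1 = μ₁ ∧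
      G.comul 1 = Δ₁) ∧ ∀ i, s i = (G.d i, G.mul i, G.comul i)
  obtain ⟨s, hs⟩ : ∃ s : ℕ → (H →ₗ[k] H) × (H ⊗[k] H →ₗ[k] H) × (H →ₗ[k] H ⊗[k] H),
      ∀ n, ∃ s', P n s' ∧ ∀ i ≤ n, s' i = s i := by
    refine exists_limit ?_ ?_
    -- The first stage corrects the constant structure at order `1` by the given cocycle.
    · obtain ⟨G, hG, hv, hd, hm, hc'⟩ := exists_correction X.toPreHopf_normal one_ne_zero
        (fun i _ => X.toPreHopf_holdsAt i) hc.1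
        (hc.2.trans (X.toPreHopf_holdsAt 1).obstruction_eq_zero.symm)
      refine ⟨_, G, ⟨hG, hv, ?_, ?_, ?_⟩, fun i => rfl⟩
      · rw [hd.2]; exact (congrArg (· + d₁) (const_succ X.d one_ne_zero)).trans (zero_add _)
      · rw [hm.2]; exact (congrArg (· + μ₁) (const_succ X.mul one_ne_zero)).trans (zero_add _)
      · rw [hc'.2]; exact (congrArg (· + Δ₁) (const_succ X.comul one_ne_zero)).trans (zero_add _)
    · rintro n s ⟨G, ⟨hG, hv, h₁, h₂, h₃⟩, hs⟩
      have hv' : ∀ i < n + 2, HoldsAt G i := fun i hi => hv i (by omega)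
      -- The correction takes place at order `n + 2`, beyond the prescribed order `1`.
      obtain ⟨b, hb, hD⟩ := exists_obstruction_eq hX hG hv'
      obtain ⟨G', hG', hv'', hd, hm, hc'⟩ := exists_correction hG (by omega) hv' hb hD
      refine ⟨fun i => (G'.d i, G'.mul i, G'.comul i), ⟨G', ⟨hG', hv'', ?_, ?_, ?_⟩,
        fun i => rfl⟩, fun i hi => ?_⟩
      · rw [hd.1 1 (by omega), h₁]
      · rw [hm.1 1 (by omega), h₂]
      · rw [hc'.1 1 (by omega), h₃]
      · simp only [hs, hd.1 i (by omega : i < n + 2), hm.1 i (by omega : i < n + 2),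
          hc'.1 i (by omega : i < n + 2)]
  choose s' hs' hss using hs
  choose g hg hgs using hs'
  have hgs' : ∀ n, ∀ i ≤ n, s i = ((g n).d i, (g n).mul i, (g n).comul i) := fun n i hi => by
    rw [← hss n i hi, hgs n i]
  let G : PreHopf 𝒜 :=
    { d := fun i => (s i).1
      mul := fun i => (s i).2.1
      comul := fun i => (s i).2.2
      d_deg := fun i => by simp only [hgs' i i le_rfl]; exact (g i).d_deg i
      mul_deg := fun i => by simp only [hgs' i i le_rfl]; exact (g i).mul_deg i
      comul_deg := fun i => by simp only [hgs' i i le_rfl]; exact (g i).comul_deg i }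
  have hd : ∀ n, EqTo n (g n).d G.d := fun n i hi => by simp only [G, hgs' n i hi]
  have hm : ∀ n, EqTo n (g n).mul G.mul := fun n i hi => by simp only [G, hgs' n i hi]
  have hc' : ∀ n, EqTo n (g n).comul G.comul := fun n i hi => by simp only [G, hgs' n i hi]
  refine ⟨G, ⟨⟨?_, ?_, ?_⟩, fun i hi => ?_⟩, fun n => ?_, ?_, ?_, ?_⟩
  · rw [← hd 0 0 le_rfl, (hg 0).1.d_zero]
  · rw [← hm 0 0 le_rfl, (hg 0).1.mul_zero]
  · rw [← hc' 0 0 le_rfl, (hg 0).1.comul_zero]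
  · rw [← hd i i le_rfl, ← hm i i le_rfl, ← hc' i i le_rfl]; exact (hg i).1.coeff i hi
  -- The axioms at order `n` see only coefficients up to order `n`, where the limit agrees with
  -- stage `n`.
  · exact ((hg n).2.1 n n.le_succ).congr (hd n) (hm n) (hc' n)
  · rw [← hd 1 1 le_rfl, (hg 1).2.2.1]
  · rw [← hm 1 1 le_rfl, (hg 1).2.2.2.1]
  · rw [← hc' 1 1 le_rfl, (hg 1).2.2.2.2]

end DGHopfAlgebra

/-! ### Convolution -/

namespace FormalMap

variable {k : Type u} [Field k] {C H V W U : Type*} [AddCommGroup C] [Module k C] [AddCommGroup H]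
  [Module k H] [AddCommGroup V] [Module k V] [AddCommGroup W] [Module k W] [AddCommGroup U]
  [Module k U]

theorem ext₂ {f g : FormalMap k (V ⊗[k] W) U}
    (h : ∀ x y, app f (st k x y) = app g (st k x y)) : f = g :=
  ((gen_true (V := V)).tmul (gen_true (V := W))).ext fun _ ⟨x, y, _, _, e⟩ => e ▸ h x y

theorem ext₂₁ {V' : Type*} [AddCommGroup V'] [Module k V'] {f g : FormalMap k ((V ⊗[k] V') ⊗[k] W) U}
    (h : ∀ x y z, app f (st k (st k x y) z) = app g (st k (st k x y) z)) : f = g :=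
  (((gen_true (V := V)).tmul (gen_true (V := V'))).tmul (gen_true (V := W))).ext
    fun _ ⟨_, z, ⟨x, y, _, _, e⟩, _, e'⟩ => by subst e e'; exact h x y z

/-- The convolution of two maps from a coalgebra to an algebra. -/
def conv (m : FormalMap k (H ⊗[k] H) H) (δ : FormalMap k C (C ⊗[k] C)) (f g : FormalMap k C H) :
    FormalMap k C H := m ⊚ (f ⊠ g) ⊚ δ

variable {m : FormalMap k (H ⊗[k] H) H} {δ : FormalMap k C (C ⊗[k] C)}

theorem app_conv (f g : FormalMap k C H) (x : ℕ → C) :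
    app (conv m δ f g) x = app m (app (f ⊠ g) (app δ x)) := by
  rw [conv, app_comp, app_comp]

/-- Values of `δ` are not pure tensors, so the argument is split into identities of maps on tensor
products, tested on pure tensors, and then applied to the values of `δ`, where coassociativity
enters. -/
theorem conv_assoc
    (hm : ∀ x y z, app m (st k (app m (st k x y)) z) = app m (st k x (app m (st k y z))))
    (hδ : const (TensorProduct.assoc k C C C).toLinearMap ⊚ (δ ⊠ one) ⊚ δ = (one ⊠ δ) ⊚ δ)
    (f g h : FormalMap k C H) : conv m δ (conv m δ f g) h = conv m δ f (conv m δ g h) := by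
  have h₁ : m ⊚ (conv m δ f g ⊠ h) = (m ⊚ (m ⊠ one) ⊚ ((f ⊠ g) ⊠ h)) ⊚ (δ ⊠ one) :=
    ext₂ fun x y => by simp [conv]
  have h₂ : m ⊚ (f ⊠ conv m δ g h) = (m ⊚ (one ⊠ m) ⊚ (f ⊠ (g ⊠ h))) ⊚ (one ⊠ δ) :=
    ext₂ fun x y => by simp [conv]
  have h₃ : m ⊚ (m ⊠ one) ⊚ ((f ⊠ g) ⊠ h) =
      (m ⊚ (one ⊠ m) ⊚ (f ⊠ (g ⊠ h))) ⊚ const (TensorProduct.assoc k C C C).toLinearMap :=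
    ext₂₁ fun x y z => by simp [hm]
  refine ext_app fun x => ?_
  have e₁ := congrArg (fun φ => app φ (app δ x)) h₁
  have e₂ := congrArg (fun φ => app φ (app δ x)) h₂
  have e₃ := congrArg (fun φ => app φ (app (δ ⊠ one) (app δ x))) h₃
  have e₄ := congrArg (fun φ => app φ x) hδ
  simp only [app_comp] at e₁ e₂ e₃ e₄
  rw [app_conv, app_conv, e₁, e₃, e₄, e₂]

theorem conv_zero (f g : FormalMap k C H) :
    conv m δ f g 0 = m 0 ∘ₗ TensorProduct.map (f 0) (g 0) ∘ₗ δ 0 := by simp [conv]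

theorem conv_diff {n : ℕ} (hn : n ≠ 0) {f f' : FormalMap k C H} {b : C →ₗ[k] H}
    (h : Diff n f f' b) (g : FormalMap k C H) : Diff n (conv m δ f g) (conv m δ f' g)
      (m 0 ∘ₗ TensorProduct.map b (g 0) ∘ₗ δ 0) := by
  have := Diff.comp hn (Diff.refl m) (Diff.comp hn (Diff.tmap hn h (Diff.refl g)) (Diff.refl δ))
  simpa [conv] using this

variable {e : H} {κ : C →ₗ[k] k}

theorem app_smulRight (y : ℕ → C) :
    app (const (κ.smulRight e)) y = sm (app (const κ) y) (ser e) := by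
  rw [← app_rid, ← app_const_mk, ← app_comp, ← app_comp, const_comp_const, const_comp_const]
  congr 2

theorem conv_counit (he : ∀ x, app m (st k x (ser e)) = x)
    (hκ : ∀ x, app (const (evR C κ)) (app δ x) = x) (f : FormalMap k C H) :
    conv m δ f (const (κ.smulRight e)) = f := by
  have h₁ : m ⊚ (f ⊠ const (κ.smulRight e)) = f ⊚ const (evR C κ) := ext₂ fun x y => by
    rw [app_comp, app_tmap, app_smulRight, st_sm_right, app_sm, he, app_comp, app_evR, app_sm]
  refine ext_app fun x => ?_
  have e₁ := congrArg (fun φ => app φ (app δ x)) h₁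
  simp only [app_comp] at e₁
  rw [app_conv, e₁, hκ]

theorem counit_conv (he : ∀ x, app m (st k (ser e) x) = x)
    (hκ : ∀ x, app (const (evL C κ)) (app δ x) = x) (f : FormalMap k C H) :
    conv m δ (const (κ.smulRight e)) f = f := by
  have h₁ : m ⊚ (const (κ.smulRight e) ⊠ f) = f ⊚ const (evL C κ) := ext₂ fun x y => by
    rw [app_comp, app_tmap, app_smulRight, st_sm_left, app_sm, he, app_comp, app_evL, app_sm]
  refine ext_app fun x => ?_
  have e₁ := congrArg (fun φ => app φ (app δ x)) h₁
  simp only [app_comp] at e₁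
  rw [app_conv, e₁, hκ]

end FormalMap

/-! ### The coalgebra `H ⊗ H` -/

namespace PreHopf

open FormalMap

variable {k : Type u} [Field k] {H : Type v} [AddCommGroup H] [Module k H]
  {𝒜 : ℕ → Submodule k H} [DirectSum.Decomposition 𝒜] (G : PreHopf 𝒜)

/-- The coproduct of `H ⊗ H`. -/
def comul2 : FormalMap k (H ⊗[k] H) ((H ⊗[k] H) ⊗[k] (H ⊗[k] H)) :=
  const (midSwap 𝒜 H H) ⊚ (G.comul ⊠ G.comul)

theorem comul2_right : (one ⊠ G.comul2) ⊚ const (midSwap 𝒜 H H) =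
    (one ⊠ const (midSwap 𝒜 H H)) ⊚ blockSwapL 𝒜 (H ⊗[k] H) ⊚
      ((one ⊠ G.comul) ⊠ (one ⊠ G.comul)) :=
  hext₂₂ 𝒜 fun p q r s a b c e ha hb hc he => by
    simp only [app_comp, app_tmap, app_one, comul2, app_midSwap a e hb hc, map_smul,
      app_blockSwapL a _ (G.homog_comul hb) hc]

theorem comul2_left : (G.comul2 ⊠ one) ⊚ const (midSwap 𝒜 H H) =
    (const (midSwap 𝒜 H H) ⊠ one) ⊚ blockSwapR 𝒜 (H ⊗[k] H) ⊚
      ((G.comul ⊠ one) ⊠ (G.comul ⊠ one)) :=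
  hext₂₂ 𝒜 fun p q r s a b c e ha hb hc he => by
    simp only [app_comp, app_tmap, app_one, comul2, app_midSwap a e hb hc, map_smul,
      app_blockSwapR _ e hb (G.homog_comul hc)]

theorem midSwap_blockSwap :
    (one ⊠ const (midSwap 𝒜 H H)) ⊚ blockSwapL 𝒜 (H ⊗[k] H) ⊚ (asc H H H ⊠ asc H H H) =
      asc (H ⊗[k] H) (H ⊗[k] H) (H ⊗[k] H) ⊚
        (const (midSwap 𝒜 H H) ⊠ one) ⊚ blockSwapR 𝒜 (H ⊗[k] H) := by
  refine ((((gen_homog 𝒜).tmul (gen_homog 𝒜)).tmul (gen_homog 𝒜)).tmul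
    (((gen_homog 𝒜).tmul (gen_homog 𝒜)).tmul (gen_homog 𝒜))).ext ?_
  rintro _ ⟨_, _, ⟨_, c, ⟨a, b, -, ⟨q, hb⟩, rfl⟩, ⟨r, hc⟩, rfl⟩,
    ⟨_, j, ⟨e, i, ⟨s, he⟩, ⟨l, hi⟩, rfl⟩, -, rfl⟩, rfl⟩
  simp only [app_comp, app_tmap, app_one, app_assoc,
    app_blockSwapL_tmul _ _ hb hc he, app_blockSwapR_tmul _ _ hc he hi, map_smul,
    app_midSwap _ _ hc hi, app_midSwap _ _ hb he, st_smul_left, st_smul_right, smul_smul, add_mul,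
    mul_add, pow_add]
  congr 1
  ring

/-- Each iterated coproduct of `x ⊗ y` consists of the iterated coproducts of `x` and `y` followed
by a signed shuffle. The shuffles agree by `midSwap_blockSwap`, which leaves coassociativity of `H`
in both arguments. -/
theorem comul2_coassoc
    (h : asc H H H ⊚ (G.comul ⊠ one) ⊚ G.comul = (one ⊠ G.comul) ⊚ G.comul) :
    asc (H ⊗[k] H) (H ⊗[k] H) (H ⊗[k] H) ⊚ (G.comul2 ⊠ one) ⊚ G.comul2 =
      (one ⊠ G.comul2) ⊚ G.comul2 := by
  refine ext₂ fun x y => ?_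
  have h₁ := congrArg (fun f => app f (st k (app G.comul x) (app G.comul y))) G.comul2_right
  have h₂ := congrArg (fun f => app f (st k (app G.comul x) (app G.comul y))) G.comul2_left
  have h₃ := congrArg (fun f => app f (st k (app (G.comul ⊠ one) (app G.comul x))
    (app (G.comul ⊠ one) (app G.comul y)))) (midSwap_blockSwap (𝒜 := 𝒜))
  have hx := congrArg (fun f => app f x) h
  have hy := congrArg (fun f => app f y) h
  have e : ∀ u, app G.comul2 u = app (const (midSwap 𝒜 H H)) (app (G.comul ⊠ G.comul) u) :=
    fun u => by rw [comul2, app_comp]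
  simp only [app_comp, app_tmap] at h₁ h₂ h₃ hx hy
  rw [app_comp, app_comp, app_comp, e (st k x y), app_tmap, h₁, h₂, ← hx, ← hy, h₃]

end PreHopf

/-! ### The antipode -/

namespace DGHopfAlgebra

open FormalMap PreHopf

variable {k : Type u} [Field k] {H : Type v} [AddCommGroup H] [Module k H]
  {𝒜 : ℕ → Submodule k H} [DirectSum.Decomposition 𝒜] {X : DGHopfAlgebra 𝒜} {G : PreHopf 𝒜}

theorem unit_comp_counit : X.unit ∘ₗ X.counit = X.counit.smulRight X.e :=
  LinearMap.ext fun _ => X.unit_eq _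

theorem mul_mul_of_holdsAt (hv : ∀ n, HoldsAt G n) (x y z : ℕ → H) :
    app G.mul (st k (app G.mul (st k x y)) z) = app G.mul (st k x (app G.mul (st k y z))) := by
  have h : G.assocDefect = 0 := funext fun n => (hv n).assoc
  have := congrArg (fun f => app f (st k x (st k y z))) h
  simpa [assocDefect, sub_eq_zero] using this

theorem comul_coassoc_of_holdsAt (hv : ∀ n, HoldsAt G n) :
    asc H H H ⊚ (G.comul ⊠ one) ⊚ G.comul = (one ⊠ G.comul) ⊚ G.comul :=
  sub_eq_zero.1 (funext fun n => (hv n).coassoc)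

theorem comul_mul_of_holdsAt (hv : ∀ n, HoldsAt G n) :
    G.comul ⊚ G.mul = (G.mul ⊠ G.mul) ⊚ G.comul2 := by
  have h : G.compatDefect = 0 := funext fun n => (hv n).compat
  refine (sub_eq_zero.1 h).trans (ext_app fun x => ?_)
  simp [PreHopf.star, comul2]

/-- A left inverse modulo `t` lifts to a left inverse: each error of order `n + 1` is removed by
changing the coefficient of that order. -/
theorem conv_left_inverse (hG : X.Normal G) (hv : ∀ n, HoldsAt G n) {f : FormalMap k H H}
    (hf : FDeg 𝒜 𝒜 0 f) {s : H →ₗ[k] H} (hs : IsDeg 𝒜 𝒜 0 s)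
    (h : G.mul 0 ∘ₗ TensorProduct.map s (f 0) ∘ₗ G.comul 0 = X.counit.smulRight X.e) :
    ∃ L : FormalMap k H H, FDeg 𝒜 𝒜 0 L ∧ L 0 = s ∧
      conv G.mul G.comul L f = const (X.counit.smulRight X.e) := by
  have hconv : ∀ {a b : FormalMap k H H}, FDeg 𝒜 𝒜 0 a → FDeg 𝒜 𝒜 0 b →
      FDeg 𝒜 𝒜 0 (conv G.mul G.comul a b) := fun ha hb =>
    FDeg.comp (p := 0) (q := 0) G.mul_deg (FDeg.comp (p := 0) (q := 0)
      (FDeg.tmap (p := 0) (q := 0) ha hb) G.comul_deg)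
  obtain ⟨L, hL⟩ := exists_limit (P := fun n (L : ℕ → (H →ₗ[k] H)) => FDeg 𝒜 𝒜 0 L ∧ L 0 = s ∧
      EqTo n (conv G.mul G.comul L f) (const (X.counit.smulRight X.e))) (by
    refine ⟨const s, FDeg.const hs, rfl, fun i hi => ?_⟩
    obtain rfl : i = 0 := by omega
    rw [conv_zero, const_zero, const_zero, h]) (by
    rintro n L ⟨hd, h0, he⟩
    let E := conv G.mul G.comul L f (n + 1)
    -- The correction is `-E * s` in the convolution of the constant terms. As `s` is a left inverse
    -- of `f 0`, associativity gives `b * f 0 = -E`.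
    let b := -(conv G.mul G.comul (const E) (const s) 0)
    have hE : IsDeg 𝒜 𝒜 0 E := hconv hd hf (n + 1)
    have hb : IsDeg 𝒜 𝒜 0 b := (hconv (FDeg.const hE) (FDeg.const hs) 0).neg
    have hbf : G.mul 0 ∘ₗ TensorProduct.map b (f 0) ∘ₗ G.comul 0 = -E := by
      have e := congrFun (conv_assoc (mul_mul_of_holdsAt hv) (comul_coassoc_of_holdsAt hv) (const E) (const s)
        (const (f 0))) 0
      have e' := congrFun (conv_counit hG.mul_e hG.evR_comul (const E)) 0
      simp only [conv_zero, const_zero] at e e'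
      rw [h, e'] at e
      simp only [b, conv_zero, const_zero, map_neg_left, LinearMap.neg_comp, LinearMap.comp_neg, e]
    have hD : Diff (n + 1) L (Function.update L (n + 1) (L (n + 1) + b)) b :=
      ⟨fun i hi => Function.update_of_ne hi.ne _ _, Function.update_self _ _ _⟩
    have hc := conv_diff (m := G.mul) (δ := G.comul) n.succ_ne_zero hD f
    refine ⟨Function.update L (n + 1) (L (n + 1) + b), ⟨fun i => ?_, ?_, fun i hi => ?_⟩,
      fun i hi => hD.1 i (by omega)⟩
    · rcases eq_or_ne i (n + 1) with rfl | hi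
      · rw [Function.update_self]; exact (hd _).add hb
      · rw [Function.update_of_ne hi]; exact hd i
    · rw [Function.update_of_ne n.succ_ne_zero.symm, h0]
    · rcases hi.lt_or_eq with hi | rfl
      · rw [hc.1 i hi, he i (by omega)]
      · rw [hc.2, hbf, const_succ _ n.succ_ne_zero]; exact add_neg_cancel _)
  refine ⟨L, fun n => ?_, ?_, funext fun n => ?_⟩
  · obtain ⟨L', h', e⟩ := hL n
    rw [← e n le_rfl]; exact h'.1 n
  · obtain ⟨L', h', e⟩ := hL 0
    rw [← e 0 le_rfl]; exact h'.2.1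
  · obtain ⟨L', h', e⟩ := hL n
    rw [← h'.2.2 n le_rfl]
    exact ((EqTo.refl _).comp ((EqTo.tmap (fun i hi => (e i hi).symm) (EqTo.refl f)).comp
      (EqTo.refl _))) n le_rfl

/-- As for monoids: if `L` is a left inverse of the identity map and `M` is a left inverse of `L`,
then `M` equals the identity map, so `L` is a two-sided inverse. -/
theorem exists_antipode (hG : X.Normal G) (hv : ∀ n, HoldsAt G n) :
    ∃ S : FormalMap k H H, FDeg 𝒜 𝒜 0 S ∧
      conv G.mul G.comul S one = const (X.counit.smulRight X.e) ∧
      conv G.mul G.comul one S = const (X.counit.smulRight X.e) := by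
  obtain ⟨L, hL, hL0, hL1⟩ := conv_left_inverse hG hv FDeg.one (s := X.antipode) X.antipode_deg (by
    rw [hG.mul_zero, hG.comul_zero, one_zero, X.antipode_left, unit_comp_counit])
  -- Modulo `t` the series `L` is the antipode of `X`, of which the identity is a left convolution
  -- inverse.
  obtain ⟨M, -, -, hM⟩ := conv_left_inverse hG hv hL (s := LinearMap.id) IsDeg.id (by
    rw [hL0, hG.mul_zero, hG.comul_zero, X.antipode_right, unit_comp_counit])
  have hM1 : M = one := by
    have := conv_assoc (mul_mul_of_holdsAt hv) (comul_coassoc_of_holdsAt hv) M L one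
    rwa [hM, hL1, counit_conv hG.e_mul hG.evL_comul, conv_counit hG.mul_e hG.evR_comul, eq_comm]
      at this
  exact ⟨L, hL, hL1, hM1 ▸ hM⟩

/-- The counit of `H ⊗ H`. -/
def counit2 (X : DGHopfAlgebra 𝒜) : H ⊗[k] H →ₗ[k] k :=
  (TensorProduct.lid k k).toLinearMap ∘ₗ TensorProduct.map X.counit X.counit

theorem app_counit2 (x y : ℕ → H) : app (const X.counit2) (st k x y) =
    sm (app (const X.counit) x) (app (const X.counit) y) := by
  rw [counit2, ← const_comp_const, ← const_tmap_const, app_comp, app_tmap, app_lid]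

theorem evL_comul2 (hG : X.Normal G) (u : ℕ → H ⊗[k] H) :
    app (const (evL (H ⊗[k] H) X.counit2)) (app G.comul2 u) = u := by
  have h : const (evL (H ⊗[k] H) X.counit2) ⊚ const (midSwap 𝒜 H H) =
      const (evL H X.counit) ⊠ const (evL H X.counit) :=
    hext₂₂ 𝒜 fun p q r s a b c e ha hb hc he => by
      rw [app_comp, app_midSwap a e hb hc, map_smul, app_evL, app_counit2, app_tmap, app_evL,
        app_evL, st_sm_left, st_sm_right, sm_sm]
      rcases eq_or_ne r 0 with rfl | hr
      · simp
      · simp [Normal.counit_homog hr hc]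
  rw [← app_comp]
  suffices e : const (evL (H ⊗[k] H) X.counit2) ⊚ G.comul2 = one by rw [e, app_one]
  refine ext₂ fun x y => ?_
  rw [app_comp, comul2, app_comp, ← app_comp (const _) (const _), h]
  simp [hG.evL_comul]

theorem evR_comul2 (hG : X.Normal G) (u : ℕ → H ⊗[k] H) :
    app (const (evR (H ⊗[k] H) X.counit2)) (app G.comul2 u) = u := by
  have h : const (evR (H ⊗[k] H) X.counit2) ⊚ const (midSwap 𝒜 H H) =
      const (evR H X.counit) ⊠ const (evR H X.counit) :=
    hext₂₂ 𝒜 fun p q r s a b c e ha hb hc he => by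
      rw [app_comp, app_midSwap a e hb hc, map_smul, app_evR, app_counit2, app_tmap, app_evR,
        app_evR, st_sm_left, st_sm_right, sm_sm]
      rcases eq_or_ne q 0 with rfl | hr
      · simp
      · simp [Normal.counit_homog hr hb]
  rw [← app_comp]
  suffices e : const (evR (H ⊗[k] H) X.counit2) ⊚ G.comul2 = one by rw [e, app_one]
  refine ext₂ fun x y => ?_
  rw [app_comp, comul2, app_comp, ← app_comp (const _) (const _), h]
  simp [hG.evR_comul]

variable {S : FormalMap k H H}

/-- The product is a coalgebra map, so `(S ∘ μ) * μ` is `(S * 1) ∘ μ`. -/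
theorem conv_antipode_mul (hG : X.Normal G) (hv : ∀ n, HoldsAt G n)
    (hS : conv G.mul G.comul S one = const (X.counit.smulRight X.e)) :
    conv G.mul G.comul2 (S ⊚ G.mul) G.mul = const (X.counit2.smulRight X.e) := by
  refine ext₂ fun x y => ?_
  have h : (S ⊚ G.mul) ⊠ G.mul = (S ⊠ one) ⊚ (G.mul ⊠ G.mul) := ext₂ fun x y => by simp
  have h' := congrArg (fun f => app f (st k x y)) (comul_mul_of_holdsAt hv)
  have h'' := congrArg (fun f => app f (app G.mul (st k x y))) hS
  simp only [app_comp] at h' h''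
  rw [app_conv, h, app_comp, ← h', ← app_conv, h'', app_smulRight, app_smulRight, hG.counit_mul,
    app_counit2]

/-- In Sweedler notation, up to signs, the left side is `x₁ y₁ S(y₂) S(x₂)`: the two inner factors
collapse to the counit of `y`, and then the outer ones to that of `x`. -/
theorem conv_mul_antipode (hG : X.Normal G) (hv : ∀ n, HoldsAt G n) (hSd : FDeg 𝒜 𝒜 0 S)
    (hS : conv G.mul G.comul one S = const (X.counit.smulRight X.e)) :
    conv G.mul G.comul2 G.mul (G.mul ⊚ const (swap 𝒜) ⊚ (S ⊠ S)) =
      const (X.counit2.smulRight X.e) := by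
  refine hext₂ 𝒜 fun p q x y hx hy => ?_
  have hS' : ∀ z, app G.mul (app (one ⊠ S) (app G.comul z)) =
      sm (app (const X.counit) z) (ser X.e) := fun z => by
    rw [← app_conv, hS, app_smulRight]
  let Φ := G.mul ⊚ (G.mul ⊠ (G.mul ⊚ const (swap 𝒜) ⊚ (S ⊠ S))) ⊚ const (midSwap 𝒜 H H)
  have hSh : ∀ {r : ℕ} {b : ℕ → H}, Homog 𝒜 r b → Homog 𝒜 r (app S b) := fun hb => hb.app hSd
  -- With `a ⊗ b` in the role of `Δ x` and `w` in that of `Δ y`: the signs of `midSwap` and `swap`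
  -- combine into one that depends only on the total degree of `w`, so `w` need not be a pure
  -- tensor.
  have h₁ : ∀ (r s : ℕ) (a b : ℕ → H) (w : ℕ → H ⊗[k] H), Homog 𝒜 r b → Homog (gt 𝒜 𝒜) s w →
      app Φ (st k (st k a b) w) = (-1 : k) ^ (r * s) •
        app G.mul (st k a (app G.mul (st k (app G.mul (app (one ⊠ S) w)) (app S b)))) := by
    intro r s a b w hb hw
    have := Homog.ext_gt (s := s) (f := Φ ⊚ insL _ (st k a b))
      (g := (-1 : k) ^ (r * s) • (G.mul ⊚ insL _ a ⊚ G.mul ⊚ insR _ (app S b) ⊚ G.mul ⊚ (one ⊠ S)))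
      (fun i j hij c e hc he => by
        subst hij
        simp only [Φ, app_comp, app_insL, app_insR, app_smul, app_tmap, app_one,
          app_midSwap a e hb hc, map_smul, app_swap (hSh hb) (hSh he), st_smul_right, smul_smul,
          mul_mul_of_holdsAt hv, mul_add, pow_add]) hw
    simpa only [app_comp, app_insL, app_insR, app_smul] using this
  have h₂ : ∀ u, app Φ (st k u (app G.comul y)) =
      sm (app (const X.counit) y) (app G.mul (app (one ⊠ S) u)) := by
    intro u
    have : Φ ⊚ insR _ (app G.comul y) =
        (const (TensorProduct.lid k H).toLinearMap ⊚ insL _ (app (const X.counit) y)) ⊚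
          G.mul ⊚ (one ⊠ S) := by
      refine hext₂ 𝒜 fun r s a b ha hb => ?_
      simp only [app_comp, app_insR, app_insL, app_lid, app_tmap, app_one]
      rw [h₁ s q a b _ hb (G.homog_comul hy), hS', st_sm_left, app_sm, hG.e_mul, st_sm_right,
        app_sm]
      -- The counit of `y` is nonzero only in degree `0`, where the sign is `1`.
      rcases eq_or_ne q 0 with rfl | hq
      · simp
      · simp [Normal.counit_homog hq hy]
    have := congrArg (fun f => app f u) this
    simpa only [app_comp, app_insR, app_insL, app_lid] using this
  rw [app_conv, comul2, app_comp, app_tmap]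
  have h₃ := h₂ (app G.comul x)
  simp only [Φ, app_comp] at h₃
  rw [h₃, hS', app_smulRight, app_counit2, ← sm_sm, sm_comm]

/-- The two sides are a left and a right convolution inverse of `μ` among the maps `H ⊗ H → H`,
hence equal. -/
theorem antipode_comp_mul (hG : X.Normal G) (hv : ∀ n, HoldsAt G n) (hSd : FDeg 𝒜 𝒜 0 S)
    (hS : conv G.mul G.comul S one = const (X.counit.smulRight X.e))
    (hS' : conv G.mul G.comul one S = const (X.counit.smulRight X.e)) :
    S ⊚ G.mul = G.mul ⊚ const (swap 𝒜) ⊚ (S ⊠ S) := by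
  have := conv_assoc (mul_mul_of_holdsAt hv) (G.comul2_coassoc (comul_coassoc_of_holdsAt hv)) (S ⊚ G.mul) G.mul
    (G.mul ⊚ const (swap 𝒜) ⊚ (S ⊠ S))
  rwa [conv_antipode_mul hG hv hS, conv_mul_antipode hG hv hSd hS',
    counit_conv hG.e_mul (evL_comul2 hG), conv_counit hG.mul_e (evR_comul2 hG), eq_comm] at this

end DGHopfAlgebra

/-! ### The deformation -/

namespace DGHopfAlgebra

open FormalMap PreHopf

variable {k : Type u} [Field k] {H : Type v} [AddCommGroup H] [Module k H]
  {𝒜 : ℕ → Submodule k H}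

theorem pair_mul_mem {m : H ⊗[k] H →ₗ[k] H} (hm : IsDeg (gt 𝒜 𝒜) 𝒜 0 m) (p : ℕ) :
    ∀ x ∈ tensorGr 𝒜 1 p, m ((pair k H).symm x) ∈ 𝒜 p := by
  have key : ∀ (𝒢 : ℕ → Submodule k (H ⊗[k] H)) (s : H ⊗[k] H →ₗ[k] H ⊗[k] H),
      tensorGr 𝒜 1 = 𝒢 → (pair k H).symm.toLinearMap = s →
      (∀ x ∈ 𝒢 p, m (s x) ∈ 𝒜 p) → ∀ x ∈ tensorGr 𝒜 1 p, m ((pair k H).symm x) ∈ 𝒜 p := by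
    rintro _ _ rfl rfl h; exact h
  exact key _ _ (tensorGr_one 𝒜) (pair_symm_eq k H) fun x hx => hm p x hx

theorem pair_comul_mem {c : H →ₗ[k] H ⊗[k] H} (hc : IsDeg 𝒜 (gt 𝒜 𝒜) 0 c) (p : ℕ) :
    ∀ x ∈ 𝒜 p, pair k H (c x) ∈ tensorGr 𝒜 1 p := by
  have key : ∀ (𝒢 : ℕ → Submodule k (H ⊗[k] H)) (s : H ⊗[k] H →ₗ[k] H ⊗[k] H),
      tensorGr 𝒜 1 = 𝒢 → (pair k H).toLinearMap = s →
      (∀ x ∈ 𝒜 p, s (c x) ∈ 𝒢 p) → ∀ x ∈ 𝒜 p, pair k H (c x) ∈ tensorGr 𝒜 1 p := by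
    rintro _ _ rfl rfl h; exact h
  exact key _ _ (tensorGr_one 𝒜) (pair_eq k H) fun x hx => hc p x hx

variable [DirectSum.Decomposition 𝒜] {X : DGHopfAlgebra 𝒜} {G : PreHopf 𝒜}

theorem app_unit (s : ℕ → k) : app (const X.unit) s = sm s (ser X.e) := by
  have : X.unit = (LinearMap.id : k →ₗ[k] k).smulRight X.e := LinearMap.ext fun c => X.unit_eq c
  rw [this, app_smulRight]
  congr 1
  exact app_one s

/-- A formal differential graded bialgebra that lifts `X` is a Hopf algebra. -/
def toFormal (hG : X.Normal G) (hv : ∀ n, HoldsAt G n) {S : FormalMap k H H}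
    (hSd : FDeg 𝒜 𝒜 0 S) (hS : conv G.mul G.comul S one = const (X.counit.smulRight X.e))
    (hS' : conv G.mul G.comul one S = const (X.counit.smulRight X.e)) :
    FormalDGHopfAlgebra 𝒜 where
  d := G.d
  mul := G.mul
  -- Normalization of the coefficients allows the unit and the counit to stay undeformed.
  unit := const X.unit
  comul := G.comul
  counit := const X.counit
  antipode := S
  d_deg := G.d_deg
  mul_deg n := pair_mul_mem (G.mul_deg n)
  unit_deg n c := by
    by_cases h : n = 0
    · subst h; exact X.unit_deg c
    · rw [const_succ _ h]; exact zero_mem _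
  comul_deg n := pair_comul_mem (G.comul_deg n)
  counit_deg n p hp x hx := by
    by_cases h : n = 0
    · subst h; exact X.counit_deg p hp x hx
    · rw [const_succ _ h]; rfl
  antipode_deg := hSd
  d_comp_d := funext fun n => (hv n).sq
  mul_assoc := ext₂₁ fun x y z => by simp [mul_mul_of_holdsAt hv]
  unit_mul := ext_app fun x => by
    have h : const (TensorProduct.lid k H).symm.toLinearMap = const (TensorProduct.mk k k H 1) :=
      rfl
    rw [h, app_comp, app_comp, app_const_mk, app_tmap, app_unit, sm_ser_left, one_smul, app_one,
      hG.e_mul]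
  mul_unit := ext_app fun x => by
    have h : const (TensorProduct.rid k H).symm.toLinearMap =
      const ((TensorProduct.mk k H k).flip 1) := rfl
    rw [h, app_comp, app_comp, app_const_mk_flip, app_tmap, app_unit, sm_ser_left, one_smul,
      app_one, hG.mul_e]
  d_mul := sub_eq_zero.1 (funext fun n => (hv n).leib)
  comul_coassoc := comul_coassoc_of_holdsAt hv
  counit_comul := ext_app fun x => by
    have h : const (TensorProduct.lid k H).toLinearMap ⊚ (const X.counit ⊠ one) =
        const (evL H X.counit) := by rw [one, const_tmap_const, const_comp_const]; rfl
    rw [app_comp, app_comp, ← app_comp _ (const X.counit ⊠ one), h, hG.evL_comul, app_one]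
  comul_counit := ext_app fun x => by
    have h : const (TensorProduct.rid k H).toLinearMap ⊚ (one ⊠ const X.counit) =
        const (evR H X.counit) := by rw [one, const_tmap_const, const_comp_const]; rfl
    rw [app_comp, app_comp, ← app_comp _ (one ⊠ const X.counit), h, hG.evR_comul, app_one]
  comul_d := sub_eq_zero.1 (funext fun n => (hv n).coleib)
  comul_mul := comul_mul_of_holdsAt hv
  comul_unit := ext_app fun s => by
    have h : const (TensorProduct.lid k k).symm.toLinearMap = const (TensorProduct.mk k k k 1) :=
      rfl
    rw [h, app_comp, app_comp, app_unit, app_sm, hG.comul_e, app_const_mk, app_tmap, app_unit,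
      app_unit, sm_ser_left, one_smul, st_sm_right]
  counit_mul := ext₂ fun x y => by
    rw [app_comp, app_comp, hG.counit_mul, app_tmap, app_lid]
  counit_unit := by rw [const_comp_const, X.counit_unit]; rfl
  antipode_left := by
    rw [const_comp_const, unit_comp_counit, ← hS]; rfl
  antipode_right := by
    rw [const_comp_const, unit_comp_counit, ← hS']; rfl
  antipode_mul := antipode_comp_mul hG hv hSd hS hS'

end DGHopfAlgebra

end DGH

end

/-! ### The extension theorem. -/

theorem mainTheorem6 {k : Type*} [Field k] {H : Type*} [AddCommGroup H] [Module k H]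
    (𝒜 : ℕ → Submodule k H) [DirectSum.Decomposition 𝒜] (X : DGH.DGHopfAlgebra 𝒜)
    (hX : Subsingleton (X.Cohomology 3))
    (d₁ : H →ₗ[k] H) (μ₁ : H ⊗[k] H →ₗ[k] H) (Δ₁ : H →ₗ[k] H ⊗[k] H)
    (hc : DGH.DGHopfAlgebra.infinitesimal k H d₁ μ₁ Δ₁ ∈ X.cocycles 2) :
    ∃ Y : DGH.FormalDGHopfAlgebra 𝒜, DGH.IsDeformation X Y ∧
      Y.d 1 = d₁ ∧ Y.mul 1 = μ₁ ∧ Y.comul 1 = Δ₁ := by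
  obtain ⟨G, hG, hv, hd, hm, hΔ⟩ := DGH.DGHopfAlgebra.exists_bialgebra hX d₁ μ₁ Δ₁ hc
  obtain ⟨S, hSd, hS, hS'⟩ := DGH.DGHopfAlgebra.exists_antipode hG hv
  exact ⟨DGH.DGHopfAlgebra.toFormal hG hv hSd hS hS', ⟨hG.d_zero, hG.mul_zero, hG.comul_zero⟩,
    hd, hm, hΔ⟩
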